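/- All graphs are finite and simple. For $n\ge k>2a\ge 2$ let $H_{n,k,a}$ be the $n$-vertex graph whose vertex set is partitioned into $A,B,C$ with $|A|=a$, $|B|=n-k+a$, $|C|=k-2a$, and whose edges are all pairs between $A$ and $B$ and all pairs inside $A\cup C$; let $h(n,k,a)=\binom{k-a}{2}+a(n-k+a)$ be its number of edges. For given $k$ put $t=\lfloor (k-1)/2\rfloor$. Define the following classes of $n$-vertex graphs (up to isomorphism); $N(v)$ is the neighborhood of $v$ and, for a vertex set $S$, $N(S)$ is the set of vertices outside $S$ with a neighbor in $S$. $\mathcal G_1(n,k)=\{H_{n,k,t}\}$. $\mathcal G_2(n,k)$: graphs $G$ with a partition $V(G)=A\cup B\cup J$, $|A|=t$, and $a_1\in A$, $b_1\in B$, such that $G[A]$ is complete, $B$ is independent, all edges between $A$ and $B$ are present, and $N(c)=\{a_1,b_1\}$ for every $c\in J$. $\mathcal G_3(n,k)$: graphs $G$ with a partition $V(G)=A\cup B\cup J$, $|A|=t$, such that $G[A]$ is complete, $B$ is independent, all edges between $A$ and $B$ are present, $G[J]$ has more than one component, every component of $G[J]$ is a star with at least two vertices, there is a two-element set $A'\subseteq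 A$ with $N(J)\cap(A\cup B)=A'$, and for every component $S$ of $G[J]$ with at least three vertices there is a vertex $a(S)\in A'$ that is the only neighbor in $A'$ of each leaf of $S$. For $A\subseteq V(G)$, a set $S\subseteq V(G)\setminus A$ is a $J_3$-bridge of $A$ with endpoints $a_1,a_2$ if $a_1\ne a_2$ are in $A$, all neighbors of $S$ in $A$ belong to $\{a_1,a_2\}$, $\{a_1,a_2\}$ is a cutset of $G$, the graph $G[S\cup\{a_1,a_2\}]$ together with the edge $a_1a_2$ is 2-connected, $G[S]$ is connected, and the longest $a_1,a_2$-path in $G[S\cup\{a_1,a_2\}]$ has length three. Each class $\mathcal G_i(n,8)$, $5\le i\le 8$, consists of 2-connected $n$-vertex graphs $G$ with no cycle of length at least $8$ that have a set $A=\{a_1,\dots,a_s\}$ of $s$ distinct vertices such that $G[A]$ is complete, every component of $G-A$ is a $J_3$-bridge of $A$ or an isolated vertex with exactly two neighbors in $A$, and moreover $\mathcal G_5(n,8)$: $s=3$ and $a_1$ has a neighbor in each component of $G-A$; $\mathcal G_6(n,8)$: $s=4$, the endpoints of all $J_3$-bridges are $a_1,a_2$, and some isolated vertex $c$ of $G-A$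 is adjacent to $a_1$; $\mathcal G_7(n,8)$: $s=4$, the endpoints of all $J_3$-bridges are $a_1,a_2$, and $N(c)=\{a_3,a_4\}$ for every isolated vertex $c$ of $G-A$; $\mathcal G_8(n,8)$: $s=5$ and $N(S)=\{a_1,a_2\}$ for each component $S$ of $G-A$. Let $\mathcal G(n,4)=\emptyset$, $\mathcal G(n,5)=\mathcal G_1(n,5)$, $\mathcal G(n,6)=\mathcal G_1(n,6)\cup\mathcal G_2(n,6)$, $\mathcal G(n,7)=\{H_{n,7,3}\}\cup\mathcal G_1(n,6)\cup\mathcal G_2(n,6)\cup\mathcal G_3(n,6)$, and $\mathcal G(n,8)=\bigcup_{1\le i\le 8,\ i\ne 4}\mathcal G_i(n,8)$. Theorem. Let $4\le k\le 8$, $n\ge k$, and let $G$ be a 2-connected $n$-vertex graph with no cycle of length at least $k$. Then either $7\le k\le 8$ and $e(G)\le h(n,k,t-1)$, or $G$ is a subgraph of a graph in $\mathcal G(n,k)$. In particular, this describes all 2-connected graphs with no cycle of length at least $6$: a 2-connected graph on $n\ge 6$ vertices has no cycle of length at least $6$ if and only if it is a subgraph of a graph in $\mathcal G(n,6)$. 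-/

import Mathlib

namespace LongCycles

universe u

variable {V : Type u}

/-- A graph is 2-connected: at least three vertices, connected, and it stays connected when any
one vertex is deleted. -/
def TwoConnected (G : SimpleGraph V) : Prop :=
  3 ≤ Nat.card V ∧ G.Connected ∧ ∀ v : V, (G.induce ({v}ᶜ : Set V)).Connected

/-- `G` has no cycle of length at least `k`. -/
def NoLongCycle (G : SimpleGraph V) (k : ℕ) : Prop :=
  ∀ (v : V) (p : G.Walk v v), p.IsCycle → p.length < k

/-- `h(n,k,a)`, the number of edges of `H_{n,k,a}` (meant for `n ≥ k > 2a`). -/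
def h (n k a : ℕ) : ℕ := (k - a).choose 2 + a * (n - k + a)

/-- `S` is the vertex set of a connected component of the induced subgraph `G[W]`. -/
def IsComponent (G : SimpleGraph V) (W S : Set V) : Prop :=
  S ⊆ W ∧ (G.induce S).Connected ∧ ∀ u ∈ S, ∀ v ∈ W, G.Adj u v → v ∈ S

/-- All edges between the vertex sets `X` and `Y` are present. -/
def CompleteBetween (G : SimpleGraph V) (X Y : Set V) : Prop :=
  ∀ x ∈ X, ∀ y ∈ Y, G.Adj x y

/-- `V` is partitioned into the (possibly empty) sets `X`, `Y`, `Z`. -/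
def IsPartition₃ (X Y Z : Set V) : Prop :=
  X ∪ Y ∪ Z = Set.univ ∧ Disjoint X Y ∧ Disjoint X Z ∧ Disjoint Y Z

/-- `G` is (a copy of) `H_{n,k,a}`: the edges are all pairs between `A` and `B` and all pairs
inside `A ∪ C`. -/
def IsH (n k a : ℕ) (G : SimpleGraph V) : Prop :=
  ∃ A B C : Set V, IsPartition₃ A B C ∧
    A.ncard = a ∧ B.ncard = n - k + a ∧ C.ncard = k - 2 * a ∧
    ∀ u v : V, G.Adj u v ↔ u ≠ v ∧
      ((u ∈ A ∧ v ∈ B) ∨ (u ∈ B ∧ v ∈ A) ∨ (u ∈ A ∪ C ∧ v ∈ A ∪ C))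

/-- `t = ⌊(k-1)/2⌋`. -/
def tOf (k : ℕ) : ℕ := (k - 1) / 2

/-- The class `𝒢₁(n,k)`, on the vertex set `V`. -/
def class1 (V : Type u) (n k : ℕ) : Set (SimpleGraph V) :=
  {G | Nat.card V = n ∧ IsH n k (tOf k) G}

/-- The class `𝒢₂(n,k)`, on the vertex set `V`. -/
def class2 (V : Type u) (n k : ℕ) : Set (SimpleGraph V) :=
  {G | Nat.card V = n ∧ ∃ A B J : Set V, IsPartition₃ A B J ∧ A.ncard = tOf k ∧
    ∃ a₁ ∈ A, ∃ b₁ ∈ B,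
      G.IsClique A ∧ G.IsIndepSet B ∧ CompleteBetween G A B ∧
      ∀ c ∈ J, G.neighborSet c = {a₁, b₁}}

/-- `G[S]` is a star with center `z` and leaf set `S \ {z}`. -/
def IsStarAt (G : SimpleGraph V) (S : Set V) (z : V) : Prop :=
  z ∈ S ∧ ∀ u ∈ S, ∀ v ∈ S, (G.Adj u v ↔ u ≠ v ∧ (u = z ∨ v = z))

/-- The class `𝒢₃(n,k)`, on the vertex set `V`. In the last condition the leaves of a component
with at least three vertices have one and the same vertex as their only neighbor in `A'`. -/
def class3 (V : Type u) (n k : ℕ) : Set (SimpleGraph V) :=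
  {G | Nat.card V = n ∧ ∃ A B J : Set V, IsPartition₃ A B J ∧ A.ncard = tOf k ∧
    G.IsClique A ∧ G.IsIndepSet B ∧ CompleteBetween G A B ∧
    (∃ S T : Set V, S ≠ T ∧ IsComponent G J S ∧ IsComponent G J T) ∧
    (∀ S : Set V, IsComponent G J S → 2 ≤ S.ncard ∧ ∃ z, IsStarAt G S z) ∧
    ∃ A' : Set V, A' ⊆ A ∧ A'.ncard = 2 ∧
      {v | v ∈ A ∪ B ∧ ∃ c ∈ J, G.Adj c v} = A' ∧
      ∀ S : Set V, IsComponent G J S → 3 ≤ S.ncard → ∀ z, IsStarAt G S z →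
        ∃ a ∈ A', ∀ c ∈ S \ {z}, ∀ v ∈ A', (G.Adj c v ↔ v = a)}

/-- `S` forms a `J₃`-bridge of `A` with endpoints `a₁, a₂`. -/
structure IsJ3Bridge (G : SimpleGraph V) (A S : Set V) (a₁ a₂ : V) : Prop where
  disjoint : Disjoint S A
  left_mem : a₁ ∈ A
  right_mem : a₂ ∈ A
  ne : a₁ ≠ a₂
  /-- the neighbors of `S` in `A` are among the endpoints -/
  attach : ∀ s ∈ S, ∀ a ∈ A, G.Adj s a → a = a₁ ∨ a = a₂
  /-- `{a₁, a₂}` is a cutset of `G` -/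
  cutset : ¬ (G.induce (({a₁, a₂} : Set V)ᶜ)).Preconnected
  /-- `G[S ∪ {a₁, a₂}]` together with the edge `a₁a₂` is 2-connected -/
  twoConnected : TwoConnected ((G ⊔ SimpleGraph.edge a₁ a₂).induce (S ∪ {a₁, a₂}))
  connected : (G.induce S).Connected
  /-- the longest `a₁,a₂`-path in `G[S ∪ {a₁, a₂}]` has length three -/
  exists_path : ∃ p : G.Walk a₁ a₂, p.IsPath ∧ (∀ v ∈ p.support, v ∈ S ∪ {a₁, a₂}) ∧ p.length = 3
  path_le : ∀ p : G.Walk a₁ a₂, p.IsPath → (∀ v ∈ p.support, v ∈ S ∪ {a₁, a₂}) → p.length ≤ 3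

/-- `c` is an isolated vertex of `G - A` (all its neighbors in `G` are in `A`). -/
def IsolatedOutside (G : SimpleGraph V) (A : Set V) (c : V) : Prop :=
  c ∉ A ∧ G.neighborSet c ⊆ A

/-- What the classes `𝒢₅(n,8)`, …, `𝒢₈(n,8)` have in common: `G` is a 2-connected `n`-vertex
graph with `c(G) < 8`, `G[A]` is complete, and `G - A` consists of `J₃`-bridges of `A` and
isolated vertices having exactly two neighbors in `A`. -/
def HasSpecialSet (n : ℕ) (G : SimpleGraph V) (A : Set V) : Prop :=
  Nat.card V = n ∧ TwoConnected G ∧ NoLongCycle G 8 ∧ G.IsClique A ∧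
  ∀ S : Set V, IsComponent G Aᶜ S →
    (∃ c, S = {c} ∧ (G.neighborSet c ∩ A).ncard = 2) ∨ ∃ a a', IsJ3Bridge G A S a a'

/-- The class `𝒢₅(n,8)`, on the vertex set `V`. -/
def class5 (V : Type u) (n : ℕ) : Set (SimpleGraph V) :=
  {G | ∃ a₁ a₂ a₃ : V, [a₁, a₂, a₃].Nodup ∧ HasSpecialSet n G {a₁, a₂, a₃} ∧
    ∀ S : Set V, IsComponent G ({a₁, a₂, a₃}ᶜ) S → ∃ s ∈ S, G.Adj a₁ s}

/-- The endpoints of all `J₃`-bridges of `A` among the components of `G - A` are `a₁, a₂`. -/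
def BridgesAt (G : SimpleGraph V) (A : Set V) (a₁ a₂ : V) : Prop :=
  ∀ (S : Set V) (a a' : V), IsComponent G Aᶜ S → IsJ3Bridge G A S a a' →
    ({a, a'} : Set V) = {a₁, a₂}

/-- The class `𝒢₆(n,8)`, on the vertex set `V`. -/
def class6 (V : Type u) (n : ℕ) : Set (SimpleGraph V) :=
  {G | ∃ a₁ a₂ a₃ a₄ : V, [a₁, a₂, a₃, a₄].Nodup ∧ HasSpecialSet n G {a₁, a₂, a₃, a₄} ∧
    BridgesAt G {a₁, a₂, a₃, a₄} a₁ a₂ ∧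
    ∃ c, IsolatedOutside G {a₁, a₂, a₃, a₄} c ∧ G.Adj c a₁}

/-- The class `𝒢₇(n,8)`, on the vertex set `V`. -/
def class7 (V : Type u) (n : ℕ) : Set (SimpleGraph V) :=
  {G | ∃ a₁ a₂ a₃ a₄ : V, [a₁, a₂, a₃, a₄].Nodup ∧ HasSpecialSet n G {a₁, a₂, a₃, a₄} ∧
    BridgesAt G {a₁, a₂, a₃, a₄} a₁ a₂ ∧
    ∀ c, IsolatedOutside G {a₁, a₂, a₃, a₄} c → G.neighborSet c = {a₃, a₄}}

/-- The class `𝒢₈(n,8)`, on the vertex set `V`. -/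
def class8 (V : Type u) (n : ℕ) : Set (SimpleGraph V) :=
  {G | ∃ a₁ a₂ a₃ a₄ a₅ : V, [a₁, a₂, a₃, a₄, a₅].Nodup ∧
    HasSpecialSet n G {a₁, a₂, a₃, a₄, a₅} ∧
    ∀ S : Set V, IsComponent G ({a₁, a₂, a₃, a₄, a₅}ᶜ) S →
      {v | v ∉ S ∧ ∃ s ∈ S, G.Adj s v} = {a₁, a₂}}

/-- The class `𝒢(n,k)` for `4 ≤ k ≤ 8`, on the vertex set `V` (it is used for these `k` only). -/
def extremalClass (V : Type u) (n : ℕ) : ℕ → Set (SimpleGraph V)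
  | 4 => ∅
  | 5 => class1 V n 5
  | 6 => class1 V n 6 ∪ class2 V n 6
  | 7 => {G | Nat.card V = n ∧ IsH n 7 3 G} ∪ class1 V n 6 ∪ class2 V n 6 ∪ class3 V n 6
  | 8 => class1 V n 8 ∪ class2 V n 8 ∪ class3 V n 8 ∪ class5 V n ∪ class6 V n ∪ class7 V n ∪
      class8 V n
  | _ => ∅

end LongCycles

/-!
Graphs without long cycles.

**Reduction to edge-maximal graphs.** Adding edges as long as no cycle of length `k` or more appears
only enlarges `G`, so `G` may be taken edge-maximal (`exists_saturated`). Then the two vertices of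
every 2-vertex cut are adjacent: otherwise a long path would join them, on one side of the cut, and a
path through the other side would close it to a long cycle (`Saturated.cutsAdjacent`).

**Graphs without 2-vertex cuts.** If such a graph has a longest cycle of length at most seven and a
vertex off it, then this vertex is adjacent to every other vertex of an arc of the cycle, since
consecutive attachments of a component off the cycle are at distance at least two
(`NoCut.off_cycle`). Hence the cycle has length six or seven, and an exchange argument shows that all
vertices except three, and possibly two more, are adjacent to exactly these three
(`NoCut.exists_triple`, `NoCut.exists_triple_pair`). In particular there is a 2-vertex cut `{x, y}`
if `k ≤ 6`.

**Two-vertex cuts.** Paths from `x` to `y` through different components of `G - {x, y}` form a cycle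
(`NoLongCycle.links_lt`), and a component that is not a single vertex carries such a path of length
at least three. So only short paths remain: a component all of whose paths from `x` to `y` have
length at most three is a vertex, an edge, or a star whose leaves have one and the same neighbor
outside (`IsComponent.pair_or_star`). This settles `k ≤ 6`, and also `k = 7` if two components
contain edges. For `k = 8`, if two components contain edges, then at most one component `D` has a
path `x, u, v, w, y` of length four, and none has a longer one (`BigComponent`). The vertices of `D`
off this path are classified by their neighbors on it (`BigComponent.types`); the outcome is one of
the classes with a special set, or a vertex of `D` that meets all edges inside `D`
(`BigComponent.classify`). In the latter case, and if all paths from `x` to `y` are short, `G` is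
contained in a graph of one of the first three classes (`exists_class_of_center`). No assumption on
the number of edges is needed here.

**No separation with edges on both sides.** For `k = 7, 8` there may remain graphs in which no
2-vertex cut has edges on both sides. If such a graph has a 2-vertex cut, it has a vertex of degree
two with adjacent neighbors (`exists_degree_two`). Deleting these vertices one by one ends with a
graph without 2-vertex cuts, where three vertices have many common neighbors, or with a graph on `k`
vertices, which has too few edges: a graph on `m` vertices with at most `m - 4` nonadjacent pairs has
Hamiltonian paths between all pairs of vertices (`exists_hamiltonian_link`). Each deletion loses two
edges, the slope of `h(n, 7, 2) = 2 n` and `h(n, 8, 2) = 2 n + 3`, so more edges than that are enough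
to start with. When the vertices are put back, the three vertices with their many common neighbors
restrict the remaining edges so strongly that their shape does not change (`step_seven`,
`step_single`, `step_star`): none for `k = 7`, an edge or a star for `k = 8`.

**The converse for `k = 6`.** In the graphs of the two classes any six consecutive vertices of a
cycle can be followed by hand (`noLongCycle_of_mem_class1`, `noLongCycle_of_mem_class2`).
-/

namespace LongCycles

universe u

variable {V : Type u} {G : SimpleGraph V}

/-! ### Paths as lists, components and attachments -/

/-- `x, l, y` is a walk whose inner vertices form the list `l` without repetitions, all of them
in `S`; its length is `l.length + 1`. That `x` and `y` are distinct and not in `l` is not part of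
the definition; usually it holds because they are not in `S`. -/
structure Link (G : SimpleGraph V) (S : Set V) (x y : V) (l : List V) : Prop where
  nodup : l.Nodup
  mem : ∀ z ∈ l, z ∈ S
  chain : (x :: (l ++ [y])).IsChain G.Adj

theorem Link.reverse {S : Set V} {x y : V} {l : List V} (h : Link G S x y l) :
    Link G S y x l.reverse where
  nodup := List.nodup_reverse.2 h.nodup
  mem z hz := h.mem z (List.mem_reverse.1 hz)
  chain := by
    rw [show y :: (l.reverse ++ [x]) = (x :: (l ++ [y])).reverse by simp, List.isChain_reverse]
    exact h.chain.imp fun _ _ h => G.adj_symm h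

theorem Link.mono {S T : Set V} {x y : V} {l : List V} (h : Link G S x y l) (hST : S ⊆ T) :
    Link G T x y l := ⟨h.nodup, fun z hz => hST (h.mem z hz), h.chain⟩

theorem Link.append {S T : Set V} {x y z : V} {l m : List V} (hl : Link G S x y l)
    (hm : Link G T y z m) (hST : ∀ v ∈ l, v ∉ m) (hyl : y ∉ l) (hym : y ∉ m) :
    Link G (S ∪ T ∪ {y}) x z (l ++ y :: m) where
  nodup := by
    have := hl.nodup
    have := hm.nodup
    simp only [List.nodup_append, List.nodup_cons, List.mem_cons]
    grind
  mem v hv := by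
    have := hl.mem v
    have := hm.mem v
    simp only [List.mem_append, List.mem_cons] at hv
    simp only [Set.mem_union, Set.mem_singleton_iff]
    tauto
  chain := by
    have h1 := hl.chain
    have h2 := hm.chain
    have : x :: ((l ++ y :: m) ++ [z]) = (x :: l) ++ y :: (m ++ [z]) := by simp
    rw [this, List.isChain_split]
    exact ⟨by simpa using h1, h2⟩

theorem exists_walk_of_chain {x y : V} : ∀ {l : List V}, (x :: (l ++ [y])).IsChain G.Adj →
    ∃ p : G.Walk x y, p.support = x :: (l ++ [y]) ∧ p.length = l.length + 1 := by
  intro l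
  induction l generalizing x with
  | nil =>
    intro h
    have h : G.Adj x y := by simpa using h
    exact ⟨.cons h .nil, by simp, by simp⟩
  | cons a l ih =>
    intro h
    simp only [List.cons_append, List.isChain_cons_cons] at h
    obtain ⟨p, hp, hl⟩ := ih h.2
    exact ⟨.cons h.1 p, by simp [hp], by simp [hl]⟩

/-- A closed chain `x, l, x` without repetitions is a cycle. -/
theorem NoLongCycle.length_lt {k : ℕ} (h : NoLongCycle G k) {x : V} {l : List V}
    (hn : (x :: l).Nodup) (hc : (x :: (l ++ [x])).IsChain G.Adj) (h2 : 2 ≤ l.length) :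
    l.length + 1 < k := by
  match l, h2 with
  | a :: b :: l, _ =>
    simp only [List.cons_append, List.isChain_cons_cons] at hc
    have hc2 : (a :: ((b :: l) ++ [x])).IsChain G.Adj := by simp [hc.2]
    obtain ⟨p, hp, hl⟩ := exists_walk_of_chain hc2
    have hpp : p.IsPath := by
      rw [SimpleGraph.Walk.isPath_def, hp]
      simp only [List.nodup_cons, List.mem_cons, List.cons_append, List.nodup_append,
        List.mem_append] at hn ⊢
      grind
    have hcyc : (SimpleGraph.Walk.cons hc.1 p).IsCycle := by
      rw [SimpleGraph.Walk.cons_isCycle_iff]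
      refine ⟨hpp, fun he => ?_⟩
      cases p with
      | nil => simp at hl
      | cons h' q =>
        rw [SimpleGraph.Walk.cons_isPath_iff] at hpp
        rw [SimpleGraph.Walk.edges_cons, List.mem_cons] at he
        rcases he with he | he
        · rw [Sym2.eq_swap, Sym2.eq_iff] at he
          have : q.length = 0 := by
            rcases he with ⟨_, he⟩ | ⟨he, _⟩
            · subst he
              exact SimpleGraph.Walk.length_eq_zero_iff.2 (SimpleGraph.Walk.isPath_iff_nil.1 hpp.1)
            · exact absurd he (G.ne_of_adj h')
          simp [this] at hl
        · exact hpp.2 (SimpleGraph.Walk.snd_mem_support_of_mem_edges q he)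
    have := h _ _ hcyc
    simp only [SimpleGraph.Walk.length_cons, hl] at this
    simpa using this

/-- Two paths with the same ends and disjoint interiors form a cycle. -/
theorem NoLongCycle.link_link {k : ℕ} (h : NoLongCycle G k) {S T : Set V} {x y : V}
    {l m : List V} (hl : Link G S x y l) (hm : Link G T x y m) (hST : ∀ v ∈ l, v ∉ m)
    (hxy : x ≠ y) (hxl : x ∉ l) (hxm : x ∉ m) (hyl : y ∉ l) (hym : y ∉ m)
    (h1 : 1 ≤ l.length + m.length) : l.length + m.length + 2 < k := by
  have h3 := hl.append hm.reverse (fun v hv hv' => hST v hv (List.mem_reverse.1 hv')) hyl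
    (by simpa using hym)
  have := h.length_lt (x := x) (l := l ++ y :: m.reverse)
    (List.nodup_cons.2 ⟨by simp [hxl, hxm, hxy], h3.nodup⟩) h3.chain (by simp; omega)
  simp at this
  omega

/-- In a connected set `W`, an edge leaves every set that contains some but not all of `W`. -/
theorem exists_crossing {W S : Set V} (h : (G.induce W).Preconnected) {a b : V} (ha : a ∈ W)
    (hb : b ∈ W) (haS : a ∈ S) (hbS : b ∉ S) :
    ∃ u v, u ∈ W ∧ v ∈ W ∧ u ∈ S ∧ v ∉ S ∧ G.Adj u v := by
  obtain ⟨p⟩ := h ⟨a, ha⟩ ⟨b, hb⟩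
  obtain ⟨d, -, h1, h2⟩ := p.exists_boundary_dart (Subtype.val ⁻¹' S) haS hbS
  exact ⟨d.fst, d.snd, d.fst.2, d.snd.2, h1, h2, d.adj⟩

theorem exists_crossing_of_connected {S : Set V} (h : G.Connected) {a b : V} (haS : a ∈ S)
    (hbS : b ∉ S) : ∃ u v, u ∈ S ∧ v ∉ S ∧ G.Adj u v := by
  obtain ⟨p⟩ := h.preconnected a b
  obtain ⟨d, -, h1, h2⟩ := p.exists_boundary_dart S haS hbS
  exact ⟨d.fst, d.snd, h1, h2, d.adj⟩

theorem preconnected_of_reachable {S : Set V} {w : V} (hw : w ∈ S)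
    (h : ∀ u (hu : u ∈ S), (G.induce S).Reachable ⟨w, hw⟩ ⟨u, hu⟩) : (G.induce S).Connected :=
  { preconnected := fun a b => (h a a.2).symm.trans (h b b.2)
    nonempty := ⟨⟨w, hw⟩⟩ }

theorem exists_isComponent {W : Set V} {w : V} (hw : w ∈ W) :
    ∃ S, w ∈ S ∧ IsComponent G W S := by
  let r : V → V → Prop := fun a b => G.Adj a b ∧ b ∈ W
  refine ⟨{u | Relation.ReflTransGen r w u}, .refl, ?_, ?_, ?_⟩
  · intro u hu
    rcases Relation.ReflTransGen.cases_tail hu with h | ⟨c, -, h⟩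
    · exact h ▸ hw
    · exact h.2
  · refine preconnected_of_reachable (w := w) .refl fun u hu => ?_
    have hu' : Relation.ReflTransGen r w u := hu
    induction hu' with
    | refl => exact .rfl
    | tail h1 h2 ih =>
      refine (ih h1).trans (SimpleGraph.Adj.reachable ?_)
      exact h2.1
  · intro u hu v hv huv
    exact Relation.ReflTransGen.tail hu ⟨huv, hv⟩

theorem IsComponent.nonempty {W S : Set V} (h : IsComponent G W S) : S.Nonempty := by
  obtain ⟨⟨a, ha⟩⟩ := h.2.1.nonempty
  exact ⟨a, ha⟩

theorem IsComponent.subset_of_mem {W S T : Set V} (hS : IsComponent G W S)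
    (hT : ∀ u ∈ T, ∀ v ∈ W, G.Adj u v → v ∈ T) {a : V} (haS : a ∈ S) (haT : a ∈ T) : S ⊆ T := by
  intro b hb
  by_contra hbT
  obtain ⟨u, v, hu, hv, huT, hvT, huv⟩ := exists_crossing hS.2.1.preconnected haS hb haT hbT
  exact hvT (hT u huT v (hS.1 hv) huv)

theorem IsComponent.eq_of_mem {W S T : Set V} (hS : IsComponent G W S) (hT : IsComponent G W T)
    {a : V} (haS : a ∈ S) (haT : a ∈ T) : S = T :=
  (hS.subset_of_mem hT.2.2 haS haT).antisymm (hT.subset_of_mem hS.2.2 haT haS)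

/-- A connected set contains a path between any two of its vertices. -/
theorem exists_link {W : Set V} (h : (G.induce W).Preconnected) {a b x y : V} (ha : a ∈ W)
    (hb : b ∈ W) (hxa : G.Adj x a) (hby : G.Adj b y) :
    ∃ l, Link G W x y l ∧ 1 ≤ l.length ∧ (a ≠ b → 2 ≤ l.length) := by
  classical
  obtain ⟨p⟩ := h ⟨a, ha⟩ ⟨b, hb⟩
  set q := p.bypass
  have hq : q.IsPath := p.bypass_isPath
  have hchain : (q.support.map Subtype.val).IsChain G.Adj :=
    List.isChain_map_of_isChain Subtype.val (fun _ _ h => h) q.isChain_adj_support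
  have hlen : (q.support.map Subtype.val).length = q.length + 1 := by simp
  refine ⟨q.support.map Subtype.val, ⟨?_, ?_, ?_⟩, by omega, fun hab => ?_⟩
  · exact hq.support_nodup.map Subtype.val_injective
  · intro z hz
    obtain ⟨z', -, rfl⟩ := List.mem_map.1 hz
    exact z'.2
  · rw [List.isChain_cons, List.isChain_append]
    refine ⟨?_, hchain, by simp, ?_⟩
    · intro z hz
      rw [List.head?_append, List.head?_map, List.head?_eq_some_head q.support_ne_nil] at hz
      simp at hz
      exact hz ▸ hxa
    · intro z hz z' hz'
      rw [List.getLast?_map, List.getLast?_eq_some_getLast q.support_ne_nil] at hz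
      simp at hz hz'
      exact hz ▸ hz' ▸ hby
  · have : q.length ≠ 0 := fun h0 => hab (by
      have := SimpleGraph.Walk.eq_of_length_eq_zero h0
      simpa using this)
    omega

/-- In a 2-connected graph, the edges leaving a nonempty set that misses at least two vertices have
at least two ends outside. -/
theorem TwoConnected.exists_two_attachments (h : TwoConnected G) {K : Set V} {o₁ o₂ : V}
    (hK : K.Nonempty) (ho₁ : o₁ ∉ K) (ho₂ : o₂ ∉ K) (hne : o₁ ≠ o₂) :
    ∃ k k' o o', k ∈ K ∧ k' ∈ K ∧ o ∉ K ∧ o' ∉ K ∧ o ≠ o' ∧ G.Adj k o ∧ G.Adj k' o' := by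
  obtain ⟨a, ha⟩ := hK
  obtain ⟨k, o, hk, ho, hko⟩ := exists_crossing_of_connected h.2.1 ha ho₁
  obtain ⟨o₃, ho₃, hne₃⟩ : ∃ o₃, o₃ ∉ K ∧ o₃ ≠ o := by
    by_cases h1 : o₁ = o
    · exact ⟨o₂, ho₂, fun h2 => hne (h1.trans h2.symm)⟩
    · exact ⟨o₁, ho₁, h1⟩
  obtain ⟨k', o', -, h1, hk', ho', hko'⟩ := exists_crossing (S := K) (h.2.2 o).preconnected
    (a := a) (b := o₃) (fun hh => ho (hh ▸ ha)) hne₃ ha ho₃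
  exact ⟨k, k', o, o', hk, hk', ho, ho', fun hh => h1 hh.symm, hko, hko'⟩

/-- In a 2-connected graph, two disjoint edges leave every set of at least two vertices that
misses at least two vertices. -/
theorem TwoConnected.exists_disjoint_edges (h : TwoConnected G) {K : Set V} {o₁ o₂ k₁ k₂ : V}
    (hk₁ : k₁ ∈ K) (hk₂ : k₂ ∈ K) (hk : k₁ ≠ k₂) (ho₁ : o₁ ∉ K) (ho₂ : o₂ ∉ K) (hne : o₁ ≠ o₂) :
    ∃ k k' o o', k ∈ K ∧ k' ∈ K ∧ o ∉ K ∧ o' ∉ K ∧ k ≠ k' ∧ o ≠ o' ∧ G.Adj k o ∧ G.Adj k' o' := by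
  obtain ⟨k, k', o, o', hk', hk'', ho, ho', hoo, h1, h2⟩ :=
    h.exists_two_attachments ⟨k₁, hk₁⟩ ho₁ ho₂ hne
  by_cases hkk : k = k'
  · subst hkk
    obtain ⟨k₃, hk₃, hne₃⟩ : ∃ k₃, k₃ ∈ K ∧ k₃ ≠ k := by
      by_cases h1 : k₁ = k
      · exact ⟨k₂, hk₂, fun h2 => hk (h1.trans h2.symm)⟩
      · exact ⟨k₁, hk₁, h1⟩
    obtain ⟨u, v, hu, hv, huK, hvK, huv⟩ := exists_crossing (S := K) (h.2.2 k).preconnected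
      (a := k₃) (b := o) hne₃ (fun hh => ho (hh ▸ hk')) hk₃ ho
    by_cases hvo : v = o
    · exact ⟨u, k, v, o', huK, hk', hvK, ho', hu, by grind, huv, h2⟩
    · exact ⟨u, k, v, o, huK, hk', hvK, ho, hu, hvo, huv, h1⟩
  · exact ⟨k, k', o, o', hk', hk'', ho, ho', hkk, hoo, h1, h2⟩

/-! ### Separations by two vertices -/

/-- `S` avoids `x` and `y`, and all neighbors of `S` outside `S` are among `x` and `y`: it is a
union of components of `G - {x, y}`. -/
structure ClosedOff (G : SimpleGraph V) (S : Set V) (x y : V) : Prop where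
  left : x ∉ S
  right : y ∉ S
  adj : ∀ u ∈ S, ∀ v, G.Adj u v → v ∈ S ∨ v = x ∨ v = y

theorem ClosedOff.swap {S : Set V} {x y : V} (h : ClosedOff G S x y) : ClosedOff G S y x :=
  ⟨h.right, h.left, fun u hu v huv => (h.adj u hu v huv).imp_right Or.symm⟩

theorem ClosedOff.compl {S : Set V} {x y : V} (h : ClosedOff G S x y) :
    ClosedOff G {v | v ∉ S ∧ v ≠ x ∧ v ≠ y} x y := by
  refine ⟨by simp, by simp, fun u hu v huv => ?_⟩
  have := h.adj v
  have := huv.symm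
  simp only [Set.mem_ofPred_eq] at hu ⊢
  grind

theorem IsComponent.closedOff {S : Set V} {x y : V} (h : IsComponent G {x, y}ᶜ S) :
    ClosedOff G S x y := by
  refine ⟨fun hx => h.1 hx (by simp), fun hy => h.1 hy (by simp), fun u hu v huv => ?_⟩
  have := h.2.2 u hu v
  simp only [Set.mem_compl_iff, Set.mem_insert_iff, Set.mem_singleton_iff] at this
  tauto

theorem ClosedOff.isComponent {S : Set V} {x y : V} (h : ClosedOff G S x y)
    (hS : (G.induce S).Connected) : IsComponent G {x, y}ᶜ S := by
  refine ⟨fun u hu => ?_, hS, fun u hu v hv huv => ?_⟩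
  · have := h.left
    have := h.right
    simp only [Set.mem_compl_iff, Set.mem_insert_iff, Set.mem_singleton_iff]
    grind
  · have := h.adj u hu v huv
    simp only [Set.mem_compl_iff, Set.mem_insert_iff, Set.mem_singleton_iff] at hv
    tauto

theorem ClosedOff.exists_isComponent {S : Set V} {x y w : V} (h : ClosedOff G S x y)
    (hw : w ∈ S) : ∃ T, w ∈ T ∧ T ⊆ S ∧ IsComponent G {x, y}ᶜ T := by
  have hwxy : w ∈ ({x, y}ᶜ : Set V) := by
    have := h.left
    have := h.right
    simp only [Set.mem_compl_iff, Set.mem_insert_iff, Set.mem_singleton_iff]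
    grind
  obtain ⟨T, hwT, hT⟩ := LongCycles.exists_isComponent (G := G) hwxy
  refine ⟨T, hwT, hT.subset_of_mem (fun u hu v hv huv => ?_) hwT hw, hT⟩
  have := h.adj u hu v huv
  simp only [Set.mem_compl_iff, Set.mem_insert_iff, Set.mem_singleton_iff] at hv
  tauto

/-- In a 2-connected graph, a component of `G - {x, y}` carries a path from `x` to `y`, of length
at least three if the component is not a single vertex. -/
theorem ClosedOff.exists_link_of_connected {S : Set V} {x y : V} (h : ClosedOff G S x y)
    (h2 : TwoConnected G) (hxy : x ≠ y) (hS : (G.induce S).Connected) :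
    ∃ l, Link G S x y l ∧ 1 ≤ l.length ∧ (S.Nontrivial → 2 ≤ l.length) := by
  obtain ⟨⟨a, ha⟩⟩ := hS.nonempty
  obtain ⟨k, k', o, o', hk, hk', ho, ho', hoo, h1, h2, h3⟩ : ∃ k k' o o', k ∈ S ∧ k' ∈ S ∧
      o ∉ S ∧ o' ∉ S ∧ o ≠ o' ∧ G.Adj k o ∧ G.Adj k' o' ∧ (S.Nontrivial → k ≠ k') := by
    by_cases hn : S.Nontrivial
    · obtain ⟨k₁, hk₁, k₂, hk₂, hk⟩ := hn
      obtain ⟨k, k', o, o', hk, hk', ho, ho', hkk, hoo, h1, h2⟩ :=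
        h2.exists_disjoint_edges hk₁ hk₂ hk h.left h.right hxy
      exact ⟨k, k', o, o', hk, hk', ho, ho', hoo, h1, h2, fun _ => hkk⟩
    · obtain ⟨k, k', o, o', hk, hk', ho, ho', hoo, h1, h2⟩ :=
        h2.exists_two_attachments ⟨a, ha⟩ h.left h.right hxy
      exact ⟨k, k', o, o', hk, hk', ho, ho', hoo, h1, h2, fun hh => absurd hh hn⟩
  have e1 := h.adj k hk o h1
  have e2 := h.adj k' hk' o' h2
  obtain ⟨l, hl, hl1, hl2⟩ := exists_link hS.preconnected hk hk' h1.symm h2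
  rcases e1.resolve_left ho with rfl | rfl
  · rcases e2.resolve_left ho' with rfl | rfl
    · exact absurd rfl hoo
    · exact ⟨l, hl, hl1, fun hn => hl2 (h3 hn)⟩
  · rcases e2.resolve_left ho' with rfl | rfl
    · exact ⟨l.reverse, hl.reverse, by simpa using hl1, fun hn => by simpa using hl2 (h3 hn)⟩
    · exact absurd rfl hoo

theorem ClosedOff.exists_link {S : Set V} {x y : V} (h : ClosedOff G S x y)
    (h2 : TwoConnected G) (hxy : x ≠ y) (hS : S.Nonempty) :
    ∃ l, Link G S x y l ∧ 1 ≤ l.length := by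
  obtain ⟨w, hw⟩ := hS
  obtain ⟨T, -, hTS, hT⟩ := h.exists_isComponent hw
  obtain ⟨l, hl, hl1, -⟩ := hT.closedOff.exists_link_of_connected h2 hxy hT.2.1
  exact ⟨l, hl.mono hTS, hl1⟩

/-- If no step of a chain enters or leaves `S`, the chain lies in `S` as soon as it meets it. -/
theorem forall_mem_of_isChain {R : V → V → Prop} {S : Set V} {l : List V} (hl : l.IsChain R)
    (hR : ∀ a ∈ l, ∀ b ∈ l, R a b → (a ∈ S ↔ b ∈ S)) {a : V} (ha : a ∈ l) (haS : a ∈ S) :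
    ∀ b ∈ l, b ∈ S := by
  suffices h : ∀ a ∈ l, ∀ b ∈ l, (a ∈ S ↔ b ∈ S) from fun b hb => (h a ha b hb).1 haS
  clear ha haS
  induction l with
  | nil => simp
  | cons c l ih =>
    have ih' := ih hl.of_cons (fun a ha b hb => hR a (by simp [ha]) b (by simp [hb]))
    cases l with
    | nil => simp
    | cons d l =>
      have hcd := hR c (by simp) d (by simp) hl.rel
      intro a ha b hb
      rw [List.mem_cons] at ha hb
      have h1 := ih' d (by simp)
      rcases ha with rfl | ha <;> rcases hb with rfl | hb
      · rfl
      · exact hcd.trans (h1 b hb)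
      · exact (hcd.trans (h1 a ha)).symm
      · exact ih' a ha b hb

/-- The interior of a path from `x` to `y` lies in `S` as soon as it meets `S`. -/
theorem ClosedOff.link_of_mem {S T : Set V} {x y x' y' : V} (h : ClosedOff G S x y) {l : List V}
    (hl : Link G T x' y' l) (hx : x ∉ l) (hy : y ∉ l) {a : V} (ha : a ∈ l) (haS : a ∈ S) :
    Link G S x' y' l := by
  refine ⟨hl.nodup, forall_mem_of_isChain (R := G.Adj) ?_ (fun b hb c hc hbc => ?_) ha haS,
    hl.chain⟩
  · exact (List.isChain_append.1 hl.chain.of_cons).1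
  · have := h.adj b
    have := h.adj c
    have := hbc.symm
    grind

/-! ### Cycles as periodic sequences -/

/-- `c 0, …, c (m - 1)` is a cycle of length `m`, continued periodically. -/
structure PeriodicCycle (G : SimpleGraph V) (m : ℕ) (c : ℕ → V) : Prop where
  three_le : 3 ≤ m
  periodic : ∀ i, c (i + m) = c i
  ne : ∀ i j, i < j → j < i + m → c i ≠ c j
  adj : ∀ i, G.Adj (c i) (c (i + 1))

theorem PeriodicCycle.shift {m : ℕ} {c : ℕ → V} (h : PeriodicCycle G m c) (r : ℕ) :
    PeriodicCycle G m (fun i => c (r + i)) where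
  three_le := h.three_le
  periodic i := by rw [← Nat.add_assoc]; exact h.periodic _
  ne i j hij hji := h.ne _ _ (by omega) (by omega)
  adj i := h.adj _

theorem exists_periodicCycle {v : V} {p : G.Walk v v} (hp : p.IsCycle) :
    ∃ c, PeriodicCycle G p.length c := by
  have h3 := hp.three_le_length
  have hinj : ∀ i j, i % p.length ≠ j % p.length →
      p.getVert (i % p.length) ≠ p.getVert (j % p.length) := fun i j hij he => hij <| by
    have h1 := Nat.mod_lt i (show 0 < p.length by omega)
    have h2 := Nat.mod_lt j (show 0 < p.length by omega)
    exact hp.getVert_injOn' (by simp only [Set.mem_ofPred_eq]; omega)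
      (by simp only [Set.mem_ofPred_eq]; omega) he
  refine ⟨fun i => p.getVert (i % p.length), h3, fun i => by simp, fun i j hij hji => hinj i j ?_,
    fun i => ?_⟩
  · intro he
    have := (Nat.modEq_iff_dvd' hij.le).1 he
    have := Nat.le_of_dvd (by omega) this
    omega
  · have h1 := Nat.mod_lt i (show 0 < p.length by omega)
    have h2 := p.adj_getVert_succ h1
    by_cases h : i % p.length + 1 = p.length
    · have h0 : (i + 1) % p.length = 0 := by
        rw [Nat.add_mod, Nat.mod_eq_of_lt (show 1 < p.length by omega), h, Nat.mod_self]
      rw [h0, p.getVert_zero]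
      rwa [h, p.getVert_length] at h2
    · have h0 : (i + 1) % p.length = i % p.length + 1 := by
        rw [Nat.add_mod, Nat.mod_eq_of_lt (show 1 < p.length by omega)]
        exact Nat.mod_eq_of_lt (by omega)
      rwa [h0]

theorem exists_periodicCycle_of_not_noLongCycle {k : ℕ} (h : ¬ NoLongCycle G k) :
    ∃ m c, k ≤ m ∧ PeriodicCycle G m c := by
  simp only [NoLongCycle, not_forall, not_lt] at h
  obtain ⟨v, p, hp, hk⟩ := h
  obtain ⟨c, hc⟩ := exists_periodicCycle hp
  exact ⟨_, c, hk, hc⟩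

/-- The list `c i, …, c (i + n - 1)`. -/
def arc (c : ℕ → V) (i n : ℕ) : List V := (List.range n).map fun t => c (i + t)

theorem length_arc (c : ℕ → V) (i n : ℕ) : (arc c i n).length = n := by simp [arc]

theorem mem_arc {c : ℕ → V} {i n : ℕ} {v : V} : v ∈ arc c i n ↔ ∃ t < n, c (i + t) = v := by
  simp [arc]

theorem arc_succ (c : ℕ → V) (i n : ℕ) : arc c i (n + 1) = arc c i n ++ [c (i + n)] := by
  simp [arc, List.range_succ]

theorem arc_succ' (c : ℕ → V) (i n : ℕ) : arc c i (n + 1) = c i :: arc c (i + 1) n := by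
  simp only [arc, List.range_succ_eq_map, List.map_cons, List.map_map, Nat.add_zero]
  congr 2
  funext t
  simp only [Function.comp_apply, Nat.succ_eq_add_one]
  congr 1
  omega

/-- A stretch of consecutive terms of a sequence is a path. Adjacency is required only for the steps
of the stretch: for `Saturated.exists_link`, the rest of the cycle contains an edge not in `G`. -/
theorem link_arc {n i : ℕ} {c : ℕ → V}
    (hne : ∀ s t, s < t → t < n → c (i + 1 + s) ≠ c (i + 1 + t))
    (hadj : ∀ t ≤ n, G.Adj (c (i + t)) (c (i + t + 1))) :
    Link G {v | ∃ t < n, c (i + 1 + t) = v} (c i) (c (i + 1 + n)) (arc c (i + 1) n) where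
  nodup := by
    refine List.Nodup.map_on (fun s hs t ht hst => ?_) List.nodup_range
    rw [List.mem_range] at hs ht
    by_contra hne'
    rcases lt_or_gt_of_ne hne' with h | h
    · exact hne s t h ht hst
    · exact hne t s h hs hst.symm
  mem z hz := mem_arc.1 hz
  chain := by
    rw [← arc_succ, ← arc_succ', arc, List.isChain_map, List.isChain_range]
    intro t ht
    exact hadj t (by omega)

theorem PeriodicCycle.link_arc {m n : ℕ} {c : ℕ → V} (h : PeriodicCycle G m c) (hn : n ≤ m)
    (i : ℕ) :
    Link G {v | ∃ t < n, c (i + 1 + t) = v} (c i) (c (i + 1 + n)) (arc c (i + 1) n) :=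
  LongCycles.link_arc (fun _ _ h1 h2 => h.ne _ _ (by omega) (by omega))
    (fun _ _ => h.adj _)

theorem PeriodicCycle.length_lt {k m : ℕ} {c : ℕ → V} (h : PeriodicCycle G m c)
    (hk : NoLongCycle G k) : m < k := by
  have h3 := h.three_le
  have h1 := h.link_arc (n := m - 1) (by omega) 0
  have e : c (0 + 1 + (m - 1)) = c 0 := by
    rw [show 0 + 1 + (m - 1) = 0 + m by omega]; exact h.periodic 0
  rw [e] at h1
  have := hk.length_lt (x := c 0) (l := arc c (0 + 1) (m - 1)) (List.nodup_cons.2 ⟨?_, h1.nodup⟩)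
    h1.chain (by rw [length_arc]; omega)
  · rw [length_arc] at this
    omega
  · rw [mem_arc]
    rintro ⟨t, ht, he⟩
    exact h.ne 0 (0 + 1 + t) (by omega) (by omega) he.symm

/-! ### Edge-maximal graphs without long cycles -/

/-- `G` has no cycle of length at least `k`, but every additional edge creates one. -/
def Saturated (G : SimpleGraph V) (k : ℕ) : Prop :=
  NoLongCycle G k ∧ ∀ a b, a ≠ b → ¬ G.Adj a b → ¬ NoLongCycle (G ⊔ SimpleGraph.edge a b) k

theorem exists_saturated [Finite V] {k : ℕ} (h : NoLongCycle G k) :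
    ∃ H, G ≤ H ∧ Saturated H k := by
  obtain ⟨H, hGH, hH⟩ :=
    (Set.toFinite {H : SimpleGraph V | NoLongCycle H k}).exists_le_maximal h
  refine ⟨H, hGH, hH.prop, fun a b hab hn hno => hn ?_⟩
  have := hH.le_of_ge hno le_sup_left
  exact this (by simp [SimpleGraph.edge_adj, hab])

/-- The long cycle created by an additional edge contains this edge. -/
theorem Saturated.exists_cycle {k : ℕ} (h : Saturated G k) {a b : V} (hab : a ≠ b)
    (hn : ¬ G.Adj a b) : ∃ m c, k ≤ m ∧ PeriodicCycle (G ⊔ SimpleGraph.edge a b) m c ∧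
      ∃ i, (c i = a ∧ c (i + 1) = b) ∨ (c i = b ∧ c (i + 1) = a) := by
  obtain ⟨m, c, hkm, hc⟩ := exists_periodicCycle_of_not_noLongCycle (h.2 a b hab hn)
  refine ⟨m, c, hkm, hc, ?_⟩
  by_contra hi
  push Not at hi
  have : PeriodicCycle G m c := ⟨hc.three_le, hc.periodic, hc.ne, fun i => by
    have h1 := hc.adj i
    rw [SimpleGraph.sup_adj, SimpleGraph.edge_adj] at h1
    have := hi i
    grind⟩
  exact absurd (this.length_lt h.1) (by omega)

/-- In an edge-maximal graph, two nonadjacent vertices are joined by a long path. -/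
theorem Saturated.exists_link {k : ℕ} (h : Saturated G k) {a b : V} (hab : a ≠ b)
    (hn : ¬ G.Adj a b) :
    ∃ l, Link G Set.univ a b l ∧ a ∉ l ∧ b ∉ l ∧ k ≤ l.length + 2 := by
  obtain ⟨m, c, hkm, hc, i, hi⟩ := h.exists_cycle hab hn
  have h3 := hc.three_le
  have e : c (i + 1 + 1 + (m - 2)) = c i := by
    rw [show i + 1 + 1 + (m - 2) = i + m by omega]; exact hc.periodic i
  have ha : c i ∉ arc c (i + 1 + 1) (m - 2) := by
    rw [mem_arc]
    rintro ⟨t, ht, he⟩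
    exact hc.ne i (i + 1 + 1 + t) (by omega) (by omega) he.symm
  have hb : c (i + 1) ∉ arc c (i + 1 + 1) (m - 2) := by
    rw [mem_arc]
    rintro ⟨t, ht, he⟩
    exact hc.ne (i + 1) (i + 1 + 1 + t) (by omega) (by omega) he.symm
  have hadj : ∀ t ≤ m - 2, G.Adj (c (i + 1 + t)) (c (i + 1 + t + 1)) := by
    intro t ht
    have h1 := hc.adj (i + 1 + t)
    rw [SimpleGraph.sup_adj, SimpleGraph.edge_adj] at h1
    refine h1.resolve_right fun h2 => ?_
    have h4 := hc.ne i (i + 1 + t) (by omega) (by omega)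
    by_cases h0 : t = 0
    · subst h0
      have := hc.ne i (i + 1 + 0 + 1) (by omega) (by omega)
      grind
    · have := hc.ne (i + 1) (i + 1 + t) (by omega) (by omega)
      grind
  have hl := (link_arc (G := G) (n := m - 2) (i := i + 1)
    (fun s t _ _ => hc.ne _ _ (by omega) (by omega)) hadj).mono (Set.subset_univ _)
  rw [e] at hl
  rcases hi with ⟨rfl, rfl⟩ | ⟨rfl, rfl⟩
  · exact ⟨_, hl.reverse, by simpa using ha, by simpa using hb, by
      rw [List.length_reverse, length_arc]; omega⟩
  · exact ⟨_, hl, hb, ha, by rw [length_arc]; omega⟩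

/-- The two vertices of every 2-vertex cut are adjacent. -/
def CutsAdjacent (G : SimpleGraph V) : Prop :=
  ∀ (x y : V) (S : Set V), x ≠ y → ClosedOff G S x y → S.Nonempty →
    (∃ t, t ∉ S ∧ t ≠ x ∧ t ≠ y) → G.Adj x y

/-- If `x` and `y` were not adjacent, there would be a long path between them; it runs on one side
of the cut, and a path through the other side closes it to a longer cycle. -/
theorem Saturated.cutsAdjacent {k : ℕ} (h : Saturated G k) (h2 : TwoConnected G) (hk : 3 ≤ k) :
    CutsAdjacent G := by
  rintro x y S hxy hS hne ⟨t, ht⟩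
  by_contra hn
  obtain ⟨l, hl, hxl, hyl, hkl⟩ := h.exists_link hxy hn
  have key : ∀ (S : Set V), ClosedOff G S x y → (∃ t, t ∉ S ∧ t ≠ x ∧ t ≠ y) →
      ∀ a ∈ l, a ∉ S := by
    rintro S hS ⟨t, ht⟩ a ha haS
    have hl' := hS.link_of_mem hl hxl hyl ha haS
    obtain ⟨l', hl'', h1⟩ := hS.compl.exists_link h2 hxy ⟨t, ht⟩
    have := h.1.link_link hl' hl'' (fun v hv hv' => (hl''.mem v hv').1 (hl'.mem v hv)) hxy hxl
      (fun hx => (hl''.mem x hx).2.1 rfl) hyl (fun hy => (hl''.mem y hy).2.2 rfl) (by omega)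
    omega
  cases l with
  | nil => simp at hkl; omega
  | cons a l =>
    have h1 := key S hS ⟨t, ht⟩ a (by simp)
    obtain ⟨s, hs⟩ := hne
    refine key _ hS.compl ⟨s, by simp [hs], fun hh => hS.left (hh ▸ hs),
      fun hh => hS.right (hh ▸ hs)⟩ a (by simp) ⟨h1, ?_, ?_⟩
    · rintro rfl; simp at hxl
    · rintro rfl; simp at hyl

theorem TwoConnected.mono {H : SimpleGraph V} (h : TwoConnected G) (hGH : G ≤ H) :
    TwoConnected H :=
  ⟨h.1, h.2.1.mono hGH, fun v => (h.2.2 v).mono (SimpleGraph.comap_monotone _ hGH)⟩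

/-! ### Longest cycles in graphs without 2-vertex cuts -/

/-- No two vertices separate `G`. -/
def NoCut (G : SimpleGraph V) : Prop :=
  ∀ (x y : V) (S : Set V), x ≠ y → ClosedOff G S x y → S.Nonempty → ∀ t, t ∈ S ∨ t = x ∨ t = y

theorem PeriodicCycle.eq_of_mod_eq {m : ℕ} {c : ℕ → V} (h : PeriodicCycle G m c) {i j : ℕ}
    (hij : i % m = j % m) : c i = c j := by
  have hp : Function.Periodic c m := h.periodic
  rw [← hp.map_mod_nat i, hij, hp.map_mod_nat]

theorem PeriodicCycle.ne_of_mod_ne {m : ℕ} {c : ℕ → V} (h : PeriodicCycle G m c) {i j : ℕ}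
    (hij : i % m ≠ j % m) : c i ≠ c j := by
  have hp : Function.Periodic c m := h.periodic
  have h3 := h.three_le
  have h1 := Nat.mod_lt i (show 0 < m by omega)
  have h2 := Nat.mod_lt j (show 0 < m by omega)
  rw [← hp.map_mod_nat i, ← hp.map_mod_nat j]
  rcases lt_or_gt_of_ne hij with h' | h'
  · exact h.ne _ _ h' (by omega)
  · exact (h.ne _ _ h' (by omega)).symm

/-- A vertex off the cycle that is adjacent to two vertices at distance two on it can take the
place of the vertex between them. -/
theorem PeriodicCycle.replace {m : ℕ} {c : ℕ → V} (h : PeriodicCycle G m c) {d : V}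
    (hd : ∀ i, c i ≠ d) {r : ℕ} (h1 : G.Adj d (c r)) (h2 : G.Adj d (c (r + 2))) :
    PeriodicCycle G m (fun i => if i % m = (r + 1) % m then d else c i) where
  three_le := h.three_le
  periodic i := by simp [h.periodic i]
  ne i j hij hji := by
    have hne : i % m ≠ j % m := by
      intro he
      have := (Nat.modEq_iff_dvd' hij.le).1 he
      have := Nat.le_of_dvd (by omega) this
      omega
    have := h.ne i j hij hji
    have := hd i
    have := hd j
    grind
  adj i := by
    by_cases hi : (i + 1) % m = (r + 1) % m
    · have hir : i % m = r % m := Nat.ModEq.add_right_cancel' 1 hi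
      have hne : i % m ≠ (r + 1) % m := by
        rw [hir]
        intro he
        have h3 := h.three_le
        have := (Nat.modEq_iff_dvd' (show r ≤ r + 1 by omega)).1 he
        have := Nat.le_of_dvd (by omega) this
        omega
      rw [if_neg hne, if_pos hi, h.eq_of_mod_eq hir]
      exact h1.symm
    · rw [if_neg hi]
      by_cases hi' : i % m = (r + 1) % m
      · rw [if_pos hi']
        have : (i + 1) % m = (r + 1 + 1) % m := Nat.ModEq.add_right 1 hi'
        rw [h.eq_of_mod_eq this]
        exact h2
      · rw [if_neg hi']
        exact h.adj i

/-- A path off a longest cycle between two of its vertices is no longer than the arc it avoids. -/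
theorem PeriodicCycle.detour {m : ℕ} {c : ℕ → V} (h : PeriodicCycle G m c)
    (hm : NoLongCycle G (m + 1)) {i j : ℕ} (hij : i < j) (hji : j < i + m) {S : Set V} {l : List V}
    (hl : Link G S (c i) (c j) l) (hS : ∀ t, c t ∉ S) (h1 : 1 ≤ l.length) : l.length < j - i := by
  have hl' := h.link_arc (n := i + m - j - 1) (by omega) j
  have e : c (j + 1 + (i + m - j - 1)) = c i := by
    rw [show j + 1 + (i + m - j - 1) = i + m by omega]; exact h.periodic i
  rw [e] at hl'
  have hd : ∀ t, c t ∉ l := fun t ht => hS t (hl.mem _ ht)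
  have := hm.link_link hl hl'.reverse ?_ (h.ne i j hij hji) (hd i) ?_ (hd j) ?_ (by omega)
  · rw [List.length_reverse, length_arc] at this
    omega
  · intro v hv hv'
    rw [List.mem_reverse, mem_arc] at hv'
    obtain ⟨t, -, rfl⟩ := hv'
    exact hd _ hv
  · rw [List.mem_reverse, mem_arc]
    rintro ⟨t, ht, he⟩
    rw [← h.periodic i] at he
    exact h.ne _ _ (by omega) (by omega) he
  · rw [List.mem_reverse, mem_arc]
    rintro ⟨t, ht, he⟩
    exact h.ne j (j + 1 + t) (by omega) (by omega) he.symm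

/-- The components off a longest cycle of length at most seven, in a graph without 2-vertex cuts,
are single vertices, adjacent to every other vertex of an arc of the cycle. -/
theorem NoCut.off_cycle {m : ℕ} {c : ℕ → V} (hno : NoCut G) (h2 : TwoConnected G)
    (h : PeriodicCycle G m c) (hm : NoLongCycle G (m + 1)) (hm7 : m ≤ 7) {d : V}
    (hd : ∀ i, c i ≠ d) :
    6 ≤ m ∧ ∃ r, ∀ v, G.Adj d v ↔ v = c r ∨ v = c (r + 2) ∨ v = c (r + 4) := by
  have h3 := h.three_le
  obtain ⟨K, hdK, hK⟩ := exists_isComponent (G := G) (W := {v | ∀ i, c i ≠ v}) hd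
  have hcK : ∀ t, c t ∉ K := fun t ht => hK.1 ht t rfl
  have hatt : ∀ k ∈ K, ∀ o, o ∉ K → G.Adj k o → ∃ i, c i = o := by
    intro k hk o ho hko
    by_contra hn
    push Not at hn
    exact ho (hK.2.2 k hk o hn hko)
  have hgap : ∀ i j k k', i < j → j < i + m → k ∈ K → k' ∈ K → G.Adj k (c i) → G.Adj k' (c j) →
      i + 2 ≤ j ∧ (k ≠ k' → i + 3 ≤ j) := by
    intro i j k k' hij hji hk hk' hki hkj
    obtain ⟨l, hl, hl1, hl2⟩ := exists_link hK.2.1.preconnected hk hk' hki.symm hkj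
    have := h.detour hm hij hji hl hcK hl1
    exact ⟨by omega, fun hn => by have := hl2 hn; omega⟩
  let P : ℕ → Prop := fun i => ∃ k ∈ K, G.Adj k (c i)
  have hPper : ∀ i, P (i + m) ↔ P i := fun i => by simp only [P, h.periodic]
  have hPgap : ∀ i j, i < j → j < i + m → P i → P j → i + 2 ≤ j :=
    fun i j hij hji ⟨k, hk, hki⟩ ⟨k', hk', hkj⟩ => (hgap i j k k' hij hji hk hk' hki hkj).1
  -- three attachments
  have key : ∃ i j l, i < m ∧ j < m ∧ l < m ∧ i ≠ j ∧ i ≠ l ∧ j ≠ l ∧ P i ∧ P j ∧ P l := by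
    have hred : ∀ o, (∃ i, c i = o) → ∃ i < m, c i = o := by
      rintro o ⟨i, rfl⟩
      exact ⟨i % m, Nat.mod_lt _ (by omega), h.eq_of_mod_eq (Nat.mod_mod _ _)⟩
    obtain ⟨k, k', o, o', hk, hk', ho, ho', hoo, hko, hko'⟩ :=
      h2.exists_two_attachments ⟨d, hdK⟩ (hcK 0) (hcK 1) (h.ne 0 1 (by omega) (by omega))
    obtain ⟨i, him, rfl⟩ := hred o (hatt k hk o ho hko)
    obtain ⟨j, hjm, rfl⟩ := hred o' (hatt k' hk' o' ho' hko')
    by_contra hcon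
    have hcl : ClosedOff G K (c i) (c j) := by
      refine ⟨ho, ho', fun u hu v huv => ?_⟩
      by_contra hv
      push Not at hv
      obtain ⟨l, hlm, rfl⟩ := hred v (hatt u hu v hv.1 huv)
      exact hcon ⟨i, j, l, him, hjm, hlm, fun hh => hoo (by rw [hh]),
        fun hh => hv.2.1 (by rw [hh]), fun hh => hv.2.2 (by rw [hh]),
        ⟨k, hk, hko⟩, ⟨k', hk', hko'⟩, ⟨u, hu, huv⟩⟩
    have hall := hno _ _ K hoo hcl ⟨d, hdK⟩
    have hij : i ≠ j := fun hh => hoo (by rw [hh])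
    obtain ⟨t, htm, hti, htj⟩ : ∃ t, t < m ∧ t ≠ i ∧ t ≠ j := by
      by_cases h0 : 0 = i ∨ 0 = j
      · by_cases h1 : 1 = i ∨ 1 = j
        · exact ⟨2, by omega, by omega, by omega⟩
        · exact ⟨1, by omega, by omega, by omega⟩
      · exact ⟨0, by omega, by omega, by omega⟩
    rcases hall (c t) with hh | hh | hh
    · exact hcK t hh
    · refine h.ne_of_mod_ne ?_ hh
      rwa [Nat.mod_eq_of_lt htm, Nat.mod_eq_of_lt him]
    · refine h.ne_of_mod_ne ?_ hh
      rwa [Nat.mod_eq_of_lt htm, Nat.mod_eq_of_lt hjm]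
  have key2 : 6 ≤ m ∧ ∃ r, P r ∧ P (r + 2) ∧ P (r + 4) := by
    -- the gaps between the attachments are at least two and add up to `m ≤ 7`
    have sorted : ∀ i j l, i < j → j < l → l < m → P i → P j → P l →
        6 ≤ m ∧ ∃ r, P r ∧ P (r + 2) ∧ P (r + 4) := by
      intro i j l hij hjl hlm hi hj hl
      have g1 := hPgap i j hij (by omega) hi hj
      have g2 := hPgap j l hjl (by omega) hj hl
      have g3 := hPgap l (i + m) (by omega) (by omega) hl ((hPper i).2 hi)
      refine ⟨by omega, ?_⟩
      by_cases e1 : j = i + 2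
      · by_cases e2 : l = i + 4
        · exact ⟨i, hi, e1 ▸ hj, e2 ▸ hl⟩
        · refine ⟨l, hl, ?_, ?_⟩
          · rw [show l + 2 = i + m by omega]; exact (hPper i).2 hi
          · rw [show l + 4 = j + m by omega]; exact (hPper j).2 hj
      · refine ⟨j, hj, ?_, ?_⟩
        · rwa [show j + 2 = l by omega]
        · rw [show j + 4 = i + m by omega]; exact (hPper i).2 hi
    obtain ⟨i, j, l, him, hjm, hlm, hij, hil, hjl, hi, hj, hl⟩ := key
    rcases lt_or_gt_of_ne hij with h1 | h1 <;> rcases lt_or_gt_of_ne hil with h2 | h2 <;>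
      rcases lt_or_gt_of_ne hjl with h3 | h3 <;>
      first
        | omega
        | exact sorted _ _ _ h1 h3 (by omega) hi hj hl
        | exact sorted _ _ _ h2 h3 (by omega) hi hl hj
        | exact sorted _ _ _ h1 h2 (by omega) hj hi hl
        | exact sorted _ _ _ h3 h2 (by omega) hj hl hi
        | exact sorted _ _ _ h2 h1 (by omega) hl hi hj
        | exact sorted _ _ _ h3 h1 (by omega) hl hj hi
  obtain ⟨h6, r, ⟨k₁, hk₁, e1⟩, ⟨k₂, hk₂, e2⟩, ⟨k₃, hk₃, e3⟩⟩ := key2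
  have h12 : k₁ = k₂ := by
    by_contra hne
    have := (hgap r (r + 2) k₁ k₂ (by omega) (by omega) hk₁ hk₂ e1 e2).2 hne
    omega
  have h23 : k₂ = k₃ := by
    by_contra hne
    have := (hgap (r + 2) (r + 4) k₂ k₃ (by omega) (by omega) hk₂ hk₃ e2 e3).2 hne
    omega
  subst h12 h23
  -- every edge between the component and the cycle is one of these three
  have hedge : ∀ k ∈ K, ∀ i, G.Adj k (c i) →
      k = k₁ ∧ (c i = c r ∨ c i = c (r + 2) ∨ c i = c (r + 4)) := by
    intro k hk i hki
    obtain ⟨j, hjr, hjm, hj⟩ : ∃ j, r ≤ j ∧ j < r + m ∧ c j = c i := by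
      have hp := Nat.mod_lt (i + m * r - r) (show 0 < m by omega)
      refine ⟨r + (i + m * r - r) % m, by omega, by omega, h.eq_of_mod_eq ?_⟩
      have : r ≤ m * r := Nat.le_mul_of_pos_left r (by omega)
      rw [Nat.add_mod_mod, show r + (i + m * r - r) = i + m * r by omega, Nat.add_mul_mod_self_left]
    rw [← hj] at hki ⊢
    have e4 : G.Adj k₁ (c (r + m)) := by rwa [h.periodic]
    have hcase : j = r ∨ j = r + 2 ∨ j = r + 4 := by
      have g1 : r < j → _ := fun hh => (hgap r j k₁ k hh (by omega) hk₁ hk e1 hki).1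
      have g2 : r + 2 < j → _ :=
        fun hh => (hgap (r + 2) j k₁ k hh (by omega) hk₁ hk e2 hki).1
      have g3 : r + 4 < j → _ :=
        fun hh => (hgap (r + 4) j k₁ k hh (by omega) hk₁ hk e3 hki).1
      have g4 : r < j → _ :=
        fun hh => (hgap j (r + m) k k₁ (by omega) (by omega) hk hk₁ hki e4).1
      have g5 : j < r + 4 → _ :=
        fun hh => (hgap j (r + 4) k k₁ hh (by omega) hk hk₁ hki e3).1
      have g6 : j < r + 2 → _ :=
        fun hh => (hgap j (r + 2) k k₁ hh (by omega) hk hk₁ hki e2).1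
      by_contra hcon
      by_cases hr : r < j
      · have := g1 hr
        have := g4 hr
        by_cases hr2 : r + 2 < j
        · have := g2 hr2
          by_cases hr4 : r + 4 < j
          · have := g3 hr4; omega
          · have := g5 (by omega); omega
        · have := g6 (by omega); omega
      · omega
    rcases hcase with rfl | rfl | rfl
    · refine ⟨?_, by simp⟩
      by_contra hne
      have := (hgap j (j + 2) k k₁ (by omega) (by omega) hk hk₁ hki e2).2 hne
      omega
    · refine ⟨?_, by simp⟩
      by_contra hne
      have := (hgap (r + 2) (r + 4) k k₁ (by omega) (by omega) hk hk₁ hki e3).2 hne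
      omega
    · refine ⟨?_, by simp⟩
      by_contra hne
      have := (hgap (r + 2) (r + 4) k₁ k (by omega) (by omega) hk₁ hk e2 hki).2 (Ne.symm hne)
      omega
  have hKeq : ∀ k ∈ K, k = k₁ := by
    intro k hk
    by_contra hne
    obtain ⟨k, k', o, o', hk, hk', ho, ho', hkk, -, hko, hko'⟩ :=
      h2.exists_disjoint_edges hk hk₁ hne (hcK 0) (hcK 1) (h.ne 0 1 (by omega) (by omega))
    obtain ⟨i, rfl⟩ := hatt k hk o ho hko
    obtain ⟨j, rfl⟩ := hatt k' hk' o' ho' hko'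
    exact hkk ((hedge k hk i hko).1.trans (hedge k' hk' j hko').1.symm)
  have hdk := hKeq d hdK
  subst hdk
  refine ⟨h6, r, fun v => ⟨fun hv => ?_, ?_⟩⟩
  · by_cases hvK : v ∈ K
    · exact absurd (hKeq v hvK ▸ hv) (G.irrefl)
    · obtain ⟨i, rfl⟩ := hatt d hdK v hvK hv
      exact (hedge d hdK i hv).2
  · rintro (rfl | rfl | rfl) <;> assumption

/-! ### The graphs without 2-vertex cuts -/

/-- If `d` is adjacent to `c 0`, `c 2`, `c 4` on a longest cycle `c` of length six, then `d` can be
exchanged with `c 1`, `c 3` or `c 5`, which therefore have the same three neighbors. -/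
theorem NoCut.exists_triple_of_six {c : ℕ → V} (hno : NoCut G) (h2 : TwoConnected G)
    (h : PeriodicCycle G 6 c) (hm : NoLongCycle G 7) {d : V} (hd : ∀ i, c i ≠ d) :
    ∃ a₁ a₂ a₃, a₁ ≠ a₂ ∧ a₁ ≠ a₃ ∧ a₂ ≠ a₃ ∧
      ∀ v, v ≠ a₁ → v ≠ a₂ → v ≠ a₃ → ∀ w, G.Adj v w ↔ w = a₁ ∨ w = a₂ ∨ w = a₃ := by
  obtain ⟨-, r, hr⟩ := hno.off_cycle h2 h hm (by norm_num) hd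
  obtain ⟨c, h, hd, hr⟩ : ∃ c, PeriodicCycle G 6 c ∧ (∀ i, c i ≠ d) ∧
      ∀ v, G.Adj d v ↔ v = c 0 ∨ v = c 2 ∨ v = c 4 :=
    ⟨fun i => c (r + i), h.shift r, fun i => hd _, hr⟩
  have hodd : ∀ s, s % 2 = 0 → ∀ w, G.Adj (c (s + 1)) w ↔ w = c 0 ∨ w = c 2 ∨ w = c 4 := by
    intro s hs w
    have hds : ∀ s, s % 2 = 0 → G.Adj d (c s) := by
      intro s hs
      have : s % 6 = 0 ∨ s % 6 = 2 ∨ s % 6 = 4 := by omega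
      rcases this with e | e | e
      · exact (hr _).2 (.inl (h.eq_of_mod_eq e))
      · exact (hr _).2 (.inr (.inl (h.eq_of_mod_eq e)))
      · exact (hr _).2 (.inr (.inr (h.eq_of_mod_eq e)))
    have hc' := h.replace hd (hds s hs) (hds (s + 2) (by omega))
    obtain ⟨-, r', hr'⟩ := hno.off_cycle h2 hc' hm (by norm_num) (d := c (s + 1)) (fun i => by
      by_cases hi : i % 6 = (s + 1) % 6
      · rw [if_pos hi]; exact (hd _).symm
      · rw [if_neg hi]; exact h.ne_of_mod_ne hi)
    have heven : r' % 2 = 0 := by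
      by_contra hodd
      have h1 := (hr' (c s)).1 (h.adj s).symm
      have hne : ∀ t, t % 2 ≠ 0 → c s ≠ if t % 6 = (s + 1) % 6 then d else c t := by
        intro t ht
        split_ifs with hh
        · exact hd _
        · exact h.ne_of_mod_ne (by omega)
      have := hne r' (by omega)
      have := hne (r' + 2) (by omega)
      have := hne (r' + 4) (by omega)
      tauto
    rw [hr' w, if_neg (by omega), if_neg (by omega), if_neg (by omega)]
    have : r' % 6 = 0 ∨ r' % 6 = 2 ∨ r' % 6 = 4 := by omega
    rcases this with e | e | e
    · rw [h.eq_of_mod_eq (i := r') (j := 0) (by omega),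
        h.eq_of_mod_eq (i := r' + 2) (j := 2) (by omega),
        h.eq_of_mod_eq (i := r' + 4) (j := 4) (by omega)]
    · rw [h.eq_of_mod_eq (i := r') (j := 2) (by omega),
        h.eq_of_mod_eq (i := r' + 2) (j := 4) (by omega),
        h.eq_of_mod_eq (i := r' + 4) (j := 0) (by omega)]
      tauto
    · rw [h.eq_of_mod_eq (i := r') (j := 4) (by omega),
        h.eq_of_mod_eq (i := r' + 2) (j := 0) (by omega),
        h.eq_of_mod_eq (i := r' + 4) (j := 2) (by omega)]
      tauto
  refine ⟨c 0, c 2, c 4, h.ne _ _ (by omega) (by omega), h.ne _ _ (by omega) (by omega),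
    h.ne _ _ (by omega) (by omega), fun v hv0 hv2 hv4 => ?_⟩
  by_cases hv : ∃ i, c i = v
  · obtain ⟨i, rfl⟩ := hv
    have : ∃ s, s % 2 = 0 ∧ i % 6 = (s + 1) % 6 := by
      refine ⟨i - 1, ?_⟩
      have h0 : i % 6 ≠ 0 := fun e => hv0 (h.eq_of_mod_eq e)
      have h2 : i % 6 ≠ 2 := fun e => hv2 (h.eq_of_mod_eq e)
      have h4 : i % 6 ≠ 4 := fun e => hv4 (h.eq_of_mod_eq e)
      omega
    obtain ⟨s, hs, e⟩ := this
    rw [h.eq_of_mod_eq e]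
    exact hodd s hs
  · push Not at hv
    obtain ⟨-, r', hr'⟩ := hno.off_cycle h2 h hm (by norm_num) hv
    have heven : r' % 2 = 0 := by
      by_contra hodd'
      have h1 := (hodd (r' + 5) (by omega) v).1
        (by
          rw [h.eq_of_mod_eq (i := r' + 5 + 1) (j := r') (by omega)]
          exact ((hr' _).2 (.inl rfl)).symm)
      rcases h1 with e | e | e <;> exact hv _ e.symm
    intro w
    rw [hr' w]
    have : r' % 6 = 0 ∨ r' % 6 = 2 ∨ r' % 6 = 4 := by omega
    rcases this with e | e | e
    · rw [h.eq_of_mod_eq (i := r') (j := 0) (by omega),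
        h.eq_of_mod_eq (i := r' + 2) (j := 2) (by omega),
        h.eq_of_mod_eq (i := r' + 4) (j := 4) (by omega)]
    · rw [h.eq_of_mod_eq (i := r') (j := 2) (by omega),
        h.eq_of_mod_eq (i := r' + 2) (j := 4) (by omega),
        h.eq_of_mod_eq (i := r' + 4) (j := 0) (by omega)]
      tauto
    · rw [h.eq_of_mod_eq (i := r') (j := 4) (by omega),
        h.eq_of_mod_eq (i := r' + 2) (j := 0) (by omega),
        h.eq_of_mod_eq (i := r' + 4) (j := 2) (by omega)]
      tauto

theorem NoLongCycle.not_eight (h : NoLongCycle G 8) {x₀ x₁ x₂ x₃ x₄ x₅ x₆ x₇ : V}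
    (hn : [x₀, x₁, x₂, x₃, x₄, x₅, x₆, x₇].Nodup) (h₀ : G.Adj x₀ x₁) (h₁ : G.Adj x₁ x₂)
    (h₂ : G.Adj x₂ x₃) (h₃ : G.Adj x₃ x₄) (h₄ : G.Adj x₄ x₅) (h₅ : G.Adj x₅ x₆)
    (h₆ : G.Adj x₆ x₇) (h₇ : G.Adj x₇ x₀) : False := by
  have := h.length_lt hn (by simp [*]) (by simp)
  simp at this

theorem NoLongCycle.not_seven (h : NoLongCycle G 7) {x₀ x₁ x₂ x₃ x₄ x₅ x₆ : V}
    (hn : [x₀, x₁, x₂, x₃, x₄, x₅, x₆].Nodup) (h₀ : G.Adj x₀ x₁) (h₁ : G.Adj x₁ x₂)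
    (h₂ : G.Adj x₂ x₃) (h₃ : G.Adj x₃ x₄) (h₄ : G.Adj x₄ x₅) (h₅ : G.Adj x₅ x₆)
    (h₆ : G.Adj x₆ x₀) : False := by
  have := h.length_lt hn (by simp [*]) (by simp)
  simp at this

/-- The seven possible neighborhoods of a vertex off a longest cycle of length seven. -/
theorem PeriodicCycle.off_cycle_seven {c : ℕ → V} (hno : NoCut G) (h2 : TwoConnected G)
    (h : PeriodicCycle G 7 c) (hm : NoLongCycle G 8) {d : V} (hd : ∀ i, c i ≠ d) :
    (∀ v, G.Adj d v ↔ v = c 0 ∨ v = c 2 ∨ v = c 4) ∨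
    (∀ v, G.Adj d v ↔ v = c 1 ∨ v = c 3 ∨ v = c 5) ∨
    (∀ v, G.Adj d v ↔ v = c 2 ∨ v = c 4 ∨ v = c 6) ∨
    (∀ v, G.Adj d v ↔ v = c 3 ∨ v = c 5 ∨ v = c 0) ∨
    (∀ v, G.Adj d v ↔ v = c 4 ∨ v = c 6 ∨ v = c 1) ∨
    (∀ v, G.Adj d v ↔ v = c 5 ∨ v = c 0 ∨ v = c 2) ∨
    (∀ v, G.Adj d v ↔ v = c 6 ∨ v = c 1 ∨ v = c 3) := by
  obtain ⟨-, r, hr⟩ := hno.off_cycle h2 h hm (by norm_num) hd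
  have e : ∀ i j, i % 7 = j % 7 → c i = c j := fun i j hij => h.eq_of_mod_eq hij
  have : r % 7 = 0 ∨ r % 7 = 1 ∨ r % 7 = 2 ∨ r % 7 = 3 ∨ r % 7 = 4 ∨ r % 7 = 5 ∨ r % 7 = 6 := by
    omega
  rcases this with hh | hh | hh | hh | hh | hh | hh
  · rw [e r 0 (by omega), e (r + 2) 2 (by omega), e (r + 4) 4 (by omega)] at hr
    exact .inl hr
  · rw [e r 1 (by omega), e (r + 2) 3 (by omega), e (r + 4) 5 (by omega)] at hr
    exact .inr (.inl hr)
  · rw [e r 2 (by omega), e (r + 2) 4 (by omega), e (r + 4) 6 (by omega)] at hr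
    exact .inr (.inr (.inl hr))
  · rw [e r 3 (by omega), e (r + 2) 5 (by omega), e (r + 4) 0 (by omega)] at hr
    exact .inr (.inr (.inr (.inl hr)))
  · rw [e r 4 (by omega), e (r + 2) 6 (by omega), e (r + 4) 1 (by omega)] at hr
    exact .inr (.inr (.inr (.inr (.inl hr))))
  · rw [e r 5 (by omega), e (r + 2) 0 (by omega), e (r + 4) 2 (by omega)] at hr
    exact .inr (.inr (.inr (.inr (.inr (.inl hr)))))
  · rw [e r 6 (by omega), e (r + 2) 1 (by omega), e (r + 4) 3 (by omega)] at hr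
    exact .inr (.inr (.inr (.inr (.inr (.inr hr)))))

/-- If `d` is adjacent to `c 0`, `c 2`, `c 4` on a longest cycle `c` of length seven, then `d` can be
exchanged with `c 1` or `c 3`. All other neighborhoods of these vertices, and of other vertices off
the cycle, that `PeriodicCycle.off_cycle_seven` allows give an 8-cycle. Nothing is said about the
remaining vertices `p = c 5` and `q = c 6`. -/
theorem NoCut.exists_triple_of_seven {c : ℕ → V} (hno : NoCut G) (h2 : TwoConnected G)
    (h : PeriodicCycle G 7 c) (hm : NoLongCycle G 8) {d : V} (hd : ∀ i, c i ≠ d) :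
    ∃ a₁ a₂ a₃ p q, a₁ ≠ a₂ ∧ a₁ ≠ a₃ ∧ a₂ ≠ a₃ ∧ p ≠ q ∧
      ∀ v, v ≠ a₁ → v ≠ a₂ → v ≠ a₃ → v ≠ p → v ≠ q →
        ∀ w, G.Adj v w ↔ w = a₁ ∨ w = a₂ ∨ w = a₃ := by
  obtain ⟨-, r, hr⟩ := hno.off_cycle h2 h hm (by norm_num) hd
  obtain ⟨c, h, hd, hr⟩ : ∃ c, PeriodicCycle G 7 c ∧ (∀ i, c i ≠ d) ∧
      ∀ v, G.Adj d v ↔ v = c 0 ∨ v = c 2 ∨ v = c 4 :=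
    ⟨fun i => c (r + i), h.shift r, fun i => hd _, hr⟩
  have d0 := (hr _).2 (.inl rfl)
  have d2 := (hr _).2 (.inr (.inl rfl))
  have d4 := (hr _).2 (.inr (.inr rfl))
  have hne : ∀ i j, i < j → j < 7 → c i ≠ c j := fun i j hij hj => h.ne i j hij (by omega)
  have hnd : ∀ w, (∀ i, c i ≠ w) → [w, c 0, c 1, c 2, c 3, c 4, c 5, c 6].Nodup := by
    intro w hw
    have n1 := hne 0 1 (by omega) (by omega)
    have n2 := hne 0 2 (by omega) (by omega)
    have n3 := hne 0 3 (by omega) (by omega)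
    have n4 := hne 0 4 (by omega) (by omega)
    have n5 := hne 0 5 (by omega) (by omega)
    have n6 := hne 0 6 (by omega) (by omega)
    have n7 := hne 1 2 (by omega) (by omega)
    have n8 := hne 1 3 (by omega) (by omega)
    have n9 := hne 1 4 (by omega) (by omega)
    have n10 := hne 1 5 (by omega) (by omega)
    have n11 := hne 1 6 (by omega) (by omega)
    have n12 := hne 2 3 (by omega) (by omega)
    have n13 := hne 2 4 (by omega) (by omega)
    have n14 := hne 2 5 (by omega) (by omega)
    have n15 := hne 2 6 (by omega) (by omega)
    have n16 := hne 3 4 (by omega) (by omega)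
    have n17 := hne 3 5 (by omega) (by omega)
    have n18 := hne 3 6 (by omega) (by omega)
    have n19 := hne 4 5 (by omega) (by omega)
    have n20 := hne 4 6 (by omega) (by omega)
    have n21 := hne 5 6 (by omega) (by omega)
    simp [n1, n2, n3, n4, n5, n6, n7, n8, n9, n10, n11, n12, n13, n14, n15, n16, n17, n18, n19,
      n20, n21, fun i => (hw i).symm]
  have a01 := h.adj 0
  have a12 := h.adj 1
  have a23 := h.adj 2
  have a34 := h.adj 3
  have a45 := h.adj 4
  have a56 := h.adj 5
  have a60 : G.Adj (c 6) (c 0) := by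
    have := h.adj 6
    rwa [h.periodic 0] at this
  have hd7 := hnd d hd
  have h1 : ∀ v, G.Adj (c 1) v ↔ v = c 0 ∨ v = c 2 ∨ v = c 4 := by
    have hc' := h.replace hd (r := 0) d0 d2
    have h6 := hc'.off_cycle_seven hno h2 hm (d := c 1) (fun i => by
      by_cases hi : i % 7 = (0 + 1) % 7
      · rw [if_pos hi]; exact (hd _).symm
      · rw [if_neg hi]; exact h.ne_of_mod_ne hi)
    norm_num at h6
    rcases h6 with h6 | h6 | h6 | h6 | h6 | h6 | h6
    · exact h6
    · have := (h6 (c 0)).1 a01.symm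
      grind
    · have := (h6 (c 0)).1 a01.symm
      grind
    · have := (h6 (c 2)).1 a12
      grind
    · have := (h6 (c 0)).1 a01.symm
      grind
    · have c15 := (h6 (c 5)).2 (.inl rfl)
      exact (hm.not_eight (x₀ := c 1) (x₁ := c 5) (x₂ := c 6) (x₃ := c 0) (x₄ := d) (x₅ := c 4)
        (x₆ := c 3) (x₇ := c 2) (by grind) c15 a56 a60 d0.symm d4 a34.symm a23.symm
        a12.symm).elim
    · have := (h6 (c 0)).1 a01.symm
      grind
  have h3 : ∀ v, G.Adj (c 3) v ↔ v = c 0 ∨ v = c 2 ∨ v = c 4 := by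
    have hc' := h.replace hd (r := 2) d2 d4
    have h6 := hc'.off_cycle_seven hno h2 hm (d := c 3) (fun i => by
      by_cases hi : i % 7 = (2 + 1) % 7
      · rw [if_pos hi]; exact (hd _).symm
      · rw [if_neg hi]; exact h.ne_of_mod_ne hi)
    norm_num at h6
    rcases h6 with h6 | h6 | h6 | h6 | h6 | h6 | h6
    · exact h6
    · have := (h6 (c 2)).1 a23.symm
      grind
    · have c36 := (h6 (c 6)).2 (.inr (.inr rfl))
      exact (hm.not_eight (x₀ := c 3) (x₁ := c 6) (x₂ := c 5) (x₃ := c 4) (x₄ := d) (x₅ := c 0)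
        (x₆ := c 1) (x₇ := c 2) (by grind) c36 a56.symm a45.symm d4.symm d0 a01 a12 a23).elim
    · have := (h6 (c 2)).1 a23.symm
      grind
    · have := (h6 (c 2)).1 a23.symm
      grind
    · have := (h6 (c 4)).1 a34
      grind
    · have := (h6 (c 2)).1 a23.symm
      grind
  refine ⟨c 0, c 2, c 4, c 5, c 6, by grind, by grind, by grind, by grind,
    fun v hv0 hv2 hv4 hv5 hv6 => ?_⟩
  by_cases hv : ∃ i, c i = v
  · obtain ⟨i, rfl⟩ := hv
    have e : ∀ j, i % 7 = j % 7 → c i = c j := fun j hij => h.eq_of_mod_eq hij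
    have : i % 7 = 1 ∨ i % 7 = 3 := by
      by_contra hcon
      have : i % 7 = 0 ∨ i % 7 = 2 ∨ i % 7 = 4 ∨ i % 7 = 5 ∨ i % 7 = 6 := by omega
      rcases this with hh | hh | hh | hh | hh
      · exact hv0 (e 0 hh)
      · exact hv2 (e 2 hh)
      · exact hv4 (e 4 hh)
      · exact hv5 (e 5 hh)
      · exact hv6 (e 6 hh)
    rcases this with hh | hh
    · rw [e 1 hh]; exact h1
    · rw [e 3 hh]; exact h3
  · push Not at hv
    have hv7 := hnd v hv
    have hdv : ∀ w, G.Adj v w ↔ w = c 0 ∨ w = c 2 ∨ w = c 4 := by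
      have n1 : ¬ G.Adj v (c 1) := fun hh => by have := (h1 v).1 hh.symm; grind
      have n3 : ¬ G.Adj v (c 3) := fun hh => by have := (h3 v).1 hh.symm; grind
      rcases h.off_cycle_seven hno h2 hm hv with h6 | h6 | h6 | h6 | h6 | h6 | h6
      · exact h6
      · exact absurd ((h6 _).2 (.inl rfl)) n1
      · have hvd : v ≠ d := by
          rintro rfl
          have := (hr (c 6)).1 ((h6 (c 6)).2 (.inr (.inr rfl)))
          grind
        exact (hm.not_eight (x₀ := c 2) (x₁ := v) (x₂ := c 6) (x₃ := c 5) (x₄ := c 4) (x₅ := d)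
          (x₆ := c 0) (x₇ := c 1) (by grind) ((h6 _).2 (.inl rfl)).symm
          ((h6 _).2 (.inr (.inr rfl))) a56.symm a45.symm d4.symm d0 a01 a12).elim
      · exact absurd ((h6 _).2 (.inl rfl)) n3
      · exact absurd ((h6 _).2 (.inr (.inr rfl))) n1
      · have hvd : v ≠ d := by
          rintro rfl
          have := (hr (c 5)).1 ((h6 (c 5)).2 (.inl rfl))
          grind
        exact (hm.not_eight (x₀ := c 2) (x₁ := v) (x₂ := c 5) (x₃ := c 6) (x₄ := c 0) (x₅ := d)
          (x₆ := c 4) (x₇ := c 3) (by grind) ((h6 _).2 (.inr (.inr rfl))).symm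
          ((h6 _).2 (.inl rfl)) a56 a60 d0.symm d4 a34.symm a23.symm).elim
      · exact absurd ((h6 _).2 (.inr (.inl rfl))) n1
    exact hdv

theorem TwoConnected.exists_cycle (h2 : TwoConnected G) : ¬ NoLongCycle G 3 := by
  intro hk
  have : ∃ a b c : V, a ≠ b ∧ a ≠ c ∧ b ≠ c := by
    have h3 := h2.1
    have hf : Finite V := Nat.finite_of_card_ne_zero (by omega)
    have := Fintype.ofFinite V
    rw [Nat.card_eq_fintype_card] at h3
    obtain ⟨a, b, c, h⟩ := Fintype.two_lt_card_iff.1 (show 2 < Fintype.card V by omega)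
    exact ⟨a, b, c, h⟩
  obtain ⟨a, b, c, hab, hac, hbc⟩ := this
  obtain ⟨k, _, o, o', rfl, rfl, ho, ho', hoo, e1, e2⟩ :=
    h2.exists_two_attachments (K := {a}) ⟨a, rfl⟩ (Ne.symm hab) (Ne.symm hac) hbc
  obtain ⟨l, hl, hl1, hl2⟩ := exists_link (h2.2.2 _).preconnected ho ho' e1 e2.symm
  have := hk.length_lt (List.nodup_cons.2 ⟨fun hh => hl.mem _ hh rfl, hl.nodup⟩) hl.chain (hl2 hoo)
  have := hl2 hoo
  omega

/-- A longest cycle that misses a vertex, in a graph with more vertices than its circumference. -/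
theorem TwoConnected.exists_longest (h2 : TwoConnected G) {k : ℕ} (hk : NoLongCycle G k)
    (hkn : k ≤ Nat.card V) : ∃ m c d, m < k ∧ PeriodicCycle G m c ∧ NoLongCycle G (m + 1) ∧
      ∀ i, c i ≠ d := by
  classical
  have hex : ∃ k, NoLongCycle G k := ⟨k, hk⟩
  have h3 : 3 < Nat.find hex := by
    by_contra hcon
    refine h2.exists_cycle fun v p hp => ?_
    exact (Nat.find_spec hex v p hp).trans_le (by omega)
  have hmin := Nat.find_min hex (m := Nat.find hex - 1) (by omega)
  obtain ⟨m, c, hm, hc⟩ := exists_periodicCycle_of_not_noLongCycle hmin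
  have hlt := hc.length_lt (Nat.find_spec hex)
  have hle := Nat.find_min' hex hk
  have hmk : m + 1 = Nat.find hex := by omega
  have hd : ∃ d, ∀ i, c i ≠ d := by
    by_contra hcon
    push Not at hcon
    have hf : Finite V := Nat.finite_of_card_ne_zero (by omega)
    have hsurj : Function.Surjective (fun i : Fin m => c i) := by
      intro v
      obtain ⟨i, rfl⟩ := hcon v
      exact ⟨⟨i % m, Nat.mod_lt _ (by have := hc.three_le; omega)⟩,
        hc.eq_of_mod_eq (Nat.mod_mod _ _)⟩
    have := Nat.card_le_card_of_surjective _ hsurj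
    rw [Nat.card_fin] at this
    omega
  obtain ⟨d, hd⟩ := hd
  exact ⟨m, c, d, by omega, hc, hmk ▸ Nat.find_spec hex, hd⟩

theorem NoCut.not_noLongCycle_six (hno : NoCut G) (h2 : TwoConnected G) {k : ℕ} (hk : k ≤ 6)
    (hkn : k ≤ Nat.card V) : ¬ NoLongCycle G k := by
  intro h
  obtain ⟨m, c, d, hmk, hc, hm, hd⟩ := h2.exists_longest h hkn
  have := (hno.off_cycle h2 hc hm (by omega) hd).1
  omega

theorem NoCut.exists_triple (hno : NoCut G) (h2 : TwoConnected G) (h : NoLongCycle G 7)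
    (hn : 7 ≤ Nat.card V) : ∃ a₁ a₂ a₃, a₁ ≠ a₂ ∧ a₁ ≠ a₃ ∧ a₂ ≠ a₃ ∧
      ∀ v, v ≠ a₁ → v ≠ a₂ → v ≠ a₃ → ∀ w, G.Adj v w ↔ w = a₁ ∨ w = a₂ ∨ w = a₃ := by
  obtain ⟨m, c, d, hmk, hc, hm, hd⟩ := h2.exists_longest h hn
  have := (hno.off_cycle h2 hc hm (by omega) hd).1
  obtain rfl : m = 6 := by omega
  exact hno.exists_triple_of_six h2 hc hm hd

/-- The vertices `p` and `q` are arbitrary if the longest cycles have length six. -/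
theorem NoCut.exists_triple_pair (hno : NoCut G) (h2 : TwoConnected G) (h : NoLongCycle G 8)
    (hn : 8 ≤ Nat.card V) : ∃ a₁ a₂ a₃ p q, a₁ ≠ a₂ ∧ a₁ ≠ a₃ ∧ a₂ ≠ a₃ ∧ p ≠ q ∧
      ∀ v, v ≠ a₁ → v ≠ a₂ → v ≠ a₃ → v ≠ p → v ≠ q →
        ∀ w, G.Adj v w ↔ w = a₁ ∨ w = a₂ ∨ w = a₃ := by
  obtain ⟨m, c, d, hmk, hc, hm, hd⟩ := h2.exists_longest h hn
  have := (hno.off_cycle h2 hc hm (by omega) hd).1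
  have : m = 6 ∨ m = 7 := by omega
  rcases this with rfl | rfl
  · obtain ⟨a₁, a₂, a₃, h12, h13, h23, hh⟩ := hno.exists_triple_of_six h2 hc hm hd
    exact ⟨a₁, a₂, a₃, a₁, a₂, h12, h13, h23, h12, fun v h1 h2 h3 _ _ => hh v h1 h2 h3⟩
  · exact hno.exists_triple_of_seven h2 hc hm hd

/-! ### Counting nonadjacent pairs -/

section
open Classical

/-- The number of vertices of `W` other than `r` that are not adjacent to `r`. -/
noncomputable def nonDegree (G : SimpleGraph V) (W : Finset V) (r : V) : ℕ :=
  (W.filter fun w => w ≠ r ∧ ¬ G.Adj r w).card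

/-- Twice the number of pairs of nonadjacent vertices of `W`. -/
noncomputable def nonAdjCount (G : SimpleGraph V) (W : Finset V) : ℕ :=
  ∑ r ∈ W, nonDegree G W r

theorem nonAdjCount_erase {W : Finset V} {x : V} (hx : x ∈ W) :
    nonAdjCount G W = nonAdjCount G (W.erase x) + 2 * nonDegree G W x := by
  have h1 : ∀ r ∈ W.erase x, nonDegree G W r =
      nonDegree G (W.erase x) r + if ¬ G.Adj x r then 1 else 0 := by
    intro r hr
    have hrx := Finset.ne_of_mem_erase hr
    unfold nonDegree
    rw [Finset.filter_erase]
    by_cases h : G.Adj x r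
    · rw [if_neg (not_not.2 h), Finset.erase_eq_of_notMem, Nat.add_zero]
      simp only [Finset.mem_filter]
      exact fun hh => hh.2.2 h.symm
    · rw [if_pos h, Finset.card_erase_add_one]
      simp only [Finset.mem_filter]
      exact ⟨hx, hrx.symm, fun hh => h hh.symm⟩
  have h2 : (∑ r ∈ W.erase x, if ¬ G.Adj x r then 1 else 0) = nonDegree G W x := by
    rw [← Finset.card_filter, nonDegree]
    congr 1
    ext r
    simp only [Finset.mem_filter, Finset.mem_erase]
    tauto
  unfold nonAdjCount
  rw [← Finset.add_sum_erase W _ hx, Finset.sum_congr rfl h1, Finset.sum_add_distrib, h2]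
  omega

theorem nonDegree_le {W : Finset V} {x : V} (hx : x ∈ W) :
    2 * nonDegree G W x ≤ nonAdjCount G W := by
  rw [nonAdjCount_erase hx]; omega

/-- If more than `nonDegree G W r` candidates are available, one of them is adjacent to `r`. -/
theorem exists_adj_of_nonDegree_lt {W T : Finset V} {r : V} (hTW : T ⊆ W) (hr : r ∉ T)
    (h : nonDegree G W r < T.card) : ∃ s ∈ T, G.Adj r s := by
  by_contra hcon
  push Not at hcon
  refine absurd (Finset.card_le_card (s := T) (t := W.filter fun w => w ≠ r ∧ ¬ G.Adj r w) ?_)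
    (not_le.2 h)
  intro s hs
  rw [Finset.mem_filter]
  exact ⟨hTW hs, fun hh => hr (hh ▸ hs), hcon s hs⟩

theorem adj_of_nonDegree_eq_zero {W : Finset V} {r s : V} (h : nonDegree G W r = 0) (hs : s ∈ W)
    (hsr : s ≠ r) : G.Adj r s := by
  rw [nonDegree, Finset.card_eq_zero, Finset.filter_eq_empty_iff] at h
  have := h hs
  tauto

/-- A graph on `m ≥ 4` vertices with at most `m - 4` pairs of nonadjacent vertices has a
Hamiltonian path between any two vertices. -/
theorem exists_hamiltonian_link (m : ℕ) : ∀ (W : Finset V) (p q : V), W.card = m → 4 ≤ m →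
    nonAdjCount G W ≤ 2 * (m - 4) → p ∈ W → q ∈ W → p ≠ q →
    ∃ l, Link G {v | v ∈ W ∧ v ≠ p ∧ v ≠ q} p q l ∧ l.length + 2 = m := by
  induction m using Nat.strong_induction_on with
  | _ m ih =>
  intro W p q hW hm hcount hp hq hpq
  -- start at an end that has a nonneighbor, and delete it
  have peel : ∀ p q, p ∈ W → q ∈ W → p ≠ q → 0 < nonDegree G W p →
      ∃ l, Link G {v | v ∈ W ∧ v ≠ p ∧ v ≠ q} p q l ∧ l.length + 2 = m := by
    intro p q hp hq hpq h0
    have hc := nonAdjCount_erase (G := G) hp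
    have hdeg := nonDegree_le (G := G) hp
    have hcard := Finset.card_erase_of_mem hp
    have hq' : q ∈ W.erase p := Finset.mem_erase.2 ⟨hpq.symm, hq⟩
    have hcard' := Finset.card_erase_of_mem hq'
    obtain ⟨s, hs, hps⟩ := exists_adj_of_nonDegree_lt (G := G) (W := W) (T := (W.erase p).erase q)
      (r := p) ((Finset.erase_subset _ _).trans (Finset.erase_subset _ _)) (by simp) (by omega)
    simp only [Finset.mem_erase] at hs
    obtain ⟨l, hl, hll⟩ := ih (m - 1) (by omega) (W.erase p) s q (by omega) (by omega) (by omega)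
      (Finset.mem_erase.2 hs.2) hq' hs.1
    refine ⟨s :: l, ⟨List.nodup_cons.2 ⟨fun hh => (hl.mem s hh).2.1 rfl, hl.nodup⟩, ?_, ?_⟩, ?_⟩
    · intro z hz
      rcases List.mem_cons.1 hz with rfl | hz
      · exact ⟨hs.2.2, hs.2.1, hs.1⟩
      · have := hl.mem z hz
        simp only [Finset.mem_erase, Set.mem_ofPred_eq] at this
        exact ⟨this.1.2, this.1.1, this.2.2⟩
    · exact List.isChain_cons_cons.2 ⟨hps, hl.chain⟩
    · rw [List.length_cons]; omega
  by_cases hp0 : 0 < nonDegree G W p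
  · exact peel p q hp hq hpq hp0
  by_cases hq0 : 0 < nonDegree G W q
  · obtain ⟨l, hl, hll⟩ := peel q p hq hp hpq.symm hq0
    exact ⟨l.reverse, hl.reverse.mono fun v hv => ⟨hv.1, hv.2.2, hv.2.1⟩, by simpa using hll⟩
  have hp0' : ∀ s ∈ W, s ≠ p → G.Adj p s := fun s hs hsp =>
    adj_of_nonDegree_eq_zero (by omega) hs hsp
  have hq0' : ∀ s ∈ W, s ≠ q → G.Adj q s := fun s hs hsp =>
    adj_of_nonDegree_eq_zero (by omega) hs hsp
  by_cases hall : ∀ r ∈ W, nonDegree G W r = 0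
  · -- a complete graph
    refine ⟨((W.erase p).erase q).toList, ⟨Finset.nodup_toList _, ?_, ?_⟩, ?_⟩
    · intro z hz
      simp only [Finset.mem_toList, Finset.mem_erase] at hz
      exact ⟨hz.2.2, hz.2.1, hz.1⟩
    · have hnd : (p :: (((W.erase p).erase q).toList ++ [q])).Nodup := by
        simp only [List.nodup_cons, List.nodup_append, Finset.nodup_toList]
        simp [hpq]
        tauto
      have hmem : ∀ z ∈ (p :: (((W.erase p).erase q).toList ++ [q])), z ∈ W := by
        intro z hz
        simp at hz
        grind
      refine List.Pairwise.isChain (hnd.imp_of_mem fun ha hb hab => ?_)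
      exact adj_of_nonDegree_eq_zero (hall _ (hmem _ ha)) (hmem _ hb) (Ne.symm hab)
    · rw [Finset.length_toList, Finset.card_erase_of_mem (Finset.mem_erase.2 ⟨hpq.symm, hq⟩),
        Finset.card_erase_of_mem hp]
      omega
  push Not at hall
  obtain ⟨r, hr, hr0⟩ := hall
  have hrp : r ≠ p := by rintro rfl; omega
  have hrq : r ≠ q := by rintro rfl; omega
  have hc := nonAdjCount_erase (G := G) hr
  have hcard := Finset.card_erase_of_mem hr
  by_cases hr1 : nonDegree G W r = 1
  · -- `r` has one nonneighbor: insert it next to one of the two ends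
    obtain ⟨l, hl, hll⟩ := ih (m - 1) (by omega) (W.erase r) p q (by omega) (by omega) (by omega)
      (Finset.mem_erase.2 ⟨hrp.symm, hp⟩) (Finset.mem_erase.2 ⟨hrq.symm, hq⟩) hpq
    have hrl : r ∉ l := fun hh => by simpa using (hl.mem r hh).1
    have hmem : ∀ z ∈ l, z ∈ W ∧ z ≠ p ∧ z ≠ q := fun z hz => by
      have := hl.mem z hz
      simp only [Finset.mem_erase, Set.mem_ofPred_eq] at this
      tauto
    obtain ⟨a, l', rfl⟩ : ∃ a l', l = a :: l' := by
      cases l with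
      | nil => simp at hll; omega
      | cons a l' => exact ⟨a, l', rfl⟩
    by_cases hra : G.Adj r a
    · refine ⟨r :: a :: l', ⟨List.nodup_cons.2 ⟨hrl, hl.nodup⟩, ?_, ?_⟩, ?_⟩
      · intro z hz
        rcases List.mem_cons.1 hz with rfl | hz
        · exact ⟨hr, hrp, hrq⟩
        · exact hmem z hz
      · have := hl.chain
        simp only [List.cons_append, List.isChain_cons_cons] at this ⊢
        exact ⟨hp0' r hr hrp, hra, this.2⟩
      · simp only [List.length_cons] at hll ⊢; omega
    · obtain ⟨l'', b, rfl⟩ : ∃ l'' b, l' = l'' ++ [b] := by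
        rcases List.eq_nil_or_concat l' with rfl | ⟨l'', b, rfl⟩
        · simp at hll; omega
        · exact ⟨l'', b, by simp⟩
      have hab : b ≠ a := by
        rintro rfl
        have := hl.nodup
        simp at this
      have hrb : G.Adj r b := by
        by_contra hrb
        have : ({a, b} : Finset V) ⊆ W.filter fun w => w ≠ r ∧ ¬ G.Adj r w := by
          intro z hz
          have ha := hmem a (by simp)
          have hb := hmem b (by simp)
          simp only [List.mem_cons, List.mem_append] at hrl
          simp only [Finset.mem_insert, Finset.mem_singleton] at hz
          rw [Finset.mem_filter]
          grind
        have := Finset.card_le_card this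
        rw [Finset.card_pair hab.symm] at this
        unfold nonDegree at hr1
        omega
      refine ⟨a :: (l'' ++ [b]) ++ [r], ⟨?_, ?_, ?_⟩, ?_⟩
      · exact List.nodup_append.2 ⟨hl.nodup, by simp, by
          intro z hz z' hz' hzz
          rw [List.mem_singleton] at hz'
          exact hrl (hz' ▸ hzz ▸ hz)⟩
      · intro z hz
        rcases List.mem_append.1 hz with hz | hz
        · exact hmem z hz
        · rw [List.mem_singleton.1 hz]; exact ⟨hr, hrp, hrq⟩
      · have h1 := hl.chain
        rw [show p :: (a :: (l'' ++ [b]) ++ [q]) = (p :: a :: l'') ++ b :: [q] by simp,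
          List.isChain_split] at h1
        rw [show p :: (a :: (l'' ++ [b]) ++ [r] ++ [q]) = (p :: a :: l'') ++ b :: [r, q] by simp,
          List.isChain_split]
        exact ⟨h1.1, by simp [hrb.symm, (hq0' r hr hrq).symm]⟩
      · simp only [List.length_cons, List.length_append, List.length_nil] at hll ⊢; omega
  · -- `r` has two nonneighbors: delete `p` and `r`
    have hrp' : r ∈ W.erase p := Finset.mem_erase.2 ⟨hrp, hr⟩
    have hcp := nonAdjCount_erase (G := G) hp
    have hcr := nonAdjCount_erase (G := G) hrp'
    have hdeg := nonDegree_le (G := G) hr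
    have hsame : nonDegree G (W.erase p) r = nonDegree G W r := by
      unfold nonDegree
      rw [Finset.filter_erase, Finset.erase_eq_of_notMem]
      simp only [Finset.mem_filter]
      exact fun hh => hh.2.2 (hp0' r hr hrp).symm
    have hcard1 := Finset.card_erase_of_mem hp
    have hcard2 := Finset.card_erase_of_mem hrp'
    have hq' : q ∈ (W.erase p).erase r :=
      Finset.mem_erase.2 ⟨hrq.symm, Finset.mem_erase.2 ⟨hpq.symm, hq⟩⟩
    have hcard3 := Finset.card_erase_of_mem hq'
    obtain ⟨s, hs, hrs⟩ := exists_adj_of_nonDegree_lt (G := G) (W := W)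
      (T := ((W.erase p).erase r).erase q) (r := r)
      (((Finset.erase_subset _ _).trans (Finset.erase_subset _ _)).trans
        (Finset.erase_subset _ _)) (by simp) (by omega)
    simp only [Finset.mem_erase] at hs
    obtain ⟨l, hl, hll⟩ := ih (m - 2) (by omega) ((W.erase p).erase r) s q (by omega) (by omega)
      (by omega) (by simp only [Finset.mem_erase]; exact hs.2) hq' hs.1
    have hmem : ∀ z ∈ l, z ∈ W ∧ z ≠ p ∧ z ≠ q ∧ z ≠ r ∧ z ≠ s := fun z hz => by
      have := hl.mem z hz
      simp only [Finset.mem_erase, Set.mem_ofPred_eq] at this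
      tauto
    refine ⟨r :: s :: l, ⟨?_, ?_, ?_⟩, ?_⟩
    · rw [List.nodup_cons, List.nodup_cons]
      refine ⟨?_, fun hh => (hmem s hh).2.2.2.2 rfl, hl.nodup⟩
      rw [List.mem_cons]
      rintro (hh | hh)
      · exact hs.2.1 hh.symm
      · exact (hmem r hh).2.2.2.1 rfl
    · intro z hz
      rw [List.mem_cons, List.mem_cons] at hz
      rcases hz with rfl | rfl | hz
      · exact ⟨hr, hrp, hrq⟩
      · exact ⟨hs.2.2.2, hs.2.2.1, hs.1⟩
      · exact ⟨(hmem z hz).1, (hmem z hz).2.1, (hmem z hz).2.2.1⟩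
    · exact List.isChain_cons_cons.2 ⟨hp0' r hr hrp, List.isChain_cons_cons.2 ⟨hrs, hl.chain⟩⟩
    · simp only [List.length_cons]; omega

theorem nonDegree_univ [Fintype V] (r : V) :
    nonDegree G Finset.univ r + G.degree r + 1 = Fintype.card V := by
  have h1 : (Finset.univ.filter fun w => w ≠ r ∧ ¬ G.Adj r w) = (insert r (G.neighborFinset r))ᶜ := by
    ext w
    simp only [Finset.mem_filter, Finset.mem_univ, true_and, Finset.mem_compl, Finset.mem_insert,
      SimpleGraph.mem_neighborFinset]
    tauto
  have h2 : r ∉ G.neighborFinset r := by simp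
  have h3 := Finset.card_compl_add_card (insert r (G.neighborFinset r))
  rw [Finset.card_insert_of_notMem h2, SimpleGraph.card_neighborFinset_eq_degree] at h3
  rw [nonDegree, h1]
  omega

theorem nonAdjCount_univ [Fintype V] :
    nonAdjCount G Finset.univ + 2 * G.edgeSet.ncard + Fintype.card V
      = Fintype.card V * Fintype.card V := by
  have h1 := G.sum_degrees_eq_twice_card_edges
  have h2 : G.edgeSet.ncard = G.edgeFinset.card := by
    rw [← SimpleGraph.coe_edgeFinset, Set.ncard_coe_finset]
  have h3 : ∑ r : V, (nonDegree G Finset.univ r + G.degree r + 1) = ∑ _r : V, Fintype.card V :=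
    Finset.sum_congr rfl fun r _ => nonDegree_univ r
  rw [Finset.sum_add_distrib, Finset.sum_add_distrib, h1] at h3
  simp only [Finset.sum_const, Finset.card_univ, smul_eq_mul, mul_one] at h3
  rw [nonAdjCount, h2]
  omega

/-- A graph on `k` vertices with no Hamiltonian cycle and with a vertex of degree two has many
nonadjacent pairs: the rest has no Hamiltonian path between the two neighbors of this vertex. -/
theorem NoLongCycle.edges_le_of_card_eq [Finite V] {k : ℕ} (h : NoLongCycle G k)
    (hk : Nat.card V = k) (hk5 : 5 ≤ k) {v x y : V} (hxy : x ≠ y)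
    (hv : ∀ w, G.Adj v w ↔ w = x ∨ w = y) :
    2 * G.edgeSet.ncard + 5 * k ≤ k * k + 15 := by
  have := Fintype.ofFinite V
  rw [Nat.card_eq_fintype_card] at hk
  have hdeg : G.degree v = 2 := by
    rw [← SimpleGraph.card_neighborFinset_eq_degree, ← Finset.card_pair hxy]
    congr 1
    ext w
    simp [hv]
  have h1 := nonDegree_univ (G := G) v
  have h2 := nonAdjCount_univ (G := G)
  have h3 := nonAdjCount_erase (G := G) (Finset.mem_univ v)
  have hvx : G.Adj v x := (hv x).2 (.inl rfl)
  have hvy : G.Adj v y := (hv y).2 (.inr rfl)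
  have hcard := Finset.card_erase_of_mem (Finset.mem_univ v)
  rw [Finset.card_univ] at hcard
  rw [hdeg] at h1
  rw [hk] at h1 h2 hcard
  generalize k * k = K at h2 ⊢
  by_contra hcon
  obtain ⟨l, hl, hll⟩ := exists_hamiltonian_link (G := G) (k - 1) (Finset.univ.erase v) x y hcard
    (by omega) (by omega) (by simp [hvx.ne']) (by simp [hvy.ne']) hxy
  have hv' : Link G {v} x y [v] := ⟨by simp, by simp, by simp [hvx.symm, hvy]⟩
  have := h.link_link hl hv' (fun w hw hw' => by
      have := (hl.mem w hw).1
      simp at this hw'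
      exact this hw') hxy (fun hh => (hl.mem x hh).2.1 rfl) (by simp [hvx.ne'])
      (fun hh => (hl.mem y hh).2.2 rfl) (by simp [hvy.ne']) (by simp)
  simp at this
  omega

/-- On eight vertices, three vertices with the same three neighbors leave few edges. -/
theorem edges_le_of_card_eq_eight [Finite V] (hn : Nat.card V = 8) {a₁ a₂ a₃ p q : V}
    (h12 : a₁ ≠ a₂) (h13 : a₁ ≠ a₃) (h23 : a₂ ≠ a₃)
    (h : ∀ v, v ≠ a₁ → v ≠ a₂ → v ≠ a₃ → v ≠ p → v ≠ q →
        ∀ w, G.Adj v w ↔ w = a₁ ∨ w = a₂ ∨ w = a₃) : G.edgeSet.ncard ≤ 19 := by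
  have := Fintype.ofFinite V
  rw [Nat.card_eq_fintype_card] at hn
  have h2 := nonAdjCount_univ (G := G)
  set A : Finset V := {a₁, a₂, a₃, p, q}
  have hA : A.card ≤ 5 := Finset.card_le_five
  have hAc := Finset.card_compl_add_card A
  obtain ⟨T, hT, hT3⟩ := Finset.exists_subset_card_eq (s := Aᶜ) (n := 3) (by omega)
  obtain ⟨b₁, b₂, b₃, n12, n13, n23, rfl⟩ := Finset.card_eq_three.1 hT3
  have hb : ∀ b ∈ ({b₁, b₂, b₃} : Finset V), ∀ w, G.Adj b w ↔ w = a₁ ∨ w = a₂ ∨ w = a₃ := by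
    intro b hb
    have := hT hb
    simp [A] at this
    exact h b this.1 this.2.1 this.2.2.1 this.2.2.2.1 this.2.2.2.2
  have hbne : ∀ b ∈ ({b₁, b₂, b₃} : Finset V), b ≠ a₁ ∧ b ≠ a₂ ∧ b ≠ a₃ := by
    intro b hb
    have := hT hb
    simp [A] at this
    tauto
  have hdeg : ∀ b ∈ ({b₁, b₂, b₃} : Finset V), G.degree b = 3 := by
    intro b hb'
    rw [← SimpleGraph.card_neighborFinset_eq_degree,
      ← Finset.card_eq_three.2 ⟨a₁, a₂, a₃, h12, h13, h23, rfl⟩]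
    congr 1
    ext w
    simp [hb b hb']
  -- delete `b₁`, `b₂`, `b₃` one by one
  have e1 := nonAdjCount_erase (G := G) (Finset.mem_univ b₁)
  have d1 := nonDegree_univ (G := G) b₁
  rw [hdeg b₁ (by simp)] at d1
  have e2 := nonAdjCount_erase (G := G) (W := Finset.univ.erase b₁) (x := b₂) (by simp [n12.symm])
  have e3 := nonAdjCount_erase (G := G) (W := (Finset.univ.erase b₁).erase b₂) (x := b₃)
    (by simp [n13.symm, n23.symm])
  have d2 : 3 ≤ nonDegree G (Finset.univ.erase b₁) b₂ := by
    have d2 := nonDegree_univ (G := G) b₂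
    rw [hdeg b₂ (by simp)] at d2
    unfold nonDegree at d2 ⊢
    rw [Finset.filter_erase]
    have := Finset.pred_card_le_card_erase
      (s := Finset.univ.filter fun w => w ≠ b₂ ∧ ¬ G.Adj b₂ w) (a := b₁)
    omega
  have d3 : 2 ≤ nonDegree G ((Finset.univ.erase b₁).erase b₂) b₃ := by
    have d3 := nonDegree_univ (G := G) b₃
    rw [hdeg b₃ (by simp)] at d3
    unfold nonDegree at d3 ⊢
    rw [Finset.filter_erase, Finset.filter_erase]
    have := Finset.pred_card_le_card_erase
      (s := Finset.univ.filter fun w => w ≠ b₃ ∧ ¬ G.Adj b₃ w) (a := b₁)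
    have := Finset.pred_card_le_card_erase
      (s := (Finset.univ.filter fun w => w ≠ b₃ ∧ ¬ G.Adj b₃ w).erase b₁) (a := b₂)
    omega
  rw [hn] at h2 d1
  omega

end

/-! ### Deleting a vertex of degree two -/

/-- Some pair of vertices separates two sets of vertices each of which spans an edge. -/
def HasEdgeSeparation (G : SimpleGraph V) : Prop :=
  ∃ (x y : V) (S : Set V), x ≠ y ∧ ClosedOff G S x y ∧ (∃ u ∈ S, ∃ v ∈ S, G.Adj u v) ∧
    ∃ u v, u ∉ S ∧ u ≠ x ∧ u ≠ y ∧ v ∉ S ∧ v ≠ x ∧ v ≠ y ∧ G.Adj u v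

/-- A graph is connected if an edge leaves every set of vertices that is neither empty nor full. -/
theorem connected_of_crossing [Nonempty V]
    (h : ∀ (S : Set V) (a b : V), a ∈ S → b ∉ S → ∃ u v, u ∈ S ∧ v ∉ S ∧ G.Adj u v) :
    G.Connected where
  preconnected a b := by
    by_contra hab
    obtain ⟨u, v, hu, hv, huv⟩ := h {w | G.Reachable a w} a b .rfl hab
    exact hv (SimpleGraph.Reachable.trans hu huv.reachable)

theorem induce_connected_of_crossing {W : Set V} (hW : W.Nonempty)
    (h : ∀ (S : Set V) (a b : V), S ⊆ W → a ∈ S → b ∈ W → b ∉ S →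
      ∃ u v, u ∈ S ∧ v ∈ W ∧ v ∉ S ∧ G.Adj u v) : (G.induce W).Connected := by
  have := hW.to_subtype
  refine connected_of_crossing fun S a b ha hb => ?_
  obtain ⟨u, v, ⟨u', hu, rfl⟩, hv, hvS, huv⟩ := h (Subtype.val '' S) a b (by
    rintro _ ⟨w, -, rfl⟩; exact w.2) ⟨a, ha, rfl⟩ b.2 (fun ⟨b', hb', e⟩ =>
      hb (Subtype.val_injective e ▸ hb'))
  exact ⟨u', ⟨v, hv⟩, hu, fun hh => hvS ⟨_, hh, rfl⟩, huv⟩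

/-- A criterion for `G[W]` to be 2-connected in terms of edges of `G` that leave subsets of `W`. -/
theorem twoConnected_induce {W : Set V} (hcard : 3 ≤ W.ncard) (hW : (G.induce W).Connected)
    (h : ∀ v ∈ W, ∀ (S : Set V) (a b : V), S ⊆ W → v ∉ S → a ∈ S → b ∈ W → b ∉ S → b ≠ v →
      ∃ u w, u ∈ S ∧ w ∈ W ∧ w ∉ S ∧ w ≠ v ∧ G.Adj u w) : TwoConnected (G.induce W) := by
  refine ⟨hcard, hW, fun v => induce_connected_of_crossing ?_ fun S a b hS ha hb hbS => ?_⟩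
  · by_contra hne
    rw [Set.not_nonempty_iff_eq_empty] at hne
    have : W ⊆ {v.1} := fun w hw => by
      have : (⟨w, hw⟩ : W) ∉ ({v}ᶜ : Set W) := by rw [hne]; simp
      simpa [Subtype.ext_iff] using this
    have := Set.ncard_le_ncard this
    rw [Set.ncard_singleton] at this
    omega
  · obtain ⟨u, w, ⟨u', hu, rfl⟩, hw, hwS, hwv, huw⟩ := h v v.2 (Subtype.val '' S) a b (by
      rintro _ ⟨w, -, rfl⟩; exact w.2) (by
      rintro ⟨v', hv', e⟩
      exact hS hv' (Subtype.val_injective e)) ⟨a, ha, rfl⟩ b.2 (fun ⟨b', hb', e⟩ =>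
        hbS (Subtype.val_injective e ▸ hb')) (fun e => hb (Subtype.val_injective e))
    exact ⟨u', ⟨w, hw⟩, hu, fun e => hwv (by rw [← Set.mem_singleton_iff.1 e]),
      fun hh => hwS ⟨_, hh, rfl⟩, huw⟩

theorem NoLongCycle.induce {k : ℕ} (h : NoLongCycle G k) (W : Set V) :
    NoLongCycle (G.induce W) k := by
  intro v p hp
  have := h _ (p.map (SimpleGraph.Embedding.induce W).toHom)
    (hp.map Subtype.val_injective)
  exact (SimpleGraph.Walk.length_map _ p).symm.trans_lt this

section delete

variable {v x y : V}

/-- Deleting a vertex of degree two with adjacent neighbors preserves 2-connectedness: a path through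
the deleted vertex can use the edge between its neighbors. -/
theorem TwoConnected.induce_compl_singleton (h2 : TwoConnected G) (hn : 4 ≤ Nat.card V)
    (hv : ∀ w, G.Adj v w ↔ w = x ∨ w = y) (hxy : G.Adj x y) :
    TwoConnected (G.induce ({v}ᶜ : Set V)) := by
  have hf : Finite V := Nat.finite_of_card_ne_zero (by omega)
  refine twoConnected_induce ?_ (h2.2.2 v) fun w hw S a b hS hwS ha hb hbS hbw => ?_
  · have := Set.ncard_add_ncard_compl ({v} : Set V)
    rw [Set.ncard_singleton] at this
    omega
  · have hvS : v ∉ S := fun hh => hS hh rfl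
    have hwv : w ≠ v := hw
    have hvx : G.Adj x v := ((hv x).2 (.inl rfl)).symm
    have hvy : G.Adj y v := ((hv y).2 (.inr rfl)).symm
    by_cases hxyS : x ∈ S ∨ y ∈ S
    · obtain ⟨u, u', hu, hu', huS, hu'S, huu⟩ := exists_crossing (S := S ∪ {v})
        (h2.2.2 w).preconnected (a := a) (b := b) (fun e => hwS (e ▸ ha)) hbw (.inl ha)
        (fun hh => hh.elim hbS hb)
      have hu'S' : u' ∉ S := fun hh => hu'S (.inl hh)
      have hu'v : u' ≠ v := fun hh => hu'S (.inr hh)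
      rcases huS with huS | rfl
      · exact ⟨u, u', huS, hu'v, hu'S', hu', huu⟩
      · rcases (hv u').1 huu with rfl | rfl
        · exact ⟨y, u', hxyS.resolve_left hu'S', hu'v, hu'S', hu', hxy.symm⟩
        · exact ⟨x, u', hxyS.resolve_right hu'S', hu'v, hu'S', hu', hxy⟩
    · obtain ⟨u, u', hu, hu', huS, hu'S, huu⟩ := exists_crossing (S := S)
        (h2.2.2 w).preconnected (a := a) (b := b) (fun e => hwS (e ▸ ha)) hbw ha hbS
      refine ⟨u, u', huS, ?_, hu'S, hu', huu⟩
      rintro rfl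
      rcases (hv u).1 huu.symm with rfl | rfl
      · exact hxyS (.inl huS)
      · exact hxyS (.inr huS)

/-- A vertex of degree two whose two neighbors are adjacent can be added to one side of every cut
of the rest. -/
theorem exists_closedOff_of_induce (hv : ∀ w, G.Adj v w ↔ w = x ∨ w = y) (hxy : G.Adj x y)
    {S : Set ({v}ᶜ : Set V)} {p q : ({v}ᶜ : Set V)}
    (hS : ClosedOff (G.induce ({v}ᶜ : Set V)) S p q) :
    ∃ T : Set V, ClosedOff G T p q ∧ ∀ u : ({v}ᶜ : Set V), u.1 ∈ T ↔ u ∈ S := by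
  have hvx : G.Adj x v := ((hv x).2 (.inl rfl)).symm
  have hvy : G.Adj y v := ((hv y).2 (.inr rfl)).symm
  have hmem : ∀ u : ({v}ᶜ : Set V), u.1 ∈ Subtype.val '' S ↔ u ∈ S := fun u =>
    Subtype.val_injective.mem_set_image
  have hadj : ∀ u ∈ Subtype.val '' S, ∀ w, G.Adj u w → w ≠ v →
      w ∈ Subtype.val '' S ∨ w = p ∨ w = q := by
    rintro _ ⟨u, hu, rfl⟩ w huw hwv
    rcases hS.adj u hu ⟨w, hwv⟩ huw with h | h | h
    · exact .inl ⟨_, h, rfl⟩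
    · exact .inr (.inl (congrArg Subtype.val h))
    · exact .inr (.inr (congrArg Subtype.val h))
  have hl : (p : V) ∉ Subtype.val '' S := fun h => hS.left ((hmem p).1 h)
  have hr : (q : V) ∉ Subtype.val '' S := fun h => hS.right ((hmem q).1 h)
  have hpv : (p : V) ≠ v := p.2
  have hqv : (q : V) ≠ v := q.2
  by_cases hxyS : x ∈ Subtype.val '' S ∨ y ∈ Subtype.val '' S
  · refine ⟨Subtype.val '' S ∪ {v}, ⟨?_, ?_, ?_⟩, fun u => ?_⟩
    · rintro (h | h)
      · exact hl h
      · exact hpv h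
    · rintro (h | h)
      · exact hr h
      · exact hqv h
    · rintro u (hu | rfl) w huw
      · by_cases hwv : w = v
        · exact .inl (.inr hwv)
        · exact (hadj u hu w huw hwv).imp_left .inl
      · rcases (hv w).1 huw with rfl | rfl
        · rcases hxyS with h | h
          · exact .inl (.inl h)
          · exact (hadj y h w hxy.symm hvx.ne).imp_left .inl
        · rcases hxyS with h | h
          · exact (hadj x h w hxy hvy.ne).imp_left .inl
          · exact .inl (.inl h)
    · rw [Set.mem_union, hmem, Set.mem_singleton_iff]
      exact ⟨fun h => h.resolve_right u.2, .inl⟩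
  · refine ⟨Subtype.val '' S, ⟨hl, hr, fun u hu w huw => ?_⟩, hmem⟩
    refine hadj u hu w huw ?_
    rintro rfl
    rcases (hv u).1 huw.symm with rfl | rfl
    · exact hxyS (.inl hu)
    · exact hxyS (.inr hu)

theorem CutsAdjacent.induce_compl_singleton (h : CutsAdjacent G)
    (hv : ∀ w, G.Adj v w ↔ w = x ∨ w = y) (hxy : G.Adj x y) :
    CutsAdjacent (G.induce ({v}ᶜ : Set V)) := by
  rintro p q S hpq hS ⟨s, hs⟩ ⟨t, ht, htp, htq⟩
  obtain ⟨T, hT, hTS⟩ := exists_closedOff_of_induce hv hxy hS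
  exact h p q T (fun e => hpq (Subtype.val_injective e)) hT ⟨s, (hTS s).2 hs⟩
    ⟨t, fun hh => ht ((hTS t).1 hh), fun e => htp (Subtype.val_injective e),
      fun e => htq (Subtype.val_injective e)⟩

theorem HasEdgeSeparation.of_induce (hv : ∀ w, G.Adj v w ↔ w = x ∨ w = y) (hxy : G.Adj x y)
    (h : HasEdgeSeparation (G.induce ({v}ᶜ : Set V))) : HasEdgeSeparation G := by
  obtain ⟨p, q, S, hpq, hS, ⟨a, ha, b, hb, hab⟩, c, d, hc, hcp, hcq, hd, hdp, hdq, hcd⟩ := h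
  obtain ⟨T, hT, hTS⟩ := exists_closedOff_of_induce hv hxy hS
  have hi : ∀ {a b : ({v}ᶜ : Set V)}, a ≠ b → a.1 ≠ b.1 := fun h e => h (Subtype.val_injective e)
  exact ⟨p, q, T, hi hpq, hT, ⟨a, (hTS a).2 ha, b, (hTS b).2 hb, hab⟩, c, d,
    fun hh => hc ((hTS c).1 hh), hi hcp, hi hcq, fun hh => hd ((hTS d).1 hh), hi hdp, hi hdq, hcd⟩

/-- Deleting a vertex of degree two loses two edges. -/
theorem ncard_edgeSet_le_induce [Finite V] (hxy : x ≠ y) (hv : ∀ w, G.Adj v w ↔ w = x ∨ w = y) :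
    G.edgeSet.ncard ≤ (G.induce ({v}ᶜ : Set V)).edgeSet.ncard + 2 := by
  classical
  have := Fintype.ofFinite V
  have h1 := G.card_edgeFinset_induce_compl_singleton v
  have hdeg : G.degree v = 2 := by
    rw [← SimpleGraph.card_neighborFinset_eq_degree, ← Finset.card_pair hxy]
    congr 1
    ext w
    simp [hv]
  have h2 : G.edgeSet.ncard = G.edgeFinset.card := by
    rw [← SimpleGraph.coe_edgeFinset, Set.ncard_coe_finset]
  have h3 : (G.induce ({v}ᶜ : Set V)).edgeSet.ncard =
      (G.induce ({v}ᶜ : Set V)).edgeFinset.card := by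
    rw [← SimpleGraph.coe_edgeFinset, Set.ncard_coe_finset]
  rw [G.card_edgeFinset_deleteIncidenceSet v, hdeg] at h1
  rw [h2, h3]
  omega

end delete

/-- One side of a 2-vertex cut spans no edge, so each of its vertices is adjacent to exactly the two
vertices of the cut. -/
theorem exists_degree_two (h2 : TwoConnected G) (hcut : CutsAdjacent G)
    (hsep : ¬ HasEdgeSeparation G) (hno : ¬ NoCut G) :
    ∃ v x y, x ≠ y ∧ G.Adj x y ∧ ∀ w, G.Adj v w ↔ w = x ∨ w = y := by
  unfold NoCut at hno
  push Not at hno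
  obtain ⟨x, y, S, hxy, hS, ⟨s, hs⟩, t, htS, htx, hty⟩ := hno
  have key : ∀ (S : Set V) (s : V), ClosedOff G S x y → s ∈ S →
      (∀ u ∈ S, ∀ v ∈ S, ¬ G.Adj u v) → ∀ w, G.Adj s w ↔ w = x ∨ w = y := by
    intro S s hS hs hind
    have h1 : ∀ w, G.Adj s w → w = x ∨ w = y := fun w hw =>
      (hS.adj s hs w hw).resolve_left fun hh => hind s hs w hh hw
    obtain ⟨_, _, o, o', rfl, rfl, -, -, hoo, e1, e2⟩ := h2.exists_two_attachments (K := {s})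
      ⟨s, rfl⟩ (o₁ := x) (o₂ := y) (fun e => hS.left ((Set.mem_singleton_iff.1 e) ▸ hs))
      (fun e => hS.right ((Set.mem_singleton_iff.1 e) ▸ hs)) hxy
    intro w
    refine ⟨h1 w, ?_⟩
    have := h1 o e1
    have := h1 o' e2
    grind
  have hadj := hcut x y S hxy hS ⟨s, hs⟩ ⟨t, htS, htx, hty⟩
  by_cases hind : ∀ u ∈ S, ∀ v ∈ S, ¬ G.Adj u v
  · exact ⟨s, x, y, hxy, hadj, key S s hS hs hind⟩
  · refine ⟨t, x, y, hxy, hadj, key _ t hS.compl ⟨htS, htx, hty⟩ ?_⟩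
    rintro u ⟨hu, hux, huy⟩ v ⟨hv, hvx, hvy⟩ huv
    push Not at hind
    exact hsep ⟨x, y, S, hxy, hS, hind, u, v, hu, hux, huy, hv, hvx, hvy, huv⟩

/-! ### Three vertices with four common neighbors -/

/-- `A` has three vertices, and `B` consists of at least four common neighbors of them. -/
structure IsCore (G : SimpleGraph V) (A B : Set V) : Prop where
  card_left : A.ncard = 3
  card_right : 4 ≤ B.ncard
  notMem : ∀ b ∈ B, b ∉ A
  adj : ∀ b ∈ B, ∀ a ∈ A, G.Adj a b

theorem exists_third {A : Set V} (hA : A.ncard = 3) {x y : V} (hx : x ∈ A) (hy : y ∈ A)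
    (hxy : x ≠ y) : ∃ t ∈ A, t ≠ x ∧ t ≠ y ∧ ∀ a ∈ A, a = x ∨ a = y ∨ a = t := by
  obtain ⟨a, b, c, h1, h2, h3, rfl⟩ := Set.ncard_eq_three.1 hA
  simp only [Set.mem_insert_iff, Set.mem_singleton_iff] at hx hy ⊢
  rcases hx with rfl | rfl | rfl <;> rcases hy with rfl | rfl | rfl <;>
    first
      | exact absurd rfl hxy
      | exact ⟨a, by grind⟩
      | exact ⟨b, by grind⟩
      | exact ⟨c, by grind⟩

theorem exists_other {A : Set V} (hA : A.ncard = 3) {x : V} (hx : x ∈ A) :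
    ∃ y ∈ A, y ≠ x := by
  obtain ⟨a, b, c, h1, h2, h3, rfl⟩ := Set.ncard_eq_three.1 hA
  simp only [Set.mem_insert_iff, Set.mem_singleton_iff] at hx ⊢
  by_cases h : a = x
  · exact ⟨b, by simp, by grind⟩
  · exact ⟨a, by simp, h⟩

theorem exists_mem_of_four_le {B : Set V} (hB : 4 ≤ B.ncard) (x y z : V) :
    ∃ b ∈ B, b ≠ x ∧ b ≠ y ∧ b ≠ z := by
  have h1 : ({x, y, z} : Set V).ncard < B.ncard := by
    have := Set.ncard_insert_le x {y, z}
    have := Set.ncard_insert_le y {z}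
    rw [Set.ncard_singleton] at this
    omega
  obtain ⟨b, hb, hbn⟩ := Set.exists_mem_notMem_of_ncard_lt_ncard h1
  simp only [Set.mem_insert_iff, Set.mem_singleton_iff] at hbn
  exact ⟨b, hb, by tauto⟩

theorem exists_pair_mem_of_four_le {B : Set V} (hB : 4 ≤ B.ncard) (x y : V) :
    ∃ b ∈ B, ∃ b' ∈ B, b ≠ b' ∧ b ≠ x ∧ b ≠ y ∧ b' ≠ x ∧ b' ≠ y := by
  obtain ⟨b, hb, h1, h2, -⟩ := exists_mem_of_four_le hB x y y
  obtain ⟨b', hb', h3, h4, h5⟩ := exists_mem_of_four_le hB x y b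
  exact ⟨b, hb, b', hb', h5.symm, h1, h2, h3, h4⟩

namespace IsCore

variable {A B : Set V}

/-- No path of length four off `A` joins two vertices of `A`: the third vertex of `A` and two
vertices of `B` would close it to an 8-cycle. -/
theorem not_link_three (hAB : IsCore G A B) (h : NoLongCycle G 8) {a a' p q r : V} (ha : a ∈ A)
    (ha' : a' ∈ A) (haa : a ≠ a') (hp : p ∉ A) (hq : q ∉ A) (hr : r ∉ A) (hpq : p ≠ q)
    (hpr : p ≠ r) (hqr : q ≠ r) (hB : p ∉ B ∨ q ∉ B ∨ r ∉ B) (h1 : G.Adj a p) (h2 : G.Adj p q)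
    (h3 : G.Adj q r) (h4 : G.Adj r a') : False := by
  obtain ⟨t, ht, hta, hta', -⟩ := exists_third hAB.card_left ha ha' haa
  obtain ⟨b, hb, b', hb', hbb, e⟩ : ∃ b ∈ B, ∃ b' ∈ B, b ≠ b' ∧ b ≠ p ∧ b ≠ q ∧ b ≠ r ∧ b' ≠ p ∧
      b' ≠ q ∧ b' ≠ r := by
    rcases hB with hB | hB | hB
    · obtain ⟨b, hb, b', hb', e⟩ := exists_pair_mem_of_four_le hAB.card_right q r
      exact ⟨b, hb, b', hb', by grind⟩
    · obtain ⟨b, hb, b', hb', e⟩ := exists_pair_mem_of_four_le hAB.card_right p r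
      exact ⟨b, hb, b', hb', by grind⟩
    · obtain ⟨b, hb, b', hb', e⟩ := exists_pair_mem_of_four_le hAB.card_right p q
      exact ⟨b, hb, b', hb', by grind⟩
  have hbA := hAB.notMem b hb
  have hbA' := hAB.notMem b' hb'
  refine h.not_eight (x₀ := a) (x₁ := p) (x₂ := q) (x₃ := r) (x₄ := a') (x₅ := b) (x₆ := t)
    (x₇ := b') ?_ h1 h2 h3 h4 (hAB.adj b hb a' ha') (hAB.adj b hb t ht).symm
    (hAB.adj b' hb' t ht) (hAB.adj b' hb' a ha).symm
  simp only [List.nodup_cons, List.mem_cons, List.not_mem_nil, not_or, List.nodup_nil]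
  and_intros <;> grind

/-- Two disjoint paths of length three off `A` cannot join different pairs of vertices of `A`. -/
theorem not_link_two_two (hAB : IsCore G A B) (h : NoLongCycle G 8) {a a' a'' p q r s : V}
    (ha : a ∈ A) (ha' : a' ∈ A) (ha'' : a'' ∈ A) (h12 : a ≠ a') (h13 : a ≠ a'') (h23 : a' ≠ a'')
    (hp : p ∉ A) (hq : q ∉ A) (hr : r ∉ A) (hs : s ∉ A) (hn : [p, q, r, s].Nodup) (hB : p ∉ B)
    (e1 : G.Adj a q) (e2 : G.Adj p q) (e3 : G.Adj p a') (e4 : G.Adj a' r) (e5 : G.Adj r s)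
    (e6 : G.Adj s a'') : False := by
  obtain ⟨b, hb, e⟩ := exists_mem_of_four_le hAB.card_right q r s
  have hbA := hAB.notMem b hb
  refine h.not_eight (x₀ := a) (x₁ := q) (x₂ := p) (x₃ := a') (x₄ := r) (x₅ := s) (x₆ := a'')
    (x₇ := b) ?_ e1 e2.symm e3 e4 e5 e6 (hAB.adj b hb _ ha'') (hAB.adj b hb _ ha).symm
  simp only [List.nodup_cons, List.mem_cons, List.not_mem_nil, not_or, List.nodup_nil] at hn ⊢
  and_intros <;> grind

/-- Two disjoint edges `pq` and `vy` off `A`, where every vertex of `A` is adjacent to `p` or `q`,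
close to an 8-cycle. -/
theorem not_two_edges (hAB : IsCore G A B) (h : NoLongCycle G 8) {p q v y x a' : V} (hp : p ∉ A)
    (hq : q ∉ A) (hv : v ∉ A) (hy : y ∉ A) (hn : [p, q, v, y].Nodup) (hvB : v ∉ B)
    (hpq : G.Adj p q) (hvy : G.Adj v y) (hx : x ∈ A) (ha' : a' ∈ A) (hxa : x ≠ a')
    (hvx : G.Adj v x) (hya : G.Adj y a') (hcov : ∀ a ∈ A, G.Adj a p ∨ G.Adj a q)
    (hpA : ∃ a ∈ A, G.Adj a p) (hqA : ∃ a ∈ A, G.Adj a q) : False := by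
  obtain ⟨t, ht, htx, hta, hall⟩ := exists_third hAB.card_left hx ha' hxa
  have key : ∀ p q, p ∉ A → q ∉ A → [p, q, v, y].Nodup → G.Adj p q →
      (∀ a ∈ A, G.Adj a p ∨ G.Adj a q) → (∃ a ∈ A, G.Adj a q) → G.Adj t p → False := by
    intro p q hp hq hn hpq hcov ⟨β, hβ, hqβ⟩ htp
    have n1 : [v, y, q, p].Nodup := by
      simp only [List.nodup_cons, List.mem_cons, List.not_mem_nil, not_or, List.nodup_nil] at hn ⊢
      and_intros <;> grind
    have n2 : [v, y, p, q].Nodup := by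
      simp only [List.nodup_cons, List.mem_cons, List.not_mem_nil, not_or, List.nodup_nil] at hn ⊢
      and_intros <;> grind
    by_cases hxq : G.Adj x q
    · exact hAB.not_link_two_two h ha' hx ht hxa.symm hta.symm htx.symm hv hy hq hp n1 hvB
        hya.symm hvy hvx hxq hpq.symm htp.symm
    by_cases haq : G.Adj a' q
    · -- the path through `v` and `y`, traversed from `x` to `a'`
      obtain ⟨b, hb, e⟩ := exists_mem_of_four_le hAB.card_right y p q
      have hbA := hAB.notMem b hb
      refine h.not_eight (x₀ := x) (x₁ := v) (x₂ := y) (x₃ := a') (x₄ := q) (x₅ := p) (x₆ := t)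
        (x₇ := b) ?_ hvx.symm hvy hya haq hpq.symm htp.symm (hAB.adj b hb _ ht)
        (hAB.adj b hb _ hx).symm
      simp only [List.nodup_cons, List.mem_cons, List.not_mem_nil, not_or, List.nodup_nil] at hn ⊢
      and_intros <;> grind
    have hβt : β = t := by
      rcases hall β hβ with rfl | rfl | rfl
      · exact absurd hqβ hxq
      · exact absurd hqβ haq
      · rfl
    subst hβt
    exact hAB.not_link_two_two h ha' hx ht hxa.symm hta.symm htx.symm hv hy hp hq n2 hvB
      hya.symm hvy hvx ((hcov x hx).resolve_right hxq) hpq hqβ.symm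
  rcases hcov t ht with htp | htq
  · exact key p q hp hq hn hpq hcov hqA htp
  · refine key q p hq hp ?_ hpq.symm (fun a ha => (hcov a ha).symm) hpA htq
    simp only [List.nodup_cons, List.mem_cons, List.not_mem_nil, not_or, List.nodup_nil] at hn ⊢
    and_intros <;> grind

end IsCore

/-- The edges off `A` are either only one, or they form a star whose leaves have only one more
neighbor, the same for all leaves. -/
def OffEdges (G : SimpleGraph V) (A : Set V) : Prop :=
  (∃ p q, p ∉ A ∧ q ∉ A ∧ p ≠ q ∧ ∀ u w, u ∉ A → w ∉ A → G.Adj u w →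
      (u = p ∧ w = q) ∨ (u = q ∧ w = p)) ∨
  ∃ a b, a ∈ A ∧ b ∉ A ∧ (∃ c, c ∉ A ∧ G.Adj c b) ∧
    (∀ u w, u ∉ A → w ∉ A → G.Adj u w → u = b ∨ w = b) ∧
    ∀ c, c ∉ A → G.Adj c b → ∀ w, G.Adj c w → w = a ∨ w = b

section step

variable {A B : Set V} {v x y : V}

theorem adj_cases (hv : ∀ w, G.Adj v w ↔ w = x ∨ w = y) {u w : V} (huw : G.Adj u w) :
    (u = v ∧ (w = x ∨ w = y)) ∨ (w = v ∧ (u = x ∨ u = y)) ∨ (u ≠ v ∧ w ≠ v) := by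
  by_cases hu : u = v
  · subst hu; exact .inl ⟨rfl, (hv w).1 huw⟩
  · by_cases hw : w = v
    · subst hw; exact .inr (.inl ⟨rfl, (hv u).1 huw.symm⟩)
    · exact .inr (.inr ⟨hu, hw⟩)

/-- Putting back a vertex `v` of degree two with adjacent neighbors when no edge off `A` avoids `v`,
except possibly `pq`. If `v` has a neighbor off `A` and `pq` is an edge, then `v` and `pq` form a
star, since otherwise there is an 8-cycle or a separation with edges on both sides. -/
theorem step_single (hAB : IsCore G A B) (h : NoLongCycle G 8) (h2 : TwoConnected G)
    (hsep : ¬ HasEdgeSeparation G) (hvA : v ∉ A) (hvB : v ∉ B)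
    (hv : ∀ w, G.Adj v w ↔ w = x ∨ w = y) (hxy : G.Adj x y) {p q : V} (hp : p ∉ A) (hq : q ∉ A)
    (hpq : p ≠ q) (hpv : p ≠ v) (hqv : q ≠ v)
    (hoff : ∀ u w, u ∉ A → w ∉ A → u ≠ v → w ≠ v → G.Adj u w →
      (u = p ∧ w = q) ∨ (u = q ∧ w = p)) : OffEdges G A := by
  have hvx : G.Adj v x := (hv x).2 (.inl rfl)
  have hvy : G.Adj v y := (hv y).2 (.inr rfl)
  have hA : ∃ a₁ a₂, a₁ ∈ A ∧ a₂ ∈ A ∧ a₁ ≠ a₂ := by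
    obtain ⟨a, b, c, h1, h2, h3, rfl⟩ := Set.ncard_eq_three.1 hAB.card_left
    exact ⟨a, b, by simp, by simp, h1⟩
  obtain ⟨a₁, a₂, ha₁, ha₂, ha₁₂⟩ := hA
  -- `x` in `A` and `y` off `A`
  have mixed : ∀ x y, (∀ w, G.Adj v w ↔ w = x ∨ w = y) → G.Adj x y → x ∈ A → y ∉ A →
      OffEdges G A := by
    intro x y hv hxy hx hy
    have hvx : G.Adj v x := (hv x).2 (.inl rfl)
    have hvy : G.Adj v y := (hv y).2 (.inr rfl)
    by_cases hadj : G.Adj p q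
    swap
    · refine .inl ⟨v, y, hvA, hy, hvy.ne, fun u w hu hw huw => ?_⟩
      rcases adj_cases hv huw with ⟨e1, rfl | rfl⟩ | ⟨e1, rfl | rfl⟩ | ⟨e1, e2⟩
      · exact absurd hx hw
      · exact .inl ⟨e1, rfl⟩
      · exact absurd hx hu
      · exact .inr ⟨rfl, e1⟩
      · rcases hoff u w hu hw e1 e2 huw with ⟨rfl, rfl⟩ | ⟨rfl, rfl⟩
        · exact absurd huw hadj
        · exact absurd huw.symm hadj
    -- `y` is one of `p`, `q`
    have end_case : ∀ p q, p ∉ A → q ∉ A → p ≠ q → p ≠ v → q ≠ v → G.Adj p q →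
        (∀ u w, u ∉ A → w ∉ A → u ≠ v → w ≠ v → G.Adj u w →
          (u = p ∧ w = q) ∨ (u = q ∧ w = p)) → y = p → OffEdges G A := by
      rintro p q hp hq hpq hpv hqv hadj hoff rfl
      by_cases hN : ∀ w, G.Adj q w → w = x ∨ w = y
      · refine .inr ⟨x, y, hx, hy, ⟨q, hq, hadj.symm⟩, fun u w hu hw huw => ?_,
          fun c hc hcy w hcw => ?_⟩
        · rcases adj_cases hv huw with ⟨e1, rfl | rfl⟩ | ⟨e1, rfl | rfl⟩ | ⟨e1, e2⟩
          · exact absurd hx hw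
          · exact .inr rfl
          · exact absurd hx hu
          · exact .inl rfl
          · exact (hoff u w hu hw e1 e2 huw).imp And.left And.right
        · by_cases hcv : c = v
          · subst hcv; exact (hv w).1 hcw
          · have := hoff c y hc hy hcv hvy.ne' hcy
            have : c = q := by grind
            subst this
            exact hN w hcw
      · exfalso
        push Not at hN
        obtain ⟨w, hqw, hwx, hwy⟩ := hN
        have hwv : w ≠ v := by
          rintro rfl
          have := (hv q).1 hqw.symm
          grind
        have hw : w ∈ A := by
          by_contra hw
          have := hoff q w hq hw hqv hwv hqw
          grind
        exact hAB.not_link_three h hx hw hwx.symm hvA hy hq hvy.ne hqv.symm hpq (.inl hvB)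
          hvx.symm hvy hadj hqw
    by_cases hyp : y = p
    · exact end_case p q hp hq hpq hpv hqv hadj hoff hyp
    by_cases hyq : y = q
    · exact end_case q p hq hp hpq.symm hqv hpv hadj.symm
        (fun u w hu hw huv hwv huw => (hoff u w hu hw huv hwv huw).symm) hyq
    exfalso
    obtain ⟨a', ha', hxa, hya⟩ : ∃ a' ∈ A, x ≠ a' ∧ G.Adj y a' := by
      obtain ⟨k, k', o, o', hk, hk', ho, ho', hoo, e1, e2⟩ :=
        h2.exists_two_attachments (K := {v, y}) ⟨v, by simp⟩ (o₁ := a₁) (o₂ := a₂)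
          (by simp; grind) (by simp; grind) ha₁₂
      have key : ∀ k o, k ∈ ({v, y} : Set V) → o ∉ ({v, y} : Set V) → G.Adj k o → o ≠ x →
          o ∈ A ∧ G.Adj y o := by
        intro k o hk ho e hox
        simp only [Set.mem_insert_iff, Set.mem_singleton_iff, not_or] at hk ho
        rcases hk with rfl | rfl
        · have := (hv o).1 e
          grind
        · refine ⟨?_, e⟩
          by_contra hoA
          have := hoff k o hy hoA hvy.ne' ho.1 e
          grind
      by_cases hox : o = x
      · exact ⟨o', (key k' o' hk' ho' e2 (by grind)).1, by grind,
          (key k' o' hk' ho' e2 (by grind)).2⟩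
      · exact ⟨o, (key k o hk ho e1 hox).1, Ne.symm hox, (key k o hk ho e1 hox).2⟩
    have hvp : ¬ G.Adj v p := fun hh => by have := (hv p).1 hh; grind
    have hvq : ¬ G.Adj v q := fun hh => by have := (hv q).1 hh; grind
    have hcov : ∀ a ∈ A, G.Adj a p ∨ G.Adj a q := by
      intro a ha
      by_contra hcon
      push Not at hcon
      obtain ⟨s, hs, hsa⟩ := exists_other hAB.card_left ha
      obtain ⟨t, ht, hta, hts, hall⟩ := exists_third hAB.card_left ha hs hsa.symm
      obtain ⟨b, hb, hbp, hbq, -⟩ := exists_mem_of_four_le hAB.card_right p q q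
      have hbA := hAB.notMem b hb
      have hab := hAB.adj b hb a ha
      refine hsep ⟨s, t, {p, q}, hts.symm, ⟨?_, ?_, ?_⟩, ⟨p, by simp, q, by simp, hadj⟩, a, b,
        ?_, ?_, ?_, ?_, ?_, ?_, hab⟩
      · simp; grind
      · simp; grind
      · intro u hu w huw
        simp only [Set.mem_insert_iff, Set.mem_singleton_iff] at hu ⊢
        by_cases hwA : w ∈ A
        · have := hall w hwA
          have := huw.symm
          grind
        · have := hoff u w
          have := huw.symm
          grind
      all_goals try simp only [Set.mem_insert_iff, Set.mem_singleton_iff]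
      all_goals grind
    have hnb : ∀ p q, p ∉ A → q ∉ A → p ≠ v → ¬ G.Adj v p →
        (∀ u w, u ∉ A → w ∉ A → u ≠ v → w ≠ v → G.Adj u w →
          (u = p ∧ w = q) ∨ (u = q ∧ w = p)) → ∃ a ∈ A, G.Adj a p := by
      intro p q hp hq hpv hvp hoff
      obtain ⟨_, _, o, o', rfl, rfl, -, -, hoo, e1, e2⟩ :=
        h2.exists_two_attachments (K := {p}) ⟨p, rfl⟩ (o₁ := a₁) (o₂ := a₂)
          (by simp; grind) (by simp; grind) ha₁₂
      by_contra hcon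
      push Not at hcon
      have key : ∀ o, G.Adj _ o → o = q := fun o e => by
        have hoA : o ∉ A := fun hh => hcon o hh e.symm
        have hov : o ≠ v := by rintro rfl; exact hvp e.symm
        have := hoff _ o hp hoA hpv hov e
        grind
      exact hoo ((key o e1).trans (key o' e2).symm)
    exact hAB.not_two_edges h hp hq hvA hy (by simp; grind) hvB hadj hvy hx ha' hxa hvx hya hcov
      (hnb p q hp hq hpv hvp hoff) (hnb q p hq hp hqv hvq
        (fun u w hu hw huv hwv huw => (hoff u w hu hw huv hwv huw).symm))
  by_cases hxA : x ∈ A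
  · by_cases hyA : y ∈ A
    · refine .inl ⟨p, q, hp, hq, hpq, fun u w hu hw huw => ?_⟩
      rcases adj_cases hv huw with ⟨e1, rfl | rfl⟩ | ⟨e1, rfl | rfl⟩ | ⟨e1, e2⟩
      · exact absurd hxA hw
      · exact absurd hyA hw
      · exact absurd hxA hu
      · exact absurd hyA hu
      · exact hoff u w hu hw e1 e2 huw
    · exact mixed x y hv hxy hxA hyA
  · by_cases hyA : y ∈ A
    · exact mixed y x (fun w => (hv w).trans or_comm) hxy.symm hyA hxA
    · exfalso
      have hpqxy := hoff x y hxA hyA hvx.ne' hvy.ne' hxy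
      have hadj : G.Adj p q := by
        rcases hpqxy with ⟨rfl, rfl⟩ | ⟨rfl, rfl⟩
        · exact hxy
        · exact hxy.symm
      have hvpq : ∀ w, G.Adj v w ↔ w = p ∨ w = q := fun w => (hv w).trans (by grind)
      obtain ⟨k, k', o, o', hk, hk', ho, ho', hkk, hoo, e1, e2⟩ :=
        h2.exists_disjoint_edges (K := {v, p, q}) (k₁ := v) (k₂ := p) (by simp) (by simp)
          hpv.symm (o₁ := a₁) (o₂ := a₂) (by simp; grind) (by simp; grind) ha₁₂
      have key : ∀ k o, k ∈ ({v, p, q} : Set V) → o ∉ ({v, p, q} : Set V) → G.Adj k o →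
          o ∈ A ∧ (k = p ∨ k = q) := by
        intro k o hk ho e
        simp only [Set.mem_insert_iff, Set.mem_singleton_iff, not_or] at hk ho
        have hkv : k ≠ v := by
          rintro rfl
          have := (hvpq o).1 e
          grind
        refine ⟨?_, by grind⟩
        by_contra hoA
        have := hoff k o (by grind) hoA hkv ho.1 e
        grind
      obtain ⟨hoA, hkp⟩ := key k o hk ho e1
      obtain ⟨hoA', hkp'⟩ := key k' o' hk' ho' e2
      have hvk : G.Adj v k := (hvpq k).2 hkp
      have hvk' : G.Adj v k' := (hvpq k').2 hkp'
      exact hAB.not_link_three h hoA hoA' hoo (p := k) (q := v) (r := k') (by grind) hvA (by grind)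
        hvk.ne' hkk hvk'.ne (.inr (.inl hvB)) e1.symm hvk.symm hvk' e2

/-- Putting back a vertex `v` of degree two with adjacent neighbors when the edges off `A` that avoid
`v` form a star with center `b`, whose leaves have no other neighbor than `a`. If `v` has
a neighbor off `A`, then `v` is another such leaf, since otherwise there is an 8-cycle or a separation
with edges on both sides. -/
theorem step_star (hAB : IsCore G A B) (h : NoLongCycle G 8) (h2 : TwoConnected G)
    (hsep : ¬ HasEdgeSeparation G) (hvA : v ∉ A) (hvB : v ∉ B)
    (hv : ∀ w, G.Adj v w ↔ w = x ∨ w = y) (hxy : G.Adj x y) {a b c : V} (ha : a ∈ A) (hb : b ∉ A)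
    (hbv : b ≠ v) (hc : c ∉ A) (hcv : c ≠ v) (hcb : G.Adj c b)
    (hoff : ∀ u w, u ∉ A → w ∉ A → u ≠ v → w ≠ v → G.Adj u w → u = b ∨ w = b)
    (hleaf : ∀ c, c ∉ A → c ≠ v → G.Adj c b → ∀ w, w ≠ v → G.Adj c w → w = a ∨ w = b) :
    OffEdges G A := by
  have hvx : G.Adj v x := (hv x).2 (.inl rfl)
  have hvy : G.Adj v y := (hv y).2 (.inr rfl)
  obtain ⟨a₂, ha₂, ha₁₂⟩ := exists_other hAB.card_left ha
  -- a neighbor of `b` in `A` other than `a`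
  have hb_nb : (∀ w, G.Adj v w → w ∉ A → w = b ∨ G.Adj w b) →
      (∀ w, G.Adj v w → w ∈ A → w = a) → ∃ a' ∈ A, a' ≠ a ∧ G.Adj b a' := by
    intro hv1 hv2
    obtain ⟨s, hs, t, ht, hst⟩ : ∃ s, s ∈ A ∧ ∃ t, t ∈ A ∧ s ≠ t := ⟨a, ha, a₂, ha₂, ha₁₂.symm⟩
    obtain ⟨k, k', o, o', hk, hk', ho, ho', hoo, e1, e2⟩ :=
      h2.exists_two_attachments (K := {u | u ∉ A ∧ (u = b ∨ u = v ∨ G.Adj u b)})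
        ⟨b, hb, .inl rfl⟩ (o₁ := s) (o₂ := t) (by simp [hs]) (by simp [ht]) hst
    have key : ∀ k o, (k ∉ A ∧ (k = b ∨ k = v ∨ G.Adj k b)) →
        ¬ (o ∉ A ∧ (o = b ∨ o = v ∨ G.Adj o b)) → G.Adj k o → o ≠ a → o ∈ A ∧ G.Adj b o := by
      intro k o hk ho e hoa
      by_cases hoA : o ∈ A
      · refine ⟨hoA, ?_⟩
        by_cases hkb : k = b
        · exact hkb ▸ e
        · by_cases hkv : k = v
          · subst hkv
            exact absurd (hv2 o e hoA) hoa
          · have := hleaf k hk.1 hkv (by tauto) o (by grind) e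
            grind
      · exfalso
        by_cases hkv : k = v
        · subst hkv
          have := hv1 o e hoA
          grind
        · have := hoff k o hk.1 hoA hkv (by grind) e
          have := e.symm
          grind
    by_cases hoa : o = a
    · exact ⟨o', (key k' o' hk' ho' e2 (by grind)).1, by grind,
        (key k' o' hk' ho' e2 (by grind)).2⟩
    · exact ⟨o, (key k o hk ho e1 hoa).1, hoa, (key k o hk ho e1 hoa).2⟩
  -- a leaf not adjacent to `v` is adjacent to `a`
  have leaf_nb : ∀ c, c ∉ A → c ≠ v → G.Adj c b → ¬ G.Adj v c → G.Adj c a := by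
    intro c hc hcv hcb hvc
    obtain ⟨_, _, o, o', rfl, rfl, -, -, hoo, e1, e2⟩ :=
      h2.exists_two_attachments (K := {c}) ⟨c, rfl⟩ (o₁ := a) (o₂ := a₂)
        (by simp; grind) (by simp; grind) ha₁₂.symm
    have k1 := hleaf _ hc hcv hcb o (by rintro rfl; exact hvc e1.symm) e1
    have k2 := hleaf _ hc hcv hcb o' (by rintro rfl; exact hvc e2.symm) e2
    grind
  have mixed : ∀ x y, (∀ w, G.Adj v w ↔ w = x ∨ w = y) → G.Adj x y → x ∈ A → y ∉ A →
      OffEdges G A := by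
    intro x y hv hxy hx hy
    have hvx : G.Adj v x := (hv x).2 (.inl rfl)
    have hvy : G.Adj v y := (hv y).2 (.inr rfl)
    by_cases hyb : y = b
    · subst hyb
      by_cases hxa : x = a
      · subst hxa
        refine .inr ⟨x, y, hx, hy, ⟨v, hvA, hvy⟩, fun u w hu hw huw => ?_, fun c hc hcy w hcw => ?_⟩
        · rcases adj_cases hv huw with ⟨e1, rfl | rfl⟩ | ⟨e1, rfl | rfl⟩ | ⟨e1, e2⟩
          · exact absurd hx hw
          · exact .inr rfl
          · exact absurd hx hu
          · exact .inl rfl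
          · exact hoff u w hu hw e1 e2 huw
        · by_cases hcv : c = v
          · subst hcv; exact (hv w).1 hcw
          · refine hleaf c hc hcv hcy w ?_ hcw
            rintro rfl
            have := (hv c).1 hcw.symm
            have := hcy.ne
            grind
      · exfalso
        have hvc : ¬ G.Adj v c := fun hh => by
          have := (hv c).1 hh
          have := hcb.ne
          grind
        exact hAB.not_link_three h hx ha hxa hvA hy hc hvy.ne hcv.symm hcb.ne' (.inl hvB)
          hvx.symm hvy hcb.symm (leaf_nb c hc hcv hcb hvc)
    · exfalso
      by_cases hyl : G.Adj y b
      · have hxa : x = a := by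
          have := hleaf y hy hvy.ne' hyl x hvx.ne' hxy.symm
          grind
        subst hxa
        obtain ⟨a', ha', haa, hba⟩ := hb_nb
          (fun w hw hwA => by
            rcases (hv w).1 hw with rfl | rfl
            · exact absurd hx hwA
            · exact .inr hyl)
          (fun w hw hwA => by
            rcases (hv w).1 hw with rfl | rfl
            · rfl
            · exact absurd hwA hy)
        exact hAB.not_link_three h hx ha' haa.symm hvA hy hb hvy.ne hbv.symm hyb (.inl hvB)
          hvx.symm hvy hyl hba
      · obtain ⟨a', ha', hxa, hya⟩ : ∃ a' ∈ A, x ≠ a' ∧ G.Adj y a' := by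
          obtain ⟨k, k', o, o', hk, hk', ho, ho', hoo, e1, e2⟩ :=
            h2.exists_two_attachments (K := {v, y}) ⟨v, by simp⟩ (o₁ := a) (o₂ := a₂)
              (by simp; grind) (by simp; grind) ha₁₂.symm
          have key : ∀ k o, k ∈ ({v, y} : Set V) → o ∉ ({v, y} : Set V) → G.Adj k o → o ≠ x →
              o ∈ A ∧ G.Adj y o := by
            intro k o hk ho e hox
            simp only [Set.mem_insert_iff, Set.mem_singleton_iff, not_or] at hk ho
            rcases hk with rfl | rfl
            · have := (hv o).1 e
              grind
            · refine ⟨?_, e⟩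
              by_contra hoA
              have := hoff k o hy hoA hvy.ne' ho.1 e
              grind
          by_cases hox : o = x
          · exact ⟨o', (key k' o' hk' ho' e2 (by grind)).1, by grind,
              (key k' o' hk' ho' e2 (by grind)).2⟩
          · exact ⟨o, (key k o hk ho e1 hox).1, Ne.symm hox, (key k o hk ho e1 hox).2⟩
        have hvc : ∀ c, c ∉ A → G.Adj c b → ¬ G.Adj v c := fun c hc hcb hh => by
          have := (hv c).1 hh
          grind
        have hvb : ¬ G.Adj v b := fun hh => by have := (hv b).1 hh; grind
        have hca := leaf_nb c hc hcv hcb (hvc c hc hcb)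
        have hcov : ∀ a' ∈ A, a' ≠ a → G.Adj a' b := by
          intro a' ha' haa
          by_contra hcon
          obtain ⟨t, ht, hta, hta', hall⟩ := exists_third hAB.card_left ha ha' haa.symm
          obtain ⟨b', hb', -⟩ := exists_mem_of_four_le hAB.card_right b b b
          have hbA := hAB.notMem b' hb'
          have hab := hAB.adj b' hb' a' ha'
          have hb'v : b' ≠ v := by rintro rfl; exact hvB hb'
          have hbb' : b' ≠ b := by rintro rfl; exact hcon hab
          have hbl : ¬ G.Adj b' b := fun hh => by
            have := hleaf b' hbA hb'v hh a' (by grind) hab.symm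
            grind
          refine hsep ⟨a, t, {u | u ∉ A ∧ (u = b ∨ G.Adj u b)}, hta.symm, ⟨?_, ?_, ?_⟩,
            ⟨c, ⟨hc, .inr hcb⟩, b, ⟨hb, .inl rfl⟩, hcb⟩, a', b',
            ?_, ?_, ?_, ?_, ?_, ?_, hab⟩
          · simp [ha]
          · simp [ht]
          · rintro u ⟨huA, hu⟩ w huw
            simp only [Set.mem_ofPred_eq]
            have huv : u ≠ v := by rintro rfl; grind
            have hwv : w ≠ v := by
              rintro rfl
              have := huw.symm
              rcases hu with rfl | hu
              · exact hvb this
              · exact hvc u huA hu this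
            by_cases hwA : w ∈ A
            · have := hall w hwA
              have := huw.symm
              rcases hu with rfl | hu
              · grind
              · have := hleaf u huA huv hu w hwv huw
                grind
            · have := hoff u w huA hwA huv hwv huw
              have := huw.symm
              grind
          all_goals try simp only [Set.mem_ofPred_eq]
          all_goals grind
        have hvc' := hvc c hc hcb
        refine hAB.not_two_edges h hb hc hvA hy ?_ hvB hcb.symm hvy hx ha' hxa hvx hya ?_
          ⟨a₂, ha₂, hcov a₂ ha₂ ha₁₂⟩ ⟨a, ha, hca.symm⟩
        · have := hcb.ne'
          simp
          grind
        · intro a' ha'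
          by_cases haa : a' = a
          · subst haa; exact .inr hca.symm
          · exact .inl (hcov a' ha' haa)
  by_cases hxA : x ∈ A
  · by_cases hyA : y ∈ A
    · refine .inr ⟨a, b, ha, hb, ⟨c, hc, hcb⟩, fun u w hu hw huw => ?_, fun c hc hcb w hcw => ?_⟩
      · rcases adj_cases hv huw with ⟨e1, rfl | rfl⟩ | ⟨e1, rfl | rfl⟩ | ⟨e1, e2⟩
        · exact absurd hxA hw
        · exact absurd hyA hw
        · exact absurd hxA hu
        · exact absurd hyA hu
        · exact hoff u w hu hw e1 e2 huw
      · have := hv b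
        have hcv : c ≠ v := by rintro rfl; grind
        refine hleaf c hc hcv hcb w ?_ hcw
        rintro rfl
        have := (hv c).1 hcw.symm
        grind
    · exact mixed x y hv hxy hxA hyA
  · by_cases hyA : y ∈ A
    · exact mixed y x (fun w => (hv w).trans or_comm) hxy.symm hyA hxA
    · exfalso
      obtain ⟨c, hcA, hcv, hcb, hvbc⟩ : ∃ c, c ∉ A ∧ c ≠ v ∧ G.Adj c b ∧
          ∀ w, G.Adj v w ↔ w = b ∨ w = c := by
        rcases hoff x y hxA hyA hvx.ne' hvy.ne' hxy with rfl | rfl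
        · exact ⟨y, hyA, hvy.ne', hxy.symm, hv⟩
        · exact ⟨x, hxA, hvx.ne', hxy, fun w => (hv w).trans or_comm⟩
      have hvb : G.Adj v b := (hvbc b).2 (.inl rfl)
      have hvc : G.Adj v c := (hvbc c).2 (.inr rfl)
      obtain ⟨a', ha', haa, hba⟩ := hb_nb
        (fun w hw _ => by
          rcases (hvbc w).1 hw with rfl | rfl
          · exact .inl rfl
          · exact .inr hcb)
        (fun w hw hwA => by
          rcases (hvbc w).1 hw with rfl | rfl
          · exact absurd hwA hb
          · exact absurd hwA hcA)
      have hca : G.Adj c a := by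
        obtain ⟨k, k', o, o', hk, hk', ho, ho', hoo, e1, e2⟩ :=
          h2.exists_two_attachments (K := {v, c}) ⟨v, by simp⟩ (o₁ := a) (o₂ := a₂)
            (by simp; grind) (by simp; grind) ha₁₂.symm
        have key : ∀ k o, k ∈ ({v, c} : Set V) → o ∉ ({v, c} : Set V) → G.Adj k o →
            o = b ∨ (o = a ∧ G.Adj c a) := by
          intro k o hk ho e
          simp only [Set.mem_insert_iff, Set.mem_singleton_iff, not_or] at hk ho
          rcases hk with rfl | rfl
          · have := (hvbc o).1 e
            grind
          · have := hleaf k hcA hcv hcb o ho.1 e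
            grind
        have := key k o hk ho e1
        have := key k' o' hk' ho' e2
        grind
      exact hAB.not_link_three h ha ha' haa.symm hcA hvA hb hvc.ne' hcb.ne hbv.symm
        (.inr (.inl hvB)) hca.symm hvc.symm hvb hba

end step

/-! ### Dense graphs without a separation into two parts with edges -/

theorem ncard_compl_singleton [Finite V] {n : ℕ} (hn : Nat.card V = n + 1) (v : V) :
    Nat.card ↥({v}ᶜ : Set V) = n := by
  have := Set.ncard_add_ncard_compl ({v} : Set V)
  rw [Set.ncard_singleton] at this
  rw [Nat.card_coe_set_eq]
  omega

theorem IsCore.of_induce {v : V} {A B : Set ↥({v}ᶜ : Set V)}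
    (h : IsCore (G.induce ({v}ᶜ : Set V)) A B) :
    IsCore G (Subtype.val '' A) (Subtype.val '' B) where
  card_left := by rw [Set.ncard_image_of_injective _ Subtype.val_injective, h.card_left]
  card_right := by
    rw [Set.ncard_image_of_injective _ Subtype.val_injective]
    exact h.card_right
  notMem := by
    rintro _ ⟨b, hb, rfl⟩ ⟨a, ha, hab⟩
    exact h.notMem b hb (Subtype.val_injective hab ▸ ha)
  adj := by
    rintro _ ⟨b, hb, rfl⟩ _ ⟨a, ha, rfl⟩
    exact h.adj b hb a ha

/-- Without 2-vertex cuts there is a core from the start; on eight vertices the core would be too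
small, but then there are too few edges. -/
theorem NoCut.exists_core_eight [Finite V] (hno : NoCut G) (h2 : TwoConnected G)
    (h : NoLongCycle G 8) (hn : 8 ≤ Nat.card V) (he : 2 * Nat.card V + 4 ≤ G.edgeSet.ncard) :
    ∃ A B, IsCore G A B ∧ OffEdges G A := by
  obtain ⟨a₁, a₂, a₃, p, q, h12, h13, h23, hpq, hnb⟩ := hno.exists_triple_pair h2 h hn
  have hn9 : Nat.card V ≠ 8 := fun h8 => by
    have := edges_le_of_card_eq_eight h8 h12 h13 h23 hnb
    omega
  have hA : ({a₁, a₂, a₃} : Set V).ncard = 3 :=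
    Set.ncard_eq_three.2 ⟨a₁, a₂, a₃, h12, h13, h23, rfl⟩
  have hX : ({a₁, a₂, a₃, p, q} : Set V).ncard ≤ 5 := by
    have e1 := Set.ncard_insert_le a₁ {a₂, a₃, p, q}
    have e2 := Set.ncard_insert_le a₂ {a₃, p, q}
    have e3 := Set.ncard_insert_le a₃ {p, q}
    have e4 := Set.ncard_insert_le p {q}
    rw [Set.ncard_singleton] at e4
    omega
  have hcard := Set.ncard_add_ncard_compl ({a₁, a₂, a₃, p, q} : Set V)
  have hcore : IsCore G {a₁, a₂, a₃} {a₁, a₂, a₃, p, q}ᶜ := by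
    refine ⟨hA, by omega, fun b hb => ?_, fun b hb a ha => ?_⟩
    · simp only [Set.mem_compl_iff, Set.mem_insert_iff, Set.mem_singleton_iff] at hb ⊢
      tauto
    · simp only [Set.mem_compl_iff, Set.mem_insert_iff, Set.mem_singleton_iff, not_or] at hb ha
      exact ((hnb b hb.1 hb.2.1 hb.2.2.1 hb.2.2.2.1 hb.2.2.2.2 a).2 ha).symm
  refine ⟨_, _, hcore, .inl ?_⟩
  have hoff : ∀ u w, u ∉ ({a₁, a₂, a₃} : Set V) → w ∉ ({a₁, a₂, a₃} : Set V) → G.Adj u w →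
      (u = p ∧ w = q) ∨ (u = q ∧ w = p) := by
    intro u w hu hw huw
    simp only [Set.mem_insert_iff, Set.mem_singleton_iff, not_or] at hu hw
    have e1 := fun e1 e2 => (hnb u hu.1 hu.2.1 hu.2.2 e1 e2 w).1 huw
    have e2 := fun e1 e2 => (hnb w hw.1 hw.2.1 hw.2.2 e1 e2 u).1 huw.symm
    have := huw.ne
    grind
  by_cases hp : p ∈ ({a₁, a₂, a₃} : Set V) ∨ q ∈ ({a₁, a₂, a₃} : Set V)
  · obtain ⟨b, hb, b', hb', hbb, -⟩ := exists_pair_mem_of_four_le hcore.card_right a₁ a₁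
    refine ⟨b, b', hcore.notMem b hb, hcore.notMem b' hb', hbb, fun u w hu hw huw => ?_⟩
    have := hoff u w hu hw huw
    grind
  · push Not at hp
    exact ⟨p, q, hp.1, hp.2, hpq, hoff⟩

/-- Induction on the number `n` of vertices, deleting a vertex of degree two while there is a
2-vertex cut. The bound on the number of edges is kept, and it excludes that the induction arrives at
a graph with a 2-vertex cut on eight vertices. -/
theorem exists_core_eight (n : ℕ) : ∀ {V : Type u} [Finite V] {G : SimpleGraph V},
    Nat.card V = n → 8 ≤ n → TwoConnected G → NoLongCycle G 8 → CutsAdjacent G →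
    ¬ HasEdgeSeparation G → 2 * n + 4 ≤ G.edgeSet.ncard →
    ∃ A B, IsCore G A B ∧ OffEdges G A := by
  induction n with
  | zero => intro _ _ _ _ h; omega
  | succ n ih =>
    intro V _ G hn h8 h2 h hcut hsep he
    by_cases hno : NoCut G
    · exact hno.exists_core_eight h2 h (by omega) (by omega)
    obtain ⟨v, x, y, hxy, hadj, hv⟩ := exists_degree_two h2 hcut hsep hno
    by_cases hn8 : n + 1 = 8
    · have := h.edges_le_of_card_eq (hn.trans hn8) (by omega) hxy hv
      omega
    have hle := ncard_edgeSet_le_induce hxy hv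
    obtain ⟨A, B, hAB, hoff⟩ := ih (G := G.induce ({v}ᶜ : Set V)) (ncard_compl_singleton hn v)
      (by omega) (h2.induce_compl_singleton (by omega) hv hadj) (h.induce _)
      (hcut.induce_compl_singleton hv hadj)
      (fun hh => hsep (HasEdgeSeparation.of_induce hv hadj hh)) (by omega)
    refine ⟨_, _, hAB.of_induce, ?_⟩
    have hvS : ∀ S : Set ↥({v}ᶜ : Set V), v ∉ Subtype.val '' S := by
      rintro S ⟨a, -, e⟩
      exact a.2 e
    have hval : ∀ S : Set ↥({v}ᶜ : Set V), ∀ w : ↥({v}ᶜ : Set V),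
        (w : V) ∈ Subtype.val '' S → w ∈ S := by
      rintro S w ⟨a, ha, e⟩
      exact Subtype.val_injective e ▸ ha
    rcases hoff with ⟨p, q, hp, hq, hpq, hoff⟩ | ⟨a, b, ha, hb, ⟨c, hc, hcb⟩, hoff, hleaf⟩
    · refine step_single hAB.of_induce h h2 hsep (hvS _) (hvS _) hv hadj
        (fun hh => hp (hval _ _ hh)) (fun hh => hq (hval _ _ hh))
        (fun hh => hpq (Subtype.val_injective hh)) p.2 q.2 fun u w hu hw huv hwv huw => ?_
      have := hoff ⟨u, huv⟩ ⟨w, hwv⟩ (fun hh => hu ⟨_, hh, rfl⟩) (fun hh => hw ⟨_, hh, rfl⟩) huw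
      simpa [Subtype.ext_iff] using this
    · refine step_star hAB.of_induce h h2 hsep (hvS _) (hvS _) hv hadj (a := a) (b := b) (c := c)
        ⟨a, ha, rfl⟩ (fun hh => hb (hval _ _ hh)) b.2 (fun hh => hc (hval _ _ hh)) c.2 hcb
        (fun u w hu hw huv hwv huw => ?_) fun c hc hcv hcb w hwv hcw => ?_
      · have := hoff ⟨u, huv⟩ ⟨w, hwv⟩ (fun hh => hu ⟨_, hh, rfl⟩) (fun hh => hw ⟨_, hh, rfl⟩) huw
        simpa [Subtype.ext_iff] using this
      · have := hleaf ⟨c, hcv⟩ (fun hh => hc ⟨_, hh, rfl⟩) hcb ⟨w, hwv⟩ hcw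
        simpa [Subtype.ext_iff] using this

theorem NoCut.exists_core_seven [Finite V] (hno : NoCut G) (h2 : TwoConnected G)
    (h : NoLongCycle G 7) (hn : 7 ≤ Nat.card V) :
    ∃ A B, IsCore G A B ∧ ∀ u, u ∉ A → ∀ w, G.Adj u w → w ∈ A := by
  obtain ⟨a₁, a₂, a₃, h12, h13, h23, hnb⟩ := hno.exists_triple h2 h hn
  have hA : ({a₁, a₂, a₃} : Set V).ncard = 3 :=
    Set.ncard_eq_three.2 ⟨a₁, a₂, a₃, h12, h13, h23, rfl⟩
  have hcard := Set.ncard_add_ncard_compl ({a₁, a₂, a₃} : Set V)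
  have hnb' : ∀ v, v ∉ ({a₁, a₂, a₃} : Set V) → ∀ w, G.Adj v w ↔ w ∈ ({a₁, a₂, a₃} : Set V) := by
    intro v hv w
    simp only [Set.mem_insert_iff, Set.mem_singleton_iff, not_or] at hv ⊢
    exact hnb v hv.1 hv.2.1 hv.2.2 w
  exact ⟨{a₁, a₂, a₃}, {a₁, a₂, a₃}ᶜ, ⟨hA, by omega, fun b hb => hb,
    fun b hb a ha => ((hnb' b hb a).2 ha).symm⟩, fun u hu w huw => (hnb' u hu w).1 huw⟩

/-- Putting back a vertex `v` of degree two with adjacent neighbors when there are no edges off `A` that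
avoid `v`. -/
theorem step_seven {A B : Set V} {v x y : V} (hAB : IsCore G A B) (h : NoLongCycle G 7)
    (h2 : TwoConnected G) (hvA : v ∉ A) (hvB : v ∉ B)
    (hv : ∀ w, G.Adj v w ↔ w = x ∨ w = y) (hxy : G.Adj x y)
    (hoff : ∀ u, u ∉ A → u ≠ v → ∀ w, w ≠ v → G.Adj u w → w ∈ A) :
    ∀ u, u ∉ A → ∀ w, G.Adj u w → w ∈ A := by
  have mixed : ∀ x y, (∀ w, G.Adj v w ↔ w = x ∨ w = y) → G.Adj x y → x ∈ A → y ∈ A := by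
    intro x y hv hxy hx
    have hvx : G.Adj v x := (hv x).2 (.inl rfl)
    have hvy : G.Adj v y := (hv y).2 (.inr rfl)
    by_contra hy
    obtain ⟨s, hs, hsx⟩ := exists_other hAB.card_left hx
    obtain ⟨a, ha, hax, hya⟩ : ∃ a ∈ A, a ≠ x ∧ G.Adj y a := by
      obtain ⟨k, k', o, o', hk, hk', ho, ho', hoo, e1, e2⟩ :=
        h2.exists_two_attachments (K := {v, y}) ⟨v, by simp⟩ (o₁ := x) (o₂ := s)
          (by simp; grind) (by simp; grind) hsx.symm
      have key : ∀ k o, k ∈ ({v, y} : Set V) → o ∉ ({v, y} : Set V) → G.Adj k o → o ≠ x →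
          o ∈ A ∧ G.Adj y o := by
        intro k o hk ho e hox
        simp only [Set.mem_insert_iff, Set.mem_singleton_iff, not_or] at hk ho
        rcases hk with rfl | rfl
        · have := (hv o).1 e
          grind
        · exact ⟨hoff k hy hvy.ne' o ho.1 e, e⟩
      by_cases hox : o = x
      · exact ⟨o', (key k' o' hk' ho' e2 (by grind)).1, by grind,
          (key k' o' hk' ho' e2 (by grind)).2⟩
      · exact ⟨o, (key k o hk ho e1 hox).1, hox, (key k o hk ho e1 hox).2⟩
    obtain ⟨t, ht, htx, hta, -⟩ := exists_third hAB.card_left hx ha hax.symm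
    obtain ⟨b, hb, b', hb', hbb, hbv, hby, hbv', hby'⟩ :=
      exists_pair_mem_of_four_le hAB.card_right v y
    have hbA := hAB.notMem b hb
    have hbA' := hAB.notMem b' hb'
    refine h.not_seven (x₀ := x) (x₁ := v) (x₂ := y) (x₃ := a) (x₄ := b) (x₅ := t) (x₆ := b') ?_
      hvx.symm hvy hya (hAB.adj b hb a ha) (hAB.adj b hb t ht).symm (hAB.adj b' hb' t ht)
      (hAB.adj b' hb' x hx).symm
    simp only [List.nodup_cons, List.mem_cons, List.not_mem_nil, not_or, List.nodup_nil]
    and_intros <;> grind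
  have hvx : G.Adj v x := (hv x).2 (.inl rfl)
  have hvy : G.Adj v y := (hv y).2 (.inr rfl)
  have hxyA : x ∈ A ∧ y ∈ A := by
    by_cases hx : x ∈ A
    · exact ⟨hx, mixed x y hv hxy hx⟩
    · have hy := hoff x hx hvx.ne' y hvy.ne' hxy
      exact absurd (mixed y x (fun w => (hv w).trans or_comm) hxy.symm hy) hx
  intro u hu w huw
  rcases adj_cases hv huw with ⟨-, rfl | rfl⟩ | ⟨-, rfl | rfl⟩ | ⟨e1, e2⟩
  · exact hxyA.1
  · exact hxyA.2
  · exact absurd hxyA.1 hu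
  · exact absurd hxyA.2 hu
  · exact hoff u hu e1 w e2 huw

/-- The analogue of `exists_core_eight` for circumference at most six: here no edges remain off `A`. -/
theorem exists_core_seven (n : ℕ) : ∀ {V : Type u} [Finite V] {G : SimpleGraph V},
    Nat.card V = n → 7 ≤ n → TwoConnected G → NoLongCycle G 7 → CutsAdjacent G →
    ¬ HasEdgeSeparation G → 2 * n + 1 ≤ G.edgeSet.ncard →
    ∃ A B, IsCore G A B ∧ ∀ u, u ∉ A → ∀ w, G.Adj u w → w ∈ A := by
  induction n with
  | zero => intro _ _ _ _ h; omega
  | succ n ih =>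
    intro V _ G hn h8 h2 h hcut hsep he
    by_cases hno : NoCut G
    · exact hno.exists_core_seven h2 h (by omega)
    obtain ⟨v, x, y, hxy, hadj, hv⟩ := exists_degree_two h2 hcut hsep hno
    by_cases hn8 : n + 1 = 7
    · have := h.edges_le_of_card_eq (hn.trans hn8) (by omega) hxy hv
      omega
    have hle := ncard_edgeSet_le_induce hxy hv
    obtain ⟨A, B, hAB, hoff⟩ := ih (G := G.induce ({v}ᶜ : Set V)) (ncard_compl_singleton hn v)
      (by omega) (h2.induce_compl_singleton (by omega) hv hadj) (h.induce _)
      (hcut.induce_compl_singleton hv hadj)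
      (fun hh => hsep (HasEdgeSeparation.of_induce hv hadj hh)) (by omega)
    have hvS : ∀ S : Set ↥({v}ᶜ : Set V), v ∉ Subtype.val '' S := by
      rintro S ⟨a, -, e⟩
      exact a.2 e
    refine ⟨_, _, hAB.of_induce, step_seven hAB.of_induce h h2 (hvS _) (hvS _) hv hadj
      fun u hu huv w hwv huw => ?_⟩
    exact ⟨_, hoff ⟨u, huv⟩ (fun hh => hu ⟨_, hh, rfl⟩) ⟨w, hwv⟩ huw, rfl⟩

/-! ### Members of the extremal classes that contain a given graph -/

/-- If all edges off `A` are inside `C`, then `G` is contained in the graph `H_{n,k,a}` with the sets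
`A` and `C`. -/
theorem exists_isH [Finite V] {n k a : ℕ} (hn : Nat.card V = n) (hak : 2 * a ≤ k) (hkn : k ≤ n)
    {A C : Set V} (hA : A.ncard = a) (hC : C.ncard = k - 2 * a) (hAC : Disjoint A C)
    (hoff : ∀ u w, u ∉ A → w ∉ A → G.Adj u w → u ∈ C ∧ w ∈ C) :
    ∃ H, IsH n k a H ∧ G ≤ H := by
  have hB : (A ∪ C)ᶜ.ncard = n - k + a := by
    have h1 := Set.ncard_add_ncard_compl (A ∪ C)
    have h2 := Set.ncard_union_eq hAC
    omega
  refine ⟨SimpleGraph.fromRel fun u v => (u ∈ A ∧ v ∈ (A ∪ C)ᶜ) ∨ (u ∈ A ∪ C ∧ v ∈ A ∪ C),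
    ⟨A, (A ∪ C)ᶜ, C, ⟨?_, ?_, hAC, ?_⟩, hA, hB, hC, fun u v => ?_⟩, fun u v huv => ?_⟩
  · ext v
    simp only [Set.mem_union, Set.mem_compl_iff, Set.mem_univ, iff_true]
    tauto
  · exact Set.disjoint_left.2 fun v hv hv' => hv' (.inl hv)
  · exact Set.disjoint_left.2 fun v hv hv' => hv (.inr hv')
  · simp only [SimpleGraph.fromRel_adj]
    tauto
  · simp only [SimpleGraph.fromRel_adj, Set.mem_union, Set.mem_compl_iff]
    have h1 := hoff u v
    have := huv.ne
    tauto

theorem exists_class1 [Finite V] {n k : ℕ} (hn : Nat.card V = n) (hk : 1 ≤ k) (hkn : k ≤ n)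
    {A C : Set V} (hA : A.ncard = tOf k) (hC : C.ncard = k - 2 * tOf k) (hAC : Disjoint A C)
    (hoff : ∀ u w, u ∉ A → w ∉ A → G.Adj u w → u ∈ C ∧ w ∈ C) : ∃ H ∈ class1 V n k, G ≤ H := by
  obtain ⟨H, hH, hGH⟩ := exists_isH hn (by unfold tOf; omega) hkn hA hC hAC hoff
  exact ⟨H, ⟨hn, hH⟩, hGH⟩

/-- If the edges off `A` form a star with center `b` whose leaves have no neighbors other than `a` and
`b`, then `G` is contained in a graph of the class with `J` the set of leaves. -/
theorem exists_class2 {n k : ℕ} (hn : Nat.card V = n) {A : Set V} (hA : A.ncard = tOf k)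
    {a b : V} (ha : a ∈ A) (hb : b ∉ A)
    (hoff : ∀ u w, u ∉ A → w ∉ A → G.Adj u w → u = b ∨ w = b)
    (hleaf : ∀ c, c ∉ A → G.Adj c b → ∀ w, G.Adj c w → w = a ∨ w = b) :
    ∃ H ∈ class2 V n k, G ≤ H := by
  have hbb := G.irrefl (v := b)
  refine ⟨SimpleGraph.fromRel fun u v => (u ∈ A ∧ v ∈ A) ∨ (u ∈ A ∧ v ∉ A ∧ ¬ G.Adj v b) ∨
    (u ∉ A ∧ G.Adj u b ∧ (v = a ∨ v = b)), ⟨hn, A, {v | v ∉ A ∧ ¬ G.Adj v b},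
    {v | v ∉ A ∧ G.Adj v b}, ⟨?_, ?_, ?_, ?_⟩, hA, a, ha, b, ⟨hb, hbb⟩, ?_, ?_, ?_, ?_⟩, ?_⟩
  · ext v
    simp only [Set.mem_union, Set.mem_ofPred_eq, Set.mem_univ, iff_true]
    tauto
  · exact Set.disjoint_left.2 fun v hv hv' => hv'.1 hv
  · exact Set.disjoint_left.2 fun v hv hv' => hv'.1 hv
  · exact Set.disjoint_left.2 fun v hv hv' => hv.2 hv'.2
  · intro u hu v hv huv
    rw [SimpleGraph.fromRel_adj]
    exact ⟨huv, .inl (.inl ⟨hu, hv⟩)⟩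
  · rintro u ⟨hu, hub⟩ v ⟨hv, hvb⟩ huv
    rw [SimpleGraph.fromRel_adj]
    tauto
  · rintro u hu v ⟨hv, hvb⟩
    rw [SimpleGraph.fromRel_adj]
    exact ⟨fun e => hv (e ▸ hu), .inl (.inr (.inl ⟨hu, hv, hvb⟩))⟩
  · rintro c ⟨hc, hcb⟩
    ext v
    simp only [SimpleGraph.mem_neighborSet, SimpleGraph.fromRel_adj, Set.mem_insert_iff,
      Set.mem_singleton_iff]
    grind
  · intro u v huv
    rw [SimpleGraph.fromRel_adj]
    have h1 := hoff u v
    have h2 := hleaf u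
    have h3 := hleaf v
    have := huv.symm
    have := huv.ne
    grind

theorem IsComponent.congr {H : SimpleGraph V} {J S : Set V}
    (h : ∀ u ∈ J, ∀ v, G.Adj u v ↔ H.Adj u v) (hS : IsComponent G J S) : IsComponent H J S := by
  refine ⟨hS.1, ?_, fun u hu v hv huv => hS.2.2 u hu v hv ((h u (hS.1 hu) v).2 huv)⟩
  convert hS.2.1 using 1
  ext u v
  exact (h u (hS.1 u.2) v).symm

theorem isStarAt_congr {H : SimpleGraph V} {J S : Set V} {z : V}
    (h : ∀ u ∈ J, ∀ v, G.Adj u v ↔ H.Adj u v) (hS : S ⊆ J) :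
    IsStarAt G S z ↔ IsStarAt H S z := by
  unfold IsStarAt
  refine and_congr_right fun _ => forall₂_congr fun u hu => forall₂_congr fun v _ => ?_
  rw [h u (hS hu)]

/-- The larger graph has all edges between `A` and the complement of `J`; the edges that meet `J` are
those of `G`. -/
theorem exists_class3 {n k : ℕ} (hn : Nat.card V = n) {A J : Set V} (hA : A.ncard = tOf k)
    (hAJ : Disjoint A J) {x y : V} (hx : x ∈ A) (hy : y ∈ A) (hxy : x ≠ y)
    (hoff : ∀ u, u ∉ A → u ∉ J → ∀ w, G.Adj u w → w ∈ A)
    (hJ : ∀ u ∈ J, ∀ w, G.Adj u w → w ∈ J ∨ w = x ∨ w = y)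
    (hJx : ∃ c ∈ J, G.Adj c x) (hJy : ∃ c ∈ J, G.Adj c y)
    (htwo : ∃ S T : Set V, S ≠ T ∧ IsComponent G J S ∧ IsComponent G J T)
    (hstar : ∀ S : Set V, IsComponent G J S → 2 ≤ S.ncard ∧ ∃ z, IsStarAt G S z)
    (hleaf : ∀ S : Set V, IsComponent G J S → 3 ≤ S.ncard → ∀ z, IsStarAt G S z →
        ∃ a, (a = x ∨ a = y) ∧ ∀ c ∈ S, c ≠ z → ∀ v, v = x ∨ v = y → (G.Adj c v ↔ v = a)) :
    ∃ H ∈ class3 V n k, G ≤ H := by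
  have hAJ' : ∀ v, v ∈ A → v ∉ J := fun v hv => Set.disjoint_left.1 hAJ hv
  let H := SimpleGraph.fromRel fun u v => G.Adj u v ∨ (u ∈ A ∧ v ∉ J)
  have hH : ∀ u v, H.Adj u v ↔ u ≠ v ∧ ((G.Adj u v ∨ (u ∈ A ∧ v ∉ J)) ∨
      (G.Adj v u ∨ (v ∈ A ∧ u ∉ J))) := fun u v => SimpleGraph.fromRel_adj _ _ _
  have hcongr : ∀ u ∈ J, ∀ v, G.Adj u v ↔ H.Adj u v := by
    intro u hu v
    rw [hH]
    have := hAJ' u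
    have := @SimpleGraph.Adj.symm _ G u v
    have := @SimpleGraph.Adj.symm _ G v u
    have := @SimpleGraph.Adj.ne _ G u v
    tauto
  have hcongr' : ∀ u ∈ J, ∀ v, H.Adj u v ↔ G.Adj u v := fun u hu v => (hcongr u hu v).symm
  refine ⟨H, ⟨hn, A, {v | v ∉ A ∧ v ∉ J}, J, ⟨?_, ?_, hAJ, ?_⟩, hA, ?_, ?_, ?_, ?_, ?_, {x, y},
    ?_, Set.ncard_pair hxy, ?_, ?_⟩, ?_⟩
  · ext v
    simp only [Set.mem_union, Set.mem_ofPred_eq, Set.mem_univ, iff_true]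
    tauto
  · exact Set.disjoint_left.2 fun v hv hv' => hv'.1 hv
  · exact Set.disjoint_left.2 fun v hv hv' => hv.2 hv'
  · intro u hu v hv huv
    exact (hH u v).2 ⟨huv, .inl (.inr ⟨hu, hAJ' v hv⟩)⟩
  · rintro u ⟨hu, huJ⟩ v ⟨hv, hvJ⟩ huv
    rw [hH]
    have := hoff u hu huJ v
    have := hoff v hv hvJ u
    tauto
  · rintro u hu v ⟨hv, hvJ⟩
    exact (hH u v).2 ⟨fun e => hv (e ▸ hu), .inl (.inr ⟨hu, hvJ⟩)⟩
  · obtain ⟨S, T, hST, hS, hT⟩ := htwo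
    exact ⟨S, T, hST, hS.congr hcongr, hT.congr hcongr⟩
  · intro S hS
    obtain ⟨h1, z, hz⟩ := hstar S (hS.congr hcongr')
    exact ⟨h1, z, (isStarAt_congr hcongr hS.1).1 hz⟩
  · rintro v (rfl | rfl)
    · exact hx
    · exact hy
  · ext v
    simp only [Set.mem_ofPred_eq, Set.mem_insert_iff, Set.mem_singleton_iff, Set.mem_union]
    constructor
    · rintro ⟨hv, c, hc, hcv⟩
      have := hJ c hc v ((hcongr c hc v).2 hcv)
      have := hAJ' v
      tauto
    · rintro (rfl | rfl)
      · obtain ⟨c, hc, hcx⟩ := hJx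
        exact ⟨.inl hx, c, hc, (hcongr c hc _).1 hcx⟩
      · obtain ⟨c, hc, hcx⟩ := hJy
        exact ⟨.inl hy, c, hc, (hcongr c hc _).1 hcx⟩
  · intro S hS h3 z hz
    obtain ⟨a, ha, hall⟩ := hleaf S (hS.congr hcongr') h3 z ((isStarAt_congr hcongr hS.1).2 hz)
    refine ⟨a, ha, fun c hc v hv => ?_⟩
    rw [← hcongr c (hS.1 hc.1)]
    exact hall c hc.1 hc.2 v hv
  · intro u v huv
    exact (hH u v).2 ⟨huv.ne, .inl (.inl huv)⟩

/-! ### Components of `G - {x, y}` -/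

theorem Link.cons {S : Set V} {x o y : V} {l : List V} (h : Link G S o y l) (ho : o ∉ l)
    (hxo : G.Adj x o) : Link G (insert o S) x y (o :: l) :=
  ⟨List.nodup_cons.2 ⟨ho, h.nodup⟩, by
    intro z hz
    rcases List.mem_cons.1 hz with rfl | hz
    · exact Set.mem_insert _ _
    · exact Set.mem_insert_of_mem _ (h.mem z hz), by
    simpa using ⟨hxo, h.chain⟩⟩

theorem Link.concat {S : Set V} {x o y : V} {l : List V} (h : Link G S x o l) (ho : o ∉ l)
    (hoy : G.Adj o y) : Link G (insert o S) x y (l ++ [o]) := by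
  have := (h.reverse.cons (by simpa using ho) hoy.symm).reverse
  simpa using this

/-- `S` has a neighbor of `o` among its vertices. -/
def Touches (G : SimpleGraph V) (S : Set V) (o : V) : Prop := ∃ k ∈ S, G.Adj k o

theorem Touches.exists_link {S : Set V} {o o' : V} (h : Touches G S o) (h' : Touches G S o')
    (hS : (G.induce S).Connected) : ∃ l, Link G S o o' l ∧ 1 ≤ l.length := by
  obtain ⟨k, hk, hko⟩ := h
  obtain ⟨k', hk', hko'⟩ := h'
  obtain ⟨l, hl, h1, -⟩ := LongCycles.exists_link hS.preconnected hk hk' hko.symm hko'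
  exact ⟨l, hl, h1⟩

/-- Two components of `G - {x, y}` together carry a cycle. -/
theorem NoLongCycle.links_lt {k : ℕ} (h : NoLongCycle G k) {x y : V} {S T : Set V} (hxy : x ≠ y)
    (hS : IsComponent G {x, y}ᶜ S) (hT : IsComponent G {x, y}ᶜ T) (hST : S ≠ T) {l m : List V}
    (hl : Link G S x y l) (hm : Link G T x y m) (h1 : 1 ≤ l.length + m.length) :
    l.length + m.length + 2 < k :=
  h.link_link hl hm
    (fun v hv hv' => hST (hS.eq_of_mem hT (hl.mem v hv) (hm.mem v hv'))) hxy
    (fun hv => hS.closedOff.left (hl.mem x hv)) (fun hv => hT.closedOff.left (hm.mem x hv))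
    (fun hv => hS.closedOff.right (hl.mem y hv)) (fun hv => hT.closedOff.right (hm.mem y hv)) h1

theorem exists_components_of_not_noCut (hno : ¬ NoCut G) : ∃ x y, x ≠ y ∧ ∃ S T, S ≠ T ∧
    IsComponent G {x, y}ᶜ S ∧ IsComponent G {x, y}ᶜ T := by
  unfold NoCut at hno
  push Not at hno
  obtain ⟨x, y, S, hxy, hS, ⟨s, hs⟩, t, htS, htx, hty⟩ := hno
  obtain ⟨S', hsS', hS'S, hS'⟩ := hS.exists_isComponent hs
  obtain ⟨T', htT', hT'S, hT'⟩ := hS.compl.exists_isComponent (w := t) ⟨htS, htx, hty⟩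
  exact ⟨x, y, hxy, S', T', fun e => htS (hS'S (e ▸ htT')), hS', hT'⟩

/-- A separation with edges on both sides has nontrivial components on both sides. -/
theorem HasEdgeSeparation.exists_components (h : HasEdgeSeparation G) : ∃ x y, x ≠ y ∧ ∃ S T,
    S ≠ T ∧ IsComponent G {x, y}ᶜ S ∧ IsComponent G {x, y}ᶜ T ∧ S.Nontrivial ∧ T.Nontrivial := by
  obtain ⟨x, y, S, hxy, hS, ⟨s, hs, s', hs', hss⟩, t, t', htS, htx, hty, htS', htx', hty', htt⟩ := h
  obtain ⟨S', hsS', hS'S, hS'⟩ := hS.exists_isComponent hs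
  obtain ⟨T', htT', hT'S, hT'⟩ := hS.compl.exists_isComponent (w := t) ⟨htS, htx, hty⟩
  refine ⟨x, y, hxy, S', T', fun e => htS (hS'S (e ▸ htT')), hS', hT', ⟨s, hsS', s', ?_, hss.ne⟩,
    ⟨t, htT', t', ?_, htt.ne⟩⟩
  · refine hS'.2.2 s hsS' s' ?_ hss
    have := hS.left
    have := hS.right
    simp only [Set.mem_compl_iff, Set.mem_insert_iff, Set.mem_singleton_iff]
    grind
  · refine hT'.2.2 t htT' t' ?_ htt
    simp only [Set.mem_compl_iff, Set.mem_insert_iff, Set.mem_singleton_iff]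
    tauto

/-- In a 2-connected graph, a vertex with at most two neighbors has exactly two. -/
theorem TwoConnected.adj_iff_of_adj (h2 : TwoConnected G) {v o o' : V}
    (h : ∀ w, G.Adj v w → w = o ∨ w = o') (hv : v ≠ o) (hv' : v ≠ o') (hoo : o ≠ o') :
    ∀ w, G.Adj v w ↔ w = o ∨ w = o' := by
  obtain ⟨_, _, p, p', rfl, rfl, -, -, hpp, e1, e2⟩ := h2.exists_two_attachments (K := {v})
    ⟨v, rfl⟩ (o₁ := o) (o₂ := o') (by simpa using hv.symm) (by simpa using hv'.symm) hoo
  intro w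
  refine ⟨h w, ?_⟩
  have := h p e1
  have := h p' e2
  grind

section components

variable {x y : V} {S : Set V}

theorem IsComponent.touches (hS : IsComponent G {x, y}ᶜ S) (h2 : TwoConnected G) (hxy : x ≠ y) :
    Touches G S x ∧ Touches G S y := by
  obtain ⟨k, k', o, o', hk, hk', ho, ho', hoo, e1, e2⟩ :=
    h2.exists_two_attachments hS.nonempty hS.closedOff.left hS.closedOff.right hxy
  have h1 := (hS.closedOff.adj k hk o e1).resolve_left ho
  have h2 := (hS.closedOff.adj k' hk' o' e2).resolve_left ho'
  unfold Touches
  grind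

theorem IsComponent.exists_link (hS : IsComponent G {x, y}ᶜ S) (h2 : TwoConnected G)
    (hxy : x ≠ y) : ∃ l, Link G S x y l ∧ 1 ≤ l.length ∧ (S.Nontrivial → 2 ≤ l.length) :=
  hS.closedOff.exists_link_of_connected h2 hxy hS.2.1

theorem IsComponent.adj_iff_of_subsingleton (hS : IsComponent G {x, y}ᶜ S) (h2 : TwoConnected G)
    (hxy : x ≠ y) (hn : ¬ S.Nontrivial) {v : V} (hv : v ∈ S) :
    ∀ w, G.Adj v w ↔ w = x ∨ w = y := by
  have hsub := Set.not_nontrivial_iff.1 hn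
  refine h2.adj_iff_of_adj (fun w hw => (hS.closedOff.adj v hv w hw).resolve_left fun hh =>
    G.irrefl (hsub hv hh ▸ hw)) (fun e => hS.closedOff.left (e ▸ hv))
    (fun e => hS.closedOff.right (e ▸ hv)) hxy

/-- The neighbors of a component of `S - P` outside it. -/
theorem IsComponent.adj_of_diff (hS : IsComponent G {x, y}ᶜ S) {P K : Set V}
    (hK : IsComponent G (S \ P) K) : ∀ k ∈ K, ∀ o, G.Adj k o → o ∉ K → o ∈ P ∨ o = x ∨ o = y := by
  intro k hk o hko hoK
  by_contra hcon
  push Not at hcon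
  have h1 := (hS.closedOff.adj k (hK.1 hk).1 o hko).resolve_right (by tauto)
  exact hoK (hK.2.2 k hk o ⟨h1, hcon.1⟩ hko)

/-- If the component carries no path from `x` to `y` longer than `x, s, s', y`, then every vertex of it
that remains connected with `s` after `s` and `s'` are deleted has exactly the neighbors `s` and
`y`. -/
theorem IsComponent.leaf_of_touches (hS : IsComponent G {x, y}ᶜ S) (h2 : TwoConnected G)
    (hl : ∀ l, Link G S x y l → l.length ≤ 2) {s s' : V} (hs : s ∈ S) (hs' : s' ∈ S)
    (hxs : G.Adj x s) (hss : G.Adj s s') (hsy : G.Adj s' y) {K : Set V}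
    (hK : IsComponent G (S \ {s, s'}) K) (hKs : Touches G K s) {t : V} (ht : t ∈ K) :
    ∀ w, G.Adj t w ↔ w = s ∨ w = y := by
  have hKS : K ⊆ S := fun k hk => (hK.1 hk).1
  have hsK : s ∉ K := fun hh => (hK.1 hh).2 (by simp)
  have hsK' : s' ∉ K := fun hh => (hK.1 hh).2 (by simp)
  have hsne : s ≠ y := fun e => hS.closedOff.right (e ▸ hs)
  have hsub : insert s' (insert s K) ⊆ S := by
    rintro v (rfl | rfl | hv)
    exacts [hs', hs, hKS hv]
  have hx : ¬ Touches G K x := fun hh => by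
    obtain ⟨l, hl', h1⟩ := hh.exists_link hKs hK.2.1
    have h3 := (hl'.concat (fun e => hsK (hl'.mem _ e)) hss).concat (by
      have := hss.ne'
      have := fun e => hsK' (hl'.mem _ e)
      simp; tauto) hsy
    have := hl _ (h3.mono hsub)
    simp only [List.length_append, List.length_cons, List.length_nil] at this
    omega
  have hs'' : ¬ Touches G K s' := fun hh => by
    obtain ⟨l, hl', h1⟩ := hKs.exists_link hh hK.2.1
    have h3 := (hl'.cons (fun e => hsK (hl'.mem _ e)) hxs).concat (by
      have := hss.ne'
      have := fun e => hsK' (hl'.mem _ e)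
      simp; tauto) hsy
    have := hl _ (h3.mono hsub)
    simp only [List.length_append, List.length_cons, List.length_nil] at this
    omega
  have hadj := hS.adj_of_diff hK
  have hclosed : ClosedOff G K s y := by
    refine ⟨hsK, fun hh => hS.closedOff.right (hKS hh), fun k hk o hko => ?_⟩
    by_contra hcon
    push Not at hcon
    have := hadj k hk o hko hcon.1
    simp only [Set.mem_insert_iff, Set.mem_singleton_iff] at this
    have e1 : o ≠ x := by rintro rfl; exact hx ⟨k, hk, hko⟩
    have e2 : o ≠ s' := by rintro rfl; exact hs'' ⟨k, hk, hko⟩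
    tauto
  have hcomp := hclosed.isComponent hK.2.1
  refine hcomp.adj_iff_of_subsingleton h2 hsne (fun hn => ?_) ht
  obtain ⟨l, hl', -, h1⟩ := hcomp.exists_link h2 hsne
  have h3 := hl'.cons (fun e => hsK (hl'.mem _ e)) hxs
  have := hl _ (h3.mono ((Set.subset_insert _ _).trans hsub))
  have := h1 hn
  simp at *
  omega

/-- If there is a vertex of the kind described in `IsComponent.leaf_of_touches`, then all vertices of
the component except `s`, including `s'`, are of this kind. -/
theorem IsComponent.star_of_leaf (hS : IsComponent G {x, y}ᶜ S)
    (hl : ∀ l, Link G S x y l → l.length ≤ 2) {s s' t : V} (hs : s ∈ S) (hs' : s' ∈ S)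
    (ht : t ∈ S) (hts : t ≠ s') (hxs : G.Adj x s) (hss : G.Adj s s') (hsy : G.Adj s' y)
    (hall : ∀ t ∈ S, t ≠ s → t ≠ s' →
      (∀ w, G.Adj t w ↔ w = s ∨ w = y) ∨ ∀ w, G.Adj t w ↔ w = s' ∨ w = x)
    (hleaf : ∀ w, G.Adj t w ↔ w = s ∨ w = y) :
    ∀ c ∈ S, c ≠ s → ∀ w, G.Adj c w ↔ w = s ∨ w = y := by
  have hts' : G.Adj t s := (hleaf s).2 (.inl rfl)
  have hty : G.Adj t y := (hleaf y).2 (.inr rfl)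
  have hsy' : s' ≠ y := fun e => hS.closedOff.right (e ▸ hs')
  have hsx' : s' ≠ x := fun e => hS.closedOff.left (e ▸ hs')
  have hsne : s ≠ y := fun e => hS.closedOff.right (e ▸ hs)
  have hty' : t ≠ y := fun e => hS.closedOff.right (e ▸ ht)
  have h1 : ∀ c ∈ S, c ≠ s → c ≠ s' → ∀ w, G.Adj c w ↔ w = s ∨ w = y := by
    intro c hc hcs hcs'
    refine (hall c hc hcs hcs').resolve_right fun hh => ?_
    have hcs'' : G.Adj c s' := (hh s').2 (.inl rfl)
    have hcx : G.Adj c x := (hh x).2 (.inr rfl)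
    have hct : c ≠ t := by
      rintro rfl
      have := (hleaf s').1 hcs''
      have := hss.ne
      grind
    have := hl [c, s', s, t] ⟨by simp; grind [hss.ne], by simp; grind,
      by simpa using ⟨hcx.symm, hcs'', hss.symm, hts'.symm, hty⟩⟩
    simp at this
  intro c hc hcs
  by_cases hcs' : c = s'
  swap
  · exact h1 c hc hcs hcs'
  subst hcs'
  intro w
  constructor
  · intro hcw
    by_contra hcon
    push Not at hcon
    rcases hS.closedOff.adj c hc w hcw with hw | rfl | rfl
    · have := (h1 w hw hcon.1 hcw.ne' c).1 hcw.symm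
      grind
    · have := hl [c, s, t] ⟨by simp; grind, by simp; grind,
        by simpa using ⟨hcw.symm, hss.symm, hts'.symm, hty⟩⟩
      simp at this
    · exact hcon.2 rfl
  · rintro (rfl | rfl)
    · exact hss.symm
    · exact hsy

/-- The shape of a nontrivial component without paths from `x` to `y` longer than three: a single edge, or a star with
all leaves adjacent to the same vertex outside. -/
theorem IsComponent.pair_or_star (hS : IsComponent G {x, y}ᶜ S) (h2 : TwoConnected G)
    (hxy : x ≠ y) (hn : S.Nontrivial) (hl : ∀ l, Link G S x y l → l.length ≤ 2) :
    (∃ s s', G.Adj s s' ∧ S = {s, s'}) ∨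
    ∃ z a, z ∈ S ∧ (a = x ∨ a = y) ∧ ∀ c ∈ S, c ≠ z → ∀ w, G.Adj c w ↔ w = z ∨ w = a := by
  obtain ⟨l, hl', -, hl2⟩ := hS.exists_link h2 hxy
  have hlen : l.length = 2 := le_antisymm (hl l hl') (hl2 hn)
  obtain ⟨s, s', rfl⟩ := List.length_eq_two.1 hlen
  have hs : s ∈ S := hl'.mem s (by simp)
  have hs' : s' ∈ S := hl'.mem s' (by simp)
  obtain ⟨hxs, hss, hsy⟩ : G.Adj x s ∧ G.Adj s s' ∧ G.Adj s' y := by simpa using hl'.chain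
  have hS' : IsComponent G {y, x}ᶜ S := Set.pair_comm x y ▸ hS
  have hlr : ∀ l, Link G S y x l → l.length ≤ 2 := fun l h => by
    simpa using hl _ h.reverse
  have hall : ∀ t ∈ S, t ≠ s → t ≠ s' →
      (∀ w, G.Adj t w ↔ w = s ∨ w = y) ∨ ∀ w, G.Adj t w ↔ w = s' ∨ w = x := by
    intro t ht hts hts'
    obtain ⟨K, htK, hK⟩ := exists_isComponent (G := G) (W := S \ {s, s'}) (w := t)
      ⟨ht, by simp [hts, hts']⟩
    obtain ⟨u, v, huS, hvS, huK, hvK, huv⟩ := exists_crossing hS.2.1.preconnected ht hs htK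
      (fun hh => (hK.1 hh).2 (by simp))
    have hv : v = s ∨ v = s' := by
      by_contra hcon
      exact hvK (hK.2.2 u huK v ⟨hvS, by simpa using hcon⟩ huv)
    rcases hv with rfl | rfl
    · exact .inl (hS.leaf_of_touches h2 hl hs hs' hxs hss hsy hK ⟨u, huK, huv⟩ htK)
    · exact .inr (hS'.leaf_of_touches h2 hlr hs' hs hsy.symm hss.symm hxs.symm
        (Set.pair_comm s v ▸ hK) ⟨u, huK, huv⟩ htK)
  by_cases ht : ∃ t ∈ S, t ≠ s ∧ t ≠ s'
  · obtain ⟨t, ht, hts, hts'⟩ := ht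
    rcases hall t ht hts hts' with hh | hh
    · exact .inr ⟨s, y, hs, .inr rfl, hS.star_of_leaf hl hs hs' ht hts' hxs hss hsy hall hh⟩
    · exact .inr ⟨s', x, hs', .inl rfl, hS'.star_of_leaf hlr hs' hs ht hts hsy.symm hss.symm
        hxs.symm (fun c hc h1 h2 => (hall c hc h2 h1).symm) hh⟩
  · push Not at ht
    refine .inl ⟨s, s', hss, ?_⟩
    ext v
    simp only [Set.mem_insert_iff, Set.mem_singleton_iff]
    grind

end components

/-! ### Two vertices with small components -/

/-- The components of `G - {x, y}` outside `D` carry no path from `x` to `y` longer than three, while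
`D` is a union of components with no edges off `A`, a set that contains `x` and `y`. -/
structure Frame (G : SimpleGraph V) (x y : V) (A D : Set V) : Prop where
  ne : x ≠ y
  left_mem : x ∈ A
  right_mem : y ∈ A
  closed : ClosedOff G D x y
  sub : ∀ a ∈ A, a = x ∨ a = y ∨ a ∈ D
  cover : ∀ u ∈ D, ∀ w ∈ D, G.Adj u w → u ∈ A ∨ w ∈ A
  short : ∀ S, IsComponent G {x, y}ᶜ S → Disjoint S D → ∀ l, Link G S x y l → l.length ≤ 2

theorem IsComponent.exists_adj {W S : Set V} (hS : IsComponent G W S) (hn : S.Nontrivial) {u : V}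
    (hu : u ∈ S) : ∃ w ∈ S, G.Adj u w := by
  obtain ⟨v, hv, hvu⟩ := hn.exists_ne u
  obtain ⟨a, b, ha, hb, hau, hbu, hab⟩ := exists_crossing (S := {u}) hS.2.1.preconnected hu hv rfl
    hvu
  rw [Set.mem_singleton_iff] at hau
  exact ⟨b, hb, hau ▸ hab⟩

theorem isStarAt_of_forall {S : Set V} {z a : V} (hz : z ∈ S) (ha : a ∉ S)
    (h : ∀ c ∈ S, c ≠ z → ∀ w, G.Adj c w ↔ w = z ∨ w = a) : IsStarAt G S z := by
  refine ⟨hz, fun u hu v hv => ⟨fun huv => ⟨huv.ne, ?_⟩, ?_⟩⟩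
  · have := h u hu
    grind
  · rintro ⟨hne, rfl | rfl⟩
    · exact ((h v hv hne.symm u).2 (.inl rfl)).symm
    · exact (h u hu hne v).2 (.inl rfl)

namespace Frame

variable {x y : V} {A D : Set V}

theorem disjoint (hF : Frame G x y A D) {S : Set V} (hS : IsComponent G {x, y}ᶜ S) {u : V}
    (hu : u ∈ S) (huD : u ∉ D) : Disjoint S D :=
  Set.disjoint_left.2 fun _ hv hvD => huD (hS.subset_of_mem (fun a ha b hb hab =>
    (hF.closed.adj a ha b hab).resolve_right hb) hv hvD hu)

/-- With two nontrivial components outside `D`, the set `J` consists of all nontrivial components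
outside `D`. -/
theorem exists_class3 [Finite V] {n k : ℕ} (hF : Frame G x y A D) (hn : Nat.card V = n)
    (h2 : TwoConnected G) (hA : A.ncard = tOf k) {S T : Set V} (hST : S ≠ T)
    (hS : IsComponent G {x, y}ᶜ S) (hT : IsComponent G {x, y}ᶜ T) (hSD : Disjoint S D)
    (hTD : Disjoint T D) (hSn : S.Nontrivial) (hTn : T.Nontrivial) :
    ∃ H ∈ class3 V n k, G ≤ H := by
  have hxD := hF.closed.left
  have hyD := hF.closed.right
  set J : Set V := {v | v ≠ x ∧ v ≠ y ∧ v ∉ D ∧ ∃ w, w ≠ x ∧ w ≠ y ∧ G.Adj v w} with hJdef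
  have hJ : ∀ u ∈ J, ∀ w, G.Adj u w → w ∈ J ∨ w = x ∨ w = y := by
    rintro u ⟨hux, huy, huD, -⟩ w huw
    by_contra hcon
    push Not at hcon
    refine hcon.1 ⟨hcon.2.1, hcon.2.2, fun hw => ?_, u, hux, huy, huw.symm⟩
    have := hF.closed.adj w hw u huw.symm
    tauto
  have of_J : ∀ S, IsComponent G J S → IsComponent G {x, y}ᶜ S ∧ S.Nontrivial ∧ Disjoint S D := by
    intro S hS
    have hS' : IsComponent G {x, y}ᶜ S := by
      refine ⟨fun v hv => ?_, hS.2.1, fun u hu v hv huv => hS.2.2 u hu v ?_ huv⟩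
      · have := hS.1 hv
        simp only [Set.mem_compl_iff, Set.mem_insert_iff, Set.mem_singleton_iff, not_or]
        exact ⟨this.1, this.2.1⟩
      · exact (hJ u (hS.1 hu) v huv).resolve_right hv
    obtain ⟨u, hu⟩ := hS.nonempty
    obtain ⟨hux, huy, huD, w, hwx, hwy, huw⟩ := hS.1 hu
    exact ⟨hS', ⟨u, hu, w, hS'.2.2 u hu w (by simp [hwx, hwy]) huw, huw.ne⟩,
      hF.disjoint hS' hu huD⟩
  have to_J : ∀ S, IsComponent G {x, y}ᶜ S → S.Nontrivial → Disjoint S D → IsComponent G J S := by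
    intro S hS hn hD
    have hxS := hS.closedOff.left
    have hyS := hS.closedOff.right
    refine ⟨fun u hu => ?_, hS.2.1, fun u hu v hv huv => hS.2.2 u hu v ?_ huv⟩
    · obtain ⟨w, hw, huw⟩ := hS.exists_adj hn hu
      exact ⟨fun e => hxS (e ▸ hu), fun e => hyS (e ▸ hu), Set.disjoint_left.1 hD hu, w,
        fun e => hxS (e ▸ hw), fun e => hyS (e ▸ hw), huw⟩
    · simp only [Set.mem_compl_iff, Set.mem_insert_iff, Set.mem_singleton_iff, not_or]
      exact ⟨hv.1, hv.2.1⟩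
  obtain ⟨⟨c, hc, hcx⟩, ⟨d, hd, hdy⟩⟩ := hS.touches h2 hF.ne
  have hSJ := (to_J S hS hSn hSD).1
  refine LongCycles.exists_class3 hn hA ?_ hF.left_mem hF.right_mem hF.ne ?_ hJ ⟨c, hSJ hc, hcx⟩
    ⟨d, hSJ hd, hdy⟩ ⟨S, T, hST, to_J S hS hSn hSD, to_J T hT hTn hTD⟩ ?_ ?_
  · refine Set.disjoint_left.2 fun a ha hJ => ?_
    have := hF.sub a ha
    have := hJ.1
    have := hJ.2.1
    have := hJ.2.2.1
    tauto
  · intro u hu huJ w huw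
    by_contra hw
    have hux : u ≠ x := fun e => hu (e ▸ hF.left_mem)
    have huy : u ≠ y := fun e => hu (e ▸ hF.right_mem)
    have hwx : w ≠ x := fun e => hw (e ▸ hF.left_mem)
    have hwy : w ≠ y := fun e => hw (e ▸ hF.right_mem)
    have huD : u ∈ D := by
      by_contra huD
      exact huJ ⟨hux, huy, huD, w, hwx, hwy, huw⟩
    have := hF.cover u huD w ((hF.closed.adj u huD w huw).resolve_right (by tauto)) huw
    tauto
  · intro S hS
    obtain ⟨hS', hn, hD⟩ := of_J S hS
    refine ⟨Set.one_lt_ncard_iff_nontrivial.2 hn, ?_⟩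
    rcases hS'.pair_or_star h2 hF.ne hn (hF.short S hS' hD) with ⟨s, s', hss, rfl⟩ |
      ⟨z, a, hz, ha, hall⟩
    · refine ⟨s, by simp, fun u hu v hv => ?_⟩
      simp only [Set.mem_insert_iff, Set.mem_singleton_iff] at hu hv
      rcases hu with rfl | rfl <;> rcases hv with rfl | rfl <;>
        simp [hss, hss.symm, hss.ne, hss.ne']
    · refine ⟨z, isStarAt_of_forall hz ?_ hall⟩
      rcases ha with rfl | rfl
      exacts [hS'.closedOff.left, hS'.closedOff.right]
  · intro S hS h3 z hz
    obtain ⟨hS', hn, hD⟩ := of_J S hS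
    rcases hS'.pair_or_star h2 hF.ne hn (hF.short S hS' hD) with ⟨s, s', hss, rfl⟩ |
      ⟨z', a, hz', ha, hall⟩
    · rw [Set.ncard_pair hss.ne] at h3
      omega
    · have hzz : z = z' := by
        by_contra hne
        have h4 : ({z, z'} : Set V).ncard < S.ncard := by
          rw [Set.ncard_pair hne]
          omega
        obtain ⟨c, hc, hcn⟩ := Set.exists_mem_notMem_of_ncard_lt_ncard h4
        simp only [Set.mem_insert_iff, Set.mem_singleton_iff, not_or] at hcn
        have := (hz.2 c hc z' hz').1 ((hall c hc hcn.2 z').2 (.inl rfl))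
        grind
      subst hzz
      refine ⟨a, ha, fun c hc hcz v hv => ?_⟩
      rw [hall c hc hcz v]
      have hvS : v ∉ S := by
        rcases hv with rfl | rfl
        exacts [hS'.closedOff.left, hS'.closedOff.right]
      have : v ≠ z := fun e => hvS (e ▸ hz')
      tauto

/-- With at most one nontrivial component outside `D`, all edges off `A` lie in this component, which
is an edge or a star. For `k = 6` and `k = 8` the set `C` of `H_{n,k,t}` has two elements, so that it
can be any edge. -/
theorem exists_class1_or_class2 [Finite V] {n k : ℕ} (hF : Frame G x y A D) (hn : Nat.card V = n)
    (h2 : TwoConnected G) (hk : k = 6 ∨ k = 8) (hkn : k ≤ n) (hA : A.ncard = tOf k)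
    (hone : ∀ S T, IsComponent G {x, y}ᶜ S → IsComponent G {x, y}ᶜ T → Disjoint S D →
      Disjoint T D → S.Nontrivial → T.Nontrivial → S = T) :
    ∃ H ∈ class1 V n k ∪ class2 V n k, G ≤ H := by
  have hk2 : k - 2 * tOf k = 2 := by rcases hk with rfl | rfl <;> rfl
  have hoff : ∀ u w, u ∉ A → w ∉ A → G.Adj u w → ∃ E, IsComponent G {x, y}ᶜ E ∧ Disjoint E D ∧
      E.Nontrivial ∧ u ∈ E ∧ w ∈ E := by
    intro u w hu hw huw
    have hux : u ≠ x := fun e => hu (e ▸ hF.left_mem)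
    have huy : u ≠ y := fun e => hu (e ▸ hF.right_mem)
    have hwx : w ≠ x := fun e => hw (e ▸ hF.left_mem)
    have hwy : w ≠ y := fun e => hw (e ▸ hF.right_mem)
    have huD : u ∉ D := by
      intro huD
      have := hF.cover u huD w ((hF.closed.adj u huD w huw).resolve_right (by tauto)) huw
      tauto
    obtain ⟨E, huE, hE⟩ := exists_isComponent (G := G) (W := {x, y}ᶜ) (w := u) (by simp [hux, huy])
    have hwE := hE.2.2 u huE w (by simp [hwx, hwy]) huw
    exact ⟨E, hE, hF.disjoint hE huE huD, ⟨u, huE, w, hwE, huw.ne⟩, huE, hwE⟩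
  have hEA : ∀ E, IsComponent G {x, y}ᶜ E → Disjoint E D → Disjoint A E := by
    refine fun E hE hD => Set.disjoint_left.2 fun a ha haE => ?_
    have := Set.disjoint_left.1 hD haE
    rcases hF.sub a ha with rfl | rfl | hh
    exacts [hE.closedOff.left haE, hE.closedOff.right haE, this hh]
  by_cases hex : ∃ E, IsComponent G {x, y}ᶜ E ∧ Disjoint E D ∧ E.Nontrivial
  · obtain ⟨E, hE, hED, hEn⟩ := hex
    have hoffE : ∀ u w, u ∉ A → w ∉ A → G.Adj u w → u ∈ E ∧ w ∈ E := by
      intro u w hu hw huw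
      obtain ⟨E', hE', hED', hEn', hu', hw'⟩ := hoff u w hu hw huw
      rw [hone E E' hE hE' hED hED' hEn hEn']
      exact ⟨hu', hw'⟩
    rcases hE.pair_or_star h2 hF.ne hEn (hF.short E hE hED) with ⟨s, s', hss, rfl⟩ |
      ⟨z, a, hz, ha, hall⟩
    · obtain ⟨H, hH, hGH⟩ := exists_class1 hn (by omega) hkn hA
        (by rw [Set.ncard_pair hss.ne, hk2]) (hEA _ hE hED) hoffE
      exact ⟨H, .inl hH, hGH⟩
    · have hzA : z ∉ A := fun hh => Set.disjoint_left.1 (hEA E hE hED) hh hz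
      have haA : a ∈ A := by
        rcases ha with rfl | rfl
        exacts [hF.left_mem, hF.right_mem]
      obtain ⟨H, hH, hGH⟩ := exists_class2 hn hA haA hzA (fun u w hu hw huw => by
        obtain ⟨hu', hw'⟩ := hoffE u w hu hw huw
        by_cases huz : u = z
        · exact .inl huz
        · have := (hall u hu' huz w).1 huw
          refine .inr (this.resolve_right fun e => hw (e ▸ haA))) (fun c hc hcz w hcw =>
        ((hall c (hoffE c z hc hzA hcz).1 hcz.ne w).1 hcw).symm)
      exact ⟨H, .inr hH, hGH⟩
  · have h1 := Set.ncard_add_ncard_compl A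
    -- there are no edges off `A`, and any two vertices can serve as `C`
    obtain ⟨C, hCA, hC⟩ := Set.exists_subset_card_eq (s := Aᶜ) (n := 2)
      (by rcases hk with rfl | rfl <;> simp [tOf] at hA <;> omega)
    obtain ⟨H, hH, hGH⟩ := exists_class1 hn (by omega) hkn hA (hC.trans hk2.symm)
      (Set.disjoint_left.2 fun a ha haC => hCA haC ha) (fun u w hu hw huw => by
        obtain ⟨E, h1, h2, h3, -⟩ := hoff u w hu hw huw
        exact absurd ⟨E, h1, h2, h3⟩ hex)
    exact ⟨H, .inl hH, hGH⟩

/-- If no component is exceptional, then `D` is empty. -/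
theorem of_short (hxy : x ≠ y)
    (short : ∀ S, IsComponent G {x, y}ᶜ S → ∀ l, Link G S x y l → l.length ≤ 2) :
    Frame G x y {x, y} ∅ where
  ne := hxy
  left_mem := by simp
  right_mem := by simp
  closed := ⟨by simp, by simp, by simp⟩
  sub := by simp
  cover := by simp
  short S hS _ := short S hS

end Frame

theorem exists_ne_component {S₀ T₀ : Set V} (hST : S₀ ≠ T₀) (S : Set V) :
    ∃ T, (T = S₀ ∨ T = T₀) ∧ S ≠ T := by
  by_cases h : S = S₀
  · exact ⟨T₀, .inr rfl, fun e => hST (h ▸ e)⟩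
  · exact ⟨S₀, .inl rfl, h⟩

theorem TwoConnected.not_noLongCycle_four (h2 : TwoConnected G) (hn : 4 ≤ Nat.card V) :
    ¬ NoLongCycle G 4 := by
  intro h
  obtain ⟨x, y, hxy, S, T, hST, hS, hT⟩ :=
    exists_components_of_not_noCut fun hno => hno.not_noLongCycle_six h2 (by omega) hn h
  obtain ⟨l, hl, h1, -⟩ := hS.exists_link h2 hxy
  obtain ⟨m, hm, h1', -⟩ := hT.exists_link h2 hxy
  have := h.links_lt hxy hS hT hST hl hm (by omega)
  omega

theorem TwoConnected.exists_class_five [Finite V] {n : ℕ} (h2 : TwoConnected G)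
    (hn : Nat.card V = n) (h5 : 5 ≤ n) (h : NoLongCycle G 5) : ∃ H ∈ class1 V n 5, G ≤ H := by
  obtain ⟨x, y, hxy, S₀, T₀, hST, hS₀, hT₀⟩ :=
    exists_components_of_not_noCut fun hno => hno.not_noLongCycle_six h2 (by omega) (by omega) h
  have hsub : ∀ S, IsComponent G {x, y}ᶜ S → ¬ S.Nontrivial := by
    intro S hS hSn
    obtain ⟨T, hT, hne⟩ := exists_ne_component hST S
    have hT' : IsComponent G {x, y}ᶜ T := by rcases hT with rfl | rfl <;> assumption
    obtain ⟨l, hl, -, h1⟩ := hS.exists_link h2 hxy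
    obtain ⟨m, hm, h1', -⟩ := hT'.exists_link h2 hxy
    have := h1 hSn
    have := h.links_lt hxy hS hT' hne hl hm (by omega)
    omega
  obtain ⟨c, hc⟩ := hS₀.nonempty
  refine exists_class1 hn (by omega) h5 (A := {x, y}) (C := {c}) (Set.ncard_pair hxy)
    (Set.ncard_singleton c) ?_ fun u w hu hw huw => ?_
  · rw [Set.disjoint_singleton_right]
    exact hS₀.1 hc
  · obtain ⟨S, huS, hS⟩ := exists_isComponent (G := G) (W := {x, y}ᶜ) (w := u) hu
    exact absurd ⟨u, huS, w, hS.2.2 u huS w hw huw, huw.ne⟩ (hsub S hS)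

theorem TwoConnected.exists_class_six [Finite V] {n : ℕ} (h2 : TwoConnected G)
    (hn : Nat.card V = n) (h6 : 6 ≤ n) (h : NoLongCycle G 6) :
    ∃ H ∈ class1 V n 6 ∪ class2 V n 6, G ≤ H := by
  obtain ⟨x, y, hxy, S₀, T₀, hST, hS₀, hT₀⟩ :=
    exists_components_of_not_noCut fun hno => hno.not_noLongCycle_six h2 le_rfl (by omega) h
  have hF : Frame G x y {x, y} ∅ := .of_short hxy fun S hS l hl => by
    obtain ⟨T, hT, hne⟩ := exists_ne_component hST S
    have hT' : IsComponent G {x, y}ᶜ T := by rcases hT with rfl | rfl <;> assumption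
    obtain ⟨m, hm, h1', -⟩ := hT'.exists_link h2 hxy
    have := h.links_lt hxy hS hT' hne hl hm (by omega)
    omega
  refine hF.exists_class1_or_class2 hn h2 (.inl rfl) h6 (Set.ncard_pair hxy)
    fun S T hS hT _ _ hSn hTn => ?_
  by_contra hne
  obtain ⟨l, hl, -, h1⟩ := hS.exists_link h2 hxy
  obtain ⟨m, hm, -, h1'⟩ := hT.exists_link h2 hxy
  have := h1 hSn
  have := h1' hTn
  have := h.links_lt hxy hS hT hne hl hm (by omega)
  omega

theorem TwoConnected.exists_class_seven [Finite V] {n : ℕ} (h2 : TwoConnected G)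
    (hn : Nat.card V = n) (h7 : 7 ≤ n) (h : NoLongCycle G 7) (hcut : CutsAdjacent G)
    (he : 2 * n + 1 ≤ G.edgeSet.ncard) : ∃ H ∈ extremalClass V n 7, G ≤ H := by
  by_cases hsep : HasEdgeSeparation G
  · obtain ⟨x, y, hxy, S₀, T₀, hST, hS₀, hT₀, hSn, hTn⟩ := hsep.exists_components
    have hF : Frame G x y {x, y} ∅ := .of_short hxy fun S hS l hl => by
      obtain ⟨T, hT, hne⟩ := exists_ne_component hST S
      have hT' : IsComponent G {x, y}ᶜ T ∧ T.Nontrivial := by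
        rcases hT with rfl | rfl <;> exact ⟨by assumption, by assumption⟩
      obtain ⟨m, hm, -, h1'⟩ := hT'.1.exists_link h2 hxy
      have := h1' hT'.2
      have := h.links_lt hxy hS hT'.1 hne hl hm (by omega)
      omega
    obtain ⟨H, hH, hGH⟩ := hF.exists_class3 (k := 6) hn h2 (Set.ncard_pair hxy) hST hS₀ hT₀
      (by simp) (by simp) hSn hTn
    exact ⟨H, .inr hH, hGH⟩
  · obtain ⟨A, B, hAB, hoff⟩ := exists_core_seven n hn h7 h2 h hcut hsep he
    obtain ⟨b, hb⟩ : B.Nonempty := Set.nonempty_of_ncard_ne_zero (by have := hAB.card_right; omega)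
    obtain ⟨H, hH, hGH⟩ := exists_isH hn (a := 3) (by omega) h7 hAB.card_left (C := {b})
      (Set.ncard_singleton b) (Set.disjoint_singleton_right.2 (hAB.notMem b hb))
      (fun u w hu hw huw => absurd (hoff u hu w huw) hw)
    exact ⟨H, .inl (.inl (.inl ⟨hn, hH⟩)), hGH⟩

/-! ### The graphs of the extremal classes for `k = 6` have no long cycles -/

theorem NoLongCycle.of_le {H : SimpleGraph V} {k : ℕ} (h : NoLongCycle H k) (hGH : G ≤ H) :
    NoLongCycle G k := fun v p hp => by
  have := h v (p.mapLe hGH) (hp.mapLe hGH)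
  simpa using this

/-- The only edge off the two-element set `A` is the one that joins the two vertices of `C`. So any
three consecutive vertices of a cycle meet `A`, and a cycle of length at least six would contain the
edge in `C` both before and after the second vertex of `A`. -/
theorem noLongCycle_of_mem_class1 [Finite V] {n : ℕ} (h : G ∈ class1 V n 6) :
    NoLongCycle G 6 := by
  obtain ⟨hn, A, B, C, ⟨hU, hAB, hAC, hBC⟩, hA, hB, hC, hadj⟩ := h
  by_contra hno
  obtain ⟨m, c', hm, hc'⟩ := exists_periodicCycle_of_not_noLongCycle hno
  obtain ⟨p, q, hpq, rfl⟩ := Set.ncard_eq_two.1 (show A.ncard = 2 from hA)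
  obtain ⟨r, s, hrs, rfl⟩ := Set.ncard_eq_two.1 (show C.ncard = 2 from hC)
  have hoff : ∀ u w, G.Adj u w → (u = p ∨ u = q) ∨ (w = p ∨ w = q) ∨ ((u = r ∨ u = s) ∧
      (w = r ∨ w = s)) := by
    intro u w huw
    have h1 := ((hadj u w).1 huw).2
    simp only [Set.mem_union, Set.mem_insert_iff, Set.mem_singleton_iff] at h1
    tauto
  have three : ∀ c, PeriodicCycle G m c → ∀ i, (c i = p ∨ c i = q) ∨
      (c (i + 1) = p ∨ c (i + 1) = q) ∨ (c (i + 2) = p ∨ c (i + 2) = q) := by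
    intro c hc i
    have h1 := hoff _ _ (hc.adj i)
    have h2 := hoff _ _ (hc.adj (i + 1))
    have h3 := hc.ne i (i + 1) (by omega) (by omega)
    have h4 := hc.ne i (i + 2) (by omega) (by omega)
    have h5 := hc.ne (i + 1) (i + 2) (by omega) (by omega)
    grind
  obtain ⟨c, hc, h0⟩ : ∃ c, PeriodicCycle G m c ∧ (c 0 = p ∨ c 0 = q) := by
    rcases three c' hc' 0 with hh | hh | hh
    · exact ⟨c', hc', hh⟩
    · exact ⟨_, hc'.shift 1, by simpa using hh⟩
    · exact ⟨_, hc'.shift 2, by simpa using hh⟩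
  have hne : ∀ i j, i < j → j < 6 → c i ≠ c j := fun i j hij hj => hc.ne i j hij (by omega)
  have e01 := hne 0 1 (by omega) (by omega)
  have e02 := hne 0 2 (by omega) (by omega)
  have e03 := hne 0 3 (by omega) (by omega)
  have e04 := hne 0 4 (by omega) (by omega)
  have e05 := hne 0 5 (by omega) (by omega)
  have e12 := hne 1 2 (by omega) (by omega)
  have e13 := hne 1 3 (by omega) (by omega)
  have e14 := hne 1 4 (by omega) (by omega)
  have e15 := hne 1 5 (by omega) (by omega)
  have e23 := hne 2 3 (by omega) (by omega)
  have e24 := hne 2 4 (by omega) (by omega)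
  have e25 := hne 2 5 (by omega) (by omega)
  have e34 := hne 3 4 (by omega) (by omega)
  have e35 := hne 3 5 (by omega) (by omega)
  have t1 := three c hc 1
  have t2 := three c hc 2
  have t3 := three c hc 3
  have a1 := hoff _ _ (hc.adj 1)
  have a4 := hoff _ _ (hc.adj 4)
  simp only [Nat.reduceAdd] at t1 t2 t3 a1 a4
  have h1 : ¬ (c 1 = p ∨ c 1 = q) := by grind
  have h2 : ¬ (c 2 = p ∨ c 2 = q) := by grind
  grind

/-- With `A = {a, a'}`, every edge of a cycle meets `{a, a', b}`. So a cycle of length at least six has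
length six and passes through these three vertices alternately; but no other vertex is adjacent to
both `a'` and `b`. -/
theorem noLongCycle_of_mem_class2 {n : ℕ} (h : G ∈ class2 V n 6) : NoLongCycle G 6 := by
  obtain ⟨hn, A, B, J, ⟨hU, hAB, hAJ, hBJ⟩, hA, a, ha, b, hb, hcl, hind, -, hJ⟩ := h
  by_contra hno
  obtain ⟨m, c', hm, hc'⟩ := exists_periodicCycle_of_not_noLongCycle hno
  obtain ⟨a', ha', haa, rfl⟩ : ∃ a', a' ∈ A ∧ a' ≠ a ∧ A = {a, a'} := by
    obtain ⟨p, q, hpq, rfl⟩ := Set.ncard_eq_two.1 (show A.ncard = 2 from hA)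
    rcases ha with rfl | rfl
    · exact ⟨q, by simp, hpq.symm, rfl⟩
    · exact ⟨p, by simp, hpq, Set.pair_comm _ _⟩
  have hJ' : ∀ c ∈ J, ∀ w, G.Adj c w ↔ w = a ∨ w = b := by
    intro c hc w
    rw [← SimpleGraph.mem_neighborSet, hJ c hc]
    rfl
  have hoff : ∀ u w, G.Adj u w → u ≠ a → u ≠ a' → u ≠ b → (w = a ∨ w = a') ∨
      (u ∈ J ∧ w = b) := by
    intro u w huw h1 h2 h3
    have hu : u ∈ ({a, a'} : Set V) ∪ B ∪ J := hU ▸ Set.mem_univ u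
    have hw : w ∈ ({a, a'} : Set V) ∪ B ∪ J := hU ▸ Set.mem_univ w
    simp only [Set.mem_union, Set.mem_insert_iff, Set.mem_singleton_iff] at hu hw
    have h4 := fun hu' hw' => hind hu' hw' huw.ne huw
    have h5 := fun hu' => (hJ' u hu' w).1 huw
    have h6 := fun hw' => (hJ' w hw' u).1 huw.symm
    tauto
  have hnot : ∀ u, u ≠ a → u ≠ a' → u ≠ b → G.Adj u a' → G.Adj u b → False := by
    intro u h1 h2 h3 h4 h5
    have hba : b ≠ a := fun e => Set.disjoint_left.1 hAB ha (e ▸ hb)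
    have hba' : b ≠ a' := fun e => Set.disjoint_left.1 hAB ha' (e ▸ hb)
    have := hoff u b h5 h1 h2 h3
    have h6 := fun hu' => (hJ' u hu' a').1 h4
    grind
  have two : ∀ c, PeriodicCycle G m c → ∀ i, (c i = a ∨ c i = a' ∨ c i = b) ∨
      (c (i + 1) = a ∨ c (i + 1) = a' ∨ c (i + 1) = b) := by
    intro c hc i
    have h1 := hoff _ _ (hc.adj i)
    grind
  obtain ⟨c, hc, h0⟩ : ∃ c, PeriodicCycle G m c ∧ (c 0 = a ∨ c 0 = a' ∨ c 0 = b) := by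
    rcases two c' hc' 0 with hh | hh
    · exact ⟨c', hc', hh⟩
    · exact ⟨_, hc'.shift 1, by simpa using hh⟩
  have hne : ∀ i j, i < j → j < i + 6 → c i ≠ c j := fun i j hij hj => hc.ne i j hij (by omega)
  have e01 := hne 0 1 (by omega) (by omega)
  have e02 := hne 0 2 (by omega) (by omega)
  have e03 := hne 0 3 (by omega) (by omega)
  have e04 := hne 0 4 (by omega) (by omega)
  have e05 := hne 0 5 (by omega) (by omega)
  have e12 := hne 1 2 (by omega) (by omega)
  have e13 := hne 1 3 (by omega) (by omega)
  have e14 := hne 1 4 (by omega) (by omega)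
  have e15 := hne 1 5 (by omega) (by omega)
  have e23 := hne 2 3 (by omega) (by omega)
  have e24 := hne 2 4 (by omega) (by omega)
  have e25 := hne 2 5 (by omega) (by omega)
  have e34 := hne 3 4 (by omega) (by omega)
  have e35 := hne 3 5 (by omega) (by omega)
  have e45 := hne 4 5 (by omega) (by omega)
  have e26 := hne 2 6 (by omega) (by omega)
  have e46 := hne 4 6 (by omega) (by omega)
  have t1 := two c hc 1
  have t2 := two c hc 2
  have t3 := two c hc 3
  have t4 := two c hc 4
  have t5 := two c hc 5
  have a0 := hc.adj 0
  have a1 := hc.adj 1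
  have a2 := hc.adj 2
  have a3 := hc.adj 3
  have a4 := hc.adj 4
  have a5 := hc.adj 5
  simp only [Nat.reduceAdd] at t1 t2 t3 t4 t5 a0 a1 a2 a3 a4 a5
  have h1 : ¬ (c 1 = a ∨ c 1 = a' ∨ c 1 = b) := by grind
  have h2 : c 2 = a ∨ c 2 = a' ∨ c 2 = b := by grind
  have h3 : ¬ (c 3 = a ∨ c 3 = a' ∨ c 3 = b) := by grind
  have h4 : c 4 = a ∨ c 4 = a' ∨ c 4 = b := by grind
  have h5 : ¬ (c 5 = a ∨ c 5 = a' ∨ c 5 = b) := by grind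
  have h6 : c 6 = c 0 := by grind
  push Not at h1 h3 h5
  rw [h6] at a5
  have n1 := hnot _ h1.1 h1.2.1 h1.2.2
  have n3 := hnot _ h3.1 h3.2.1 h3.2.2
  have n5 := hnot _ h5.1 h5.2.1 h5.2.2
  have := a0.symm
  have := a2.symm
  have := a4.symm
  grind

/-! ### Cycles across a separation -/

/-- A cycle that meets both sides of the separation `{x, y}` consists of `x`, `y` and two paths
between them, one on each side. -/
theorem PeriodicCycle.split {m : ℕ} {c : ℕ → V} (hc : PeriodicCycle G m c) {x y : V} {D : Set V}
    (hD : ClosedOff G D x y) {i j : ℕ} (hi : c i ∈ D)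
    (hj : c j ∉ D ∧ c j ≠ x ∧ c j ≠ y) :
    ∃ l l', Link G D x y l ∧ Link G {v | v ∉ D ∧ v ≠ x ∧ v ≠ y} x y l' ∧
      m = l.length + l'.length + 2 := by
  have h3 := hc.three_le
  -- the cycle leaves `D` at one of `x`, `y`
  obtain ⟨e, he, he'⟩ : ∃ e, c e ∈ D ∧ c (e + 1) ∉ D := by
    by_contra hcon
    push Not at hcon
    have h1 : ∀ t, c (i + t) ∈ D := fun t => by
      induction t with
      | zero => exact hi
      | succ t ih => exact hcon _ ih
    have h2 := h1 (j + i * (m - 1))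
    rw [show i + (j + i * (m - 1)) = j + i * m by
      obtain ⟨m, rfl⟩ : ∃ m', m = m' + 1 := ⟨m - 1, by omega⟩
      simp only [Nat.add_sub_cancel]; ring] at h2
    have h4 : ∀ t, c (j + t * m) = c j := fun t => by
      induction t with
      | zero => simp
      | succ t ih => rw [← ih, show j + (t + 1) * m = j + t * m + m by ring, hc.periodic]
    exact hj.1 (h4 i ▸ h2)
  wlog hx : c (e + 1) = x generalizing x y
  · have hy : c (e + 1) = y := ((hD.adj _ he _ (hc.adj e)).resolve_left he').resolve_left hx
    obtain ⟨l, l', hl, hl', hm⟩ := this hD.swap ⟨hj.1, hj.2.2, hj.2.1⟩ hy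
    refine ⟨l.reverse, l'.reverse, hl.reverse, hl'.reverse.mono fun v hv => ?_, by simpa using hm⟩
    exact ⟨hv.1, hv.2.2, hv.2.1⟩
  have hd : PeriodicCycle G m fun t => c (t + (e + 1)) := by
    simpa [add_comm] using hc.shift (e + 1)
  set d : ℕ → V := fun t => c (t + (e + 1)) with hddef
  have hd0 : d 0 = x := by simpa [hddef] using hx
  have hdm : d m = x := by rw [← hd0]; simpa using hd.periodic 0
  have hdD : d (m - 1) ∈ D := by
    have : c (m - 1 + (e + 1)) = c e := by
      rw [show m - 1 + (e + 1) = e + m by omega]; exact hc.periodic e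
    simpa [hddef, this] using he
  obtain ⟨r, hrm, hr⟩ : ∃ r < m, d r = c j := by
    refine ⟨(j + (e + 1) * (m - 1)) % m, Nat.mod_lt _ (by omega), ?_⟩
    have h1 : d ((j + (e + 1) * (m - 1)) % m) = d (j + (e + 1) * (m - 1)) :=
      hd.eq_of_mod_eq (by simp)
    rw [h1]
    have h2 : d (j + (e + 1) * (m - 1)) = c (j + (e + 1) * m) := by
      simp only [hddef]
      congr 1
      obtain ⟨m, rfl⟩ : ∃ m', m = m' + 1 := ⟨m - 1, by omega⟩
      simp only [Nat.add_sub_cancel]; ring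
    rw [h2]
    exact hc.eq_of_mod_eq (by simp)
  have hr0 : r ≠ 0 := by
    rintro rfl
    exact hj.2.1 (hr.symm.trans hd0)
  have hxarc : ∀ i n, 1 ≤ i → i + n ≤ m → x ∉ arc d i n := by
    intro i n hi hin
    rw [mem_arc]
    rintro ⟨t, ht, he⟩
    exact hd.ne 0 (i + t) (by omega) (by omega) (hd0.trans he.symm)
  have hlink := hd.link_arc (n := m - 1) (by omega) 0
  rw [show 0 + 1 + (m - 1) = m by omega, hdm, hd0] at hlink
  -- `y` is on the cycle as well
  obtain ⟨s, hsm, hs⟩ : ∃ s, s < m - 1 ∧ d (1 + s) = y := by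
    by_contra hcon
    push Not at hcon
    have hy : y ∉ arc d (0 + 1) (m - 1) := by
      rw [mem_arc]
      rintro ⟨t, ht, he⟩
      exact hcon t ht (by simpa using he)
    have h1 := hD.link_of_mem hlink (hxarc _ _ (by omega) (by omega)) hy (a := d (m - 1))
      (mem_arc.2 ⟨m - 2, by omega, by congr 1; omega⟩) hdD
    exact hj.1 (hr ▸ h1.mem (d r) (mem_arc.2 ⟨r - 1, by omega, by congr 1; omega⟩))
  have hsm2 : s ≠ m - 2 := by
    rintro rfl
    rw [show 1 + (m - 2) = m - 1 by omega] at hs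
    exact hD.right (hs ▸ hdD)
  have hyarc : ∀ i n, (1 + s < i ∨ i + n ≤ 1 + s) → i + n ≤ m → y ∉ arc d i n := by
    intro i n hi hin
    rw [mem_arc]
    rintro ⟨t, ht, he⟩
    rcases hi with hi | hi
    · exact hd.ne (1 + s) (i + t) (by omega) (by omega) (hs.trans he.symm)
    · exact hd.ne (i + t) (1 + s) (by omega) (by omega) (he.trans hs.symm)
  have h1 := hd.link_arc (n := s) (by omega) 0
  rw [show 0 + 1 + s = 1 + s by omega, hs, hd0] at h1
  have h2 := hd.link_arc (n := m - 2 - s) (by omega) (1 + s)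
  rw [show 1 + s + 1 + (m - 2 - s) = m by omega, hs, hdm] at h2
  have h2' := hD.link_of_mem h2 (hxarc _ _ (by omega) (by omega))
    (hyarc _ _ (.inl (by omega)) (by omega)) (a := d (m - 1))
    (mem_arc.2 ⟨m - 3 - s, by omega, by congr 1; omega⟩) hdD
  have hrs : r ≤ s := by
    by_contra hrs
    by_cases hrs' : r = 1 + s
    · exact hj.2.2 (by rw [← hr, hrs', hs])
    · exact hj.1 (hr ▸ h2'.mem (d r) (mem_arc.2 ⟨r - 2 - s, by omega, by congr 1; omega⟩))
  have h1' := hD.compl.link_of_mem h1 (hxarc _ _ (by omega) (by omega))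
    (hyarc _ _ (.inr (by omega)) (by omega)) (a := d r)
    (mem_arc.2 ⟨r - 1, by omega, by congr 1; omega⟩) (hr ▸ hj)
  refine ⟨_, _, h2'.reverse, h1', ?_⟩
  rw [List.length_reverse, length_arc, length_arc]
  omega

/-! ### A component with a path of length four -/

/-- `D` is a component of `G - {x, y}` that carries no path from `x` to `y` longer than four, while
the other components, of which at least one is not a single vertex, carry no path longer than
three. -/
structure BigComponent (G : SimpleGraph V) (x y : V) (D : Set V) : Prop where
  saturated : Saturated G 8
  two : TwoConnected G
  ne : x ≠ y
  comp : IsComponent G {x, y}ᶜ D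
  long : ∀ l, Link G D x y l → l.length ≤ 3
  short : ∀ S, IsComponent G {x, y}ᶜ S → S ≠ D → ∀ l, Link G S x y l → l.length ≤ 2
  other : ∃ E, IsComponent G {x, y}ᶜ E ∧ E ≠ D ∧ E.Nontrivial

theorem exists_list_of_walk {a b : V} (p : G.Walk a b) (hp : p.length ≠ 0) :
    ∃ l, p.support = a :: (l ++ [b]) ∧ p.length = l.length + 1 := by
  induction p with
  | nil => simp at hp
  | @cons a c b hac p ih =>
    by_cases h0 : p.length = 0
    · cases p with
      | nil => exact ⟨[], by simp⟩
      | cons _ _ => simp at h0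
    · obtain ⟨l, h1, h2⟩ := ih h0
      exact ⟨c :: l, by simp [h1], by simp [h2]⟩

theorem exists_link_of_isPath {S : Set V} {a b : V} {p : G.Walk a b} (hp : p.IsPath) (hab : a ≠ b)
    (hS : ∀ v ∈ p.support, v ∈ S ∪ {a, b}) : ∃ l, Link G S a b l ∧ p.length = l.length + 1 := by
  obtain ⟨l, h1, h2⟩ := exists_list_of_walk p (fun h0 => hab (SimpleGraph.Walk.eq_of_length_eq_zero h0))
  have hn := hp.support_nodup
  have hch := p.isChain_adj_support
  rw [h1] at hn hch hS
  refine ⟨l, ⟨?_, fun z hz => ?_, hch⟩, h2⟩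
  · simp only [List.nodup_cons, List.nodup_append] at hn
    exact hn.2.1
  · have h3 := hS z (by simp [hz])
    simp only [List.nodup_cons, List.nodup_append, List.mem_append, List.mem_cons] at hn
    simp only [Set.mem_union, Set.mem_insert_iff, Set.mem_singleton_iff] at h3
    rcases h3 with h3 | rfl | rfl
    · exact h3
    · tauto
    · exact absurd rfl (hn.2.2.2 z hz z (by simp))

theorem IsJ3Bridge.nontrivial {A S : Set V} {a a' : V} (h : IsJ3Bridge G A S a a') :
    S.Nontrivial := by
  obtain ⟨p, hp, hpS, hp3⟩ := h.exists_path
  obtain ⟨l, hl, hlen⟩ := exists_link_of_isPath hp h.ne hpS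
  obtain ⟨s, s', rfl⟩ := List.length_eq_two.1 (show l.length = 2 by omega)
  exact ⟨s, hl.mem s (by simp), s', hl.mem s' (by simp), by simpa using hl.nodup⟩

/-- A component of `G - {a, a'}`, together with the edge `aa'`, is 2-connected. -/
theorem IsComponent.twoConnected_induce [Finite V] {S : Set V} {a a' : V}
    (hS : IsComponent G {a, a'}ᶜ S) (h2 : TwoConnected G) (haa : G.Adj a a') :
    TwoConnected (G.induce (S ∪ {a, a'})) := by
  have hcl := hS.closedOff
  have key : ∀ (T : Set V) (p q v : V), T ⊆ S ∪ {a, a'} → v ∉ T → p ∈ T → q ∈ S ∪ {a, a'} →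
      q ∉ T → q ≠ v → ∃ u w, u ∈ T ∧ w ∈ S ∪ {a, a'} ∧ w ∉ T ∧ w ≠ v ∧ G.Adj u w := by
    intro T p q v hT hv hp hq hqT hqv
    have cross : ∀ (T : Set V) (p q : V), T ⊆ S → v ∉ T → p ∈ T → q ∉ T → q ≠ v →
        ∃ u w, u ∈ T ∧ w ∈ S ∪ {a, a'} ∧ w ∉ T ∧ w ≠ v ∧ G.Adj u w := by
      intro T p q hT hv hp hq hqv
      obtain ⟨u, w, -, hw, hu, hwT, huw⟩ := exists_crossing (S := T) (h2.2.2 v).preconnected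
        (a := p) (b := q) (fun e => hv (e ▸ hp)) hqv hp hq
      exact ⟨u, w, hu, hcl.adj u (hT hu) w huw, hwT, hw, huw⟩
    by_cases h1 : a ∈ T
    · by_cases h1' : a' ∈ T ∨ a' = v
      · obtain ⟨u, w, hu, hw, hwT, hwv, huw⟩ := cross {w | w ∈ S ∪ {a, a'} ∧ w ∉ T ∧ w ≠ v} q p
          (by
            rintro w ⟨hw | rfl | rfl, hwT, hwv⟩
            exacts [hw, absurd h1 hwT, absurd h1' (by tauto)]) (by simp) ⟨hq, hqT, hqv⟩
          (fun hh => hh.2.1 hp) (fun e => hv (e ▸ hp))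
        refine ⟨w, u, ?_, hu.1, hu.2.1, hu.2.2, huw.symm⟩
        by_contra hwT'
        exact hwT ⟨hw, hwT', hwv⟩
      · push Not at h1'
        exact ⟨a, a', h1, by simp, h1'.1, h1'.2, haa⟩
    · by_cases h1' : a' ∈ T
      · by_cases hav : a = v
        · obtain ⟨u, w, hu, hw, hwT, hwv, huw⟩ := cross {w | w ∈ S ∪ {a, a'} ∧ w ∉ T ∧ w ≠ v} q p
            (by
              rintro w ⟨hw | rfl | rfl, hwT, hwv⟩
              exacts [hw, absurd hav hwv, absurd h1' hwT]) (by simp) ⟨hq, hqT, hqv⟩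
            (fun hh => hh.2.1 hp) (fun e => hv (e ▸ hp))
          refine ⟨w, u, ?_, hu.1, hu.2.1, hu.2.2, huw.symm⟩
          by_contra hwT'
          exact hwT ⟨hw, hwT', hwv⟩
        · exact ⟨a', a, h1', by simp, h1, hav, haa.symm⟩
      · refine cross T p q (fun t ht => ?_) hv hp hqT hqv
        rcases hT ht with hh | rfl | rfl
        exacts [hh, absurd ht h1, absurd ht h1']
  obtain ⟨s, hs⟩ := hS.nonempty
  refine LongCycles.twoConnected_induce ?_ ?_ fun v _ T p q hT hv hp hq hqT hqv =>
    key T p q v hT hv hp hq hqT hqv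
  · rw [← Set.ncard_eq_three.2 ⟨s, a, a', fun e => hcl.left (e ▸ hs), fun e => hcl.right (e ▸ hs),
      haa.ne, rfl⟩]
    refine Set.ncard_le_ncard ?_
    rintro v (rfl | hv)
    exacts [.inl hs, .inr hv]
  · refine induce_connected_of_crossing ⟨s, .inl hs⟩ fun T p q hT hp hq hqT => ?_
    -- delete a vertex of `S ∪ {a, a'}` other than `p` and `q`, or use that only these two exist
    by_cases hex : ∃ v ∈ S ∪ {a, a'}, v ∉ T ∧ v ≠ q
    · obtain ⟨v, -, hvT, hvq⟩ := hex
      obtain ⟨u, w, h1, h2, h3, -, h4⟩ := key T p q v hT hvT hp hq hqT hvq.symm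
      exact ⟨u, w, h1, h2, h3, h4⟩
    · push Not at hex
      -- `q` is the only vertex outside `T`
      obtain ⟨w, hw, hqw⟩ : ∃ w ∈ S ∪ {a, a'}, G.Adj q w := by
        rcases hq with hq | rfl | rfl
        · obtain ⟨u, w, hu, hw, huw⟩ := exists_crossing_of_connected (S := {q}) h2.2.1 rfl
            (b := a) (fun e => hcl.left (Set.mem_singleton_iff.1 e ▸ hq))
          rw [Set.mem_singleton_iff] at hu
          subst hu
          exact ⟨w, hcl.adj _ hq w huw, huw⟩
        · exact ⟨a', by simp, haa⟩
        · exact ⟨a, by simp, haa.symm⟩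
      refine ⟨w, q, ?_, hq, hqT, hqw.symm⟩
      by_contra hwT
      exact hqw.ne (hex w hw hwT).symm

/-- A component of `G - {a, a'}` without paths from `a` to `a'` longer than three is a single vertex with
two neighbors in `A` or a `J₃`-bridge of `A`, for every set `A` that contains `a` and `a'` and is
disjoint from the component. -/
theorem IsComponent.single_or_bridge [Finite V] {A S : Set V} {a a' : V}
    (hS : IsComponent G {a, a'}ᶜ S) (h2 : TwoConnected G) (haa : G.Adj a a') (haA : a ∈ A)
    (haA' : a' ∈ A) (hSA : Disjoint S A) (hout : ∃ t, t ∉ S ∧ t ≠ a ∧ t ≠ a')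
    (hl : ∀ l, Link G S a a' l → l.length ≤ 2) :
    (∃ c, S = {c} ∧ (G.neighborSet c ∩ A).ncard = 2) ∨ ∃ a a', IsJ3Bridge G A S a a' := by
  have hcl := hS.closedOff
  have hSA' : ∀ v, v ∈ S → v ∉ A := fun v hv => Set.disjoint_left.1 hSA hv
  by_cases hn : S.Nontrivial
  · refine .inr ⟨a, a', hSA, haA, haA', haa.ne, fun s hs b hb hsb => ?_, fun hpre => ?_, ?_, hS.2.1,
      ?_, fun p hp hpS => ?_⟩
    · exact (hcl.adj s hs b hsb).resolve_left fun hh => hSA' b hh hb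
    · obtain ⟨s, hs⟩ := hS.nonempty
      obtain ⟨t, htS, hta, hta'⟩ := hout
      obtain ⟨u, w, hu, hw, huS, hwS, huw⟩ := exists_crossing (S := S) hpre (hS.1 hs)
        (b := t) (by simp [hta, hta']) hs htS
      exact hwS (hS.2.2 u huS w hw huw)
    · rw [show G ⊔ SimpleGraph.edge a a' = G from sup_eq_left.2 (by
        intro u w huw
        rw [SimpleGraph.edge_adj] at huw
        rcases huw.1 with ⟨rfl, rfl⟩ | ⟨rfl, rfl⟩
        exacts [haa, haa.symm])]
      exact hS.twoConnected_induce h2 haa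
    · obtain ⟨l, hl', -, hl2⟩ := hS.exists_link h2 haa.ne
      obtain ⟨p, hp, hlen⟩ := exists_walk_of_chain hl'.chain
      have hmem := hl'.mem
      refine ⟨p, (SimpleGraph.Walk.isPath_def p).2 ?_, fun v hv => ?_, ?_⟩
      · rw [hp]
        have h1 : a ∉ l := fun hh => hcl.left (hmem a hh)
        have h3 : a' ∉ l := fun hh => hcl.right (hmem a' hh)
        have := hl'.nodup
        simp only [List.nodup_cons, List.nodup_append, List.mem_append, List.mem_singleton]
        have := haa.ne
        grind
      · rw [hp] at hv
        simp only [List.mem_cons, List.mem_append, List.not_mem_nil, or_false] at hv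
        simp only [Set.mem_union, Set.mem_insert_iff, Set.mem_singleton_iff]
        have := hmem v
        tauto
      · have := hl l hl'
        have := hl2 hn
        omega
    · obtain ⟨l, hl', hlen⟩ := exists_link_of_isPath hp haa.ne hpS
      have := hl l hl'
      omega
  · obtain ⟨c, hc⟩ := hS.nonempty
    have hsub := Set.not_nontrivial_iff.1 hn
    refine .inl ⟨c, hsub.eq_singleton_of_mem hc, ?_⟩
    rw [show G.neighborSet c ∩ A = {a, a'} from ?_, Set.ncard_pair haa.ne]
    ext w
    have := hS.adj_iff_of_subsingleton h2 haa.ne hn hc w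
    simp only [Set.mem_inter_iff, SimpleGraph.mem_neighborSet, Set.mem_insert_iff,
      Set.mem_singleton_iff, this]
    constructor
    · exact And.left
    · rintro (rfl | rfl)
      exacts [⟨.inl rfl, haA⟩, ⟨.inr rfl, haA'⟩]

/-! ### The extremal classes from the shape of the large component -/

namespace BigComponent

variable {x y : V} {D : Set V}

theorem swap (h : BigComponent G x y D) : BigComponent G y x D where
  saturated := h.saturated
  two := h.two
  ne := h.ne.symm
  comp := Set.pair_comm x y ▸ h.comp
  long l hl := by simpa using h.long _ hl.reverse
  short S hS hSD l hl := by
    simpa using h.short S (Set.pair_comm y x ▸ hS) hSD _ hl.reverse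
  other := by
    obtain ⟨E, hE, hh⟩ := h.other
    exact ⟨E, Set.pair_comm x y ▸ hE, hh⟩

theorem exists_outside (h : BigComponent G x y D) : ∃ t, t ∉ D ∧ t ≠ x ∧ t ≠ y := by
  obtain ⟨E, hE, hED, -⟩ := h.other
  obtain ⟨t, ht⟩ := hE.nonempty
  exact ⟨t, fun hh => hED (hE.eq_of_mem h.comp ht hh), fun e => hE.closedOff.left (e ▸ ht),
    fun e => hE.closedOff.right (e ▸ ht)⟩

theorem cutsAdjacent (h : BigComponent G x y D) : CutsAdjacent G :=
  h.saturated.cutsAdjacent h.two (by omega)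

theorem adj (h : BigComponent G x y D) : G.Adj x y :=
  h.cutsAdjacent x y D h.ne h.comp.closedOff h.comp.nonempty h.exists_outside

/-- If the large component has only three vertices, these form a clique together with `x` and `y`,
because additional edges between these five vertices create no long cycle. -/
theorem isClique (h : BigComponent G x y D) [Finite V] (hD : D.ncard ≤ 3) :
    G.IsClique (D ∪ {x, y}) := by
  have hcl := h.comp.closedOff
  let H : SimpleGraph V := SimpleGraph.fromRel fun u v =>
    G.Adj u v ∨ (u ∈ D ∪ {x, y} ∧ v ∈ D ∪ {x, y})
  have hH : ∀ u v, H.Adj u v ↔ u ≠ v ∧ (G.Adj u v ∨ (u ∈ D ∪ {x, y} ∧ v ∈ D ∪ {x, y})) := by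
    intro u v
    have := G.adj_comm u v
    rw [SimpleGraph.fromRel_adj]
    tauto
  have hGH : ∀ u v, u ∉ D ∪ {x, y} → (H.Adj u v ↔ G.Adj u v) := by
    intro u v hu
    have := fun huv : G.Adj u v => huv.ne
    rw [hH]
    tauto
  have hclH : ClosedOff H D x y := by
    refine ⟨hcl.left, hcl.right, fun u hu v huv => ?_⟩
    rcases ((hH u v).1 huv).2 with hh | ⟨-, hh⟩
    · exact hcl.adj u hu v hh
    · exact hh
  have hno : NoLongCycle H 8 := by
    by_contra hno
    obtain ⟨m, c, hm, hc⟩ := exists_periodicCycle_of_not_noLongCycle hno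
    by_cases h1 : ∃ i, c i ∈ D
    · by_cases h2 : ∃ j, c j ∉ D ∧ c j ≠ x ∧ c j ≠ y
      · obtain ⟨i, hi⟩ := h1
        obtain ⟨j, hj⟩ := h2
        obtain ⟨l, l', hl, hl', hmm⟩ := hc.split hclH hi hj
        have e1 : l.length ≤ 3 := by
          classical
          rw [← List.toFinset_card_of_nodup hl.nodup, ← Set.ncard_coe_finset]
          refine (Set.ncard_le_ncard (fun v hv => ?_)).trans hD
          exact hl.mem v (by simpa using hv)
        obtain ⟨p, l'', rfl⟩ : ∃ p l'', l' = p :: l'' :=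
          List.exists_cons_of_ne_nil (by rintro rfl; simp at hmm; omega)
        have hp := hl'.mem p (by simp)
        obtain ⟨S, hpS, hS⟩ := exists_isComponent (G := G) (W := {x, y}ᶜ) (w := p)
          (by simp [hp.2.1, hp.2.2])
        have hSD : S ≠ D := fun e => hp.1 (e ▸ hpS)
        have hSW : ∀ u ∈ S, u ∉ D ∪ {x, y} := by
          rintro u hu (hh | rfl | rfl)
          exacts [hSD (hS.eq_of_mem h.comp hu hh), hS.closedOff.left hu, hS.closedOff.right hu]
        have hSH : ClosedOff H S x y := ⟨hS.closedOff.left, hS.closedOff.right, fun u hu v huv =>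
          hS.closedOff.adj u hu v ((hGH u v (hSW u hu)).1 huv)⟩
        have hl'S := hSH.link_of_mem hl' (fun hh => (hl'.mem x hh).2.1 rfl)
          (fun hh => (hl'.mem y hh).2.2 rfl) (a := p) (by simp) hpS
        have hl'G : Link G S x y (p :: l'') := by
          refine ⟨hl'S.nodup, hl'S.mem, ?_⟩
          have hch := hl'S.chain
          rw [List.isChain_iff_getElem] at hch ⊢
          intro i hi
          have hadj := hch i hi
          by_cases hS' : (x :: (p :: l'' ++ [y]))[i] ∈ S
          · exact (hGH _ _ (hSW _ hS')).1 hadj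
          · by_cases hS'' : (x :: (p :: l'' ++ [y]))[i + 1] ∈ S
            · exact ((hGH _ _ (hSW _ hS'')).1 hadj.symm).symm
            · exfalso
              cases i with
              | zero => exact hS'' (by simpa using hpS)
              | succ i =>
                refine hS' ?_
                have hi' : i < (p :: l'').length := by simp at hi ⊢; omega
                have : (x :: (p :: l'' ++ [y]))[i + 1] = (p :: l'')[i] := by
                  rw [List.getElem_cons_succ, List.getElem_append_left hi']
                rw [this]
                exact hl'S.mem _ (List.getElem_mem _)
        have := h.short S hS hSD _ hl'G
        omega
      · push Not at h2
        have h5 : (D ∪ {x, y}).ncard ≤ 5 := by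
          have e1 := Set.ncard_union_le D {x, y}
          rw [Set.ncard_pair h.ne] at e1
          omega
        have h6 : (c '' Set.Iio 8).ncard = 8 := by
          rw [Set.InjOn.ncard_image]
          · simp
          · intro i hi j hj hij
            simp only [Set.mem_Iio] at hi hj
            rcases lt_trichotomy i j with hlt | rfl | hlt
            · exact absurd hij (hc.ne i j hlt (by omega))
            · rfl
            · exact absurd hij.symm (hc.ne j i hlt (by omega))
        have h7 : (c '' Set.Iio 8).ncard ≤ (D ∪ {x, y}).ncard := by
          refine Set.ncard_le_ncard ?_
          rintro _ ⟨i, -, rfl⟩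
          have := h2 i
          simp only [Set.mem_union, Set.mem_insert_iff, Set.mem_singleton_iff]
          tauto
        omega
    · push Not at h1
      have hcG : PeriodicCycle G m c := ⟨hc.three_le, hc.periodic, hc.ne, fun i => by
        obtain ⟨hne, hh | ⟨hh, hh'⟩⟩ := (hH _ _).1 (hc.adj i)
        · exact hh
        · have e1 := hh.resolve_left (h1 i)
          have e2 := hh'.resolve_left (h1 (i + 1))
          simp only [Set.mem_insert_iff, Set.mem_singleton_iff] at e1 e2
          have := h.adj
          have := h.adj.symm
          rcases e1 with e1 | e1 <;> rcases e2 with e2 | e2 <;> rw [e1, e2] at hne ⊢ <;>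
            first
              | exact absurd rfl hne
              | assumption⟩
      exact absurd (hcG.length_lt h.saturated.1) (by omega)
  intro u hu v hv huv
  by_contra hn
  refine h.saturated.2 u v huv hn (hno.of_le ?_)
  intro a b hab
  rw [hH]
  refine ⟨hab.ne, ?_⟩
  rw [SimpleGraph.sup_adj, SimpleGraph.edge_adj] at hab
  rcases hab with hh | ⟨⟨rfl, rfl⟩ | ⟨rfl, rfl⟩, -⟩
  exacts [.inl hh, .inr ⟨hu, hv⟩, .inr ⟨hv, hu⟩]

/-- The components of `G - A` that are not inside `D` are the components of `G - {x, y}` other than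
`D`. -/
theorem isComponent_outside (h : BigComponent G x y D) {A S : Set V} (hx : x ∈ A) (hy : y ∈ A)
    (hA : A ⊆ D ∪ {x, y}) (hS : IsComponent G Aᶜ S) {s : V} (hs : s ∈ S) (hsD : s ∉ D) :
    IsComponent G {x, y}ᶜ S ∧ S ≠ D := by
  have hcl := h.comp.closedOff
  have hsub : S ⊆ (D ∪ {x, y})ᶜ := by
    refine hS.subset_of_mem (a := s) (fun u hu v hv huv hvD => hu ?_) hs ?_
    · rcases hvD with hvD | rfl | rfl
      · exact hcl.adj v hvD u huv.symm
      · exact absurd hx hv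
      · exact absurd hy hv
    · rintro (hh | rfl | rfl)
      exacts [hsD hh, hS.1 hs hx, hS.1 hs hy]
  refine ⟨⟨fun u hu hxy => hsub hu (.inr hxy), hS.2.1, fun u hu v hv huv => ?_⟩, ?_⟩
  · refine hS.2.2 u hu v (fun hvA => ?_) huv
    refine hsub hu ?_
    exact hcl.adj v ((hA hvA).resolve_right hv) u huv.symm
  · rintro rfl
    exact hsD hs

/-- Only the components of `G - A` inside `D` have to be checked, the others being short. -/
theorem hasSpecialSet (h : BigComponent G x y D) [Finite V] {n : ℕ} (hn : Nat.card V = n)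
    {A : Set V} (hx : x ∈ A) (hy : y ∈ A) (hA : A ⊆ D ∪ {x, y}) (hclique : G.IsClique A)
    (hin : ∀ S, IsComponent G Aᶜ S → S ⊆ D →
      (∃ c, S = {c} ∧ (G.neighborSet c ∩ A).ncard = 2) ∨ ∃ a a', IsJ3Bridge G A S a a') :
    HasSpecialSet n G A := by
  refine ⟨hn, h.two, h.saturated.1, hclique, fun S hS => ?_⟩
  by_cases hSD : S ⊆ D
  · exact hin S hS hSD
  · obtain ⟨s, hs, hsD⟩ := Set.not_subset.1 hSD
    obtain ⟨hS', hne⟩ := h.isComponent_outside hx hy hA hS hs hsD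
    obtain ⟨d, hd⟩ := h.comp.nonempty
    refine hS'.single_or_bridge h.two h.adj hx hy (Set.disjoint_left.2 fun v hv => hS.1 hv)
      ⟨d, fun hh => hne (hS'.eq_of_mem h.comp hh hd), fun e => h.comp.closedOff.left (e ▸ hd),
        fun e => h.comp.closedOff.right (e ▸ hd)⟩ (h.short S hS' hne)

theorem neighbors_outside (h : BigComponent G x y D) {S : Set V} (hS : IsComponent G {x, y}ᶜ S) :
    {v | v ∉ S ∧ ∃ s ∈ S, G.Adj s v} = {x, y} := by
  ext v
  simp only [Set.mem_ofPred_eq, Set.mem_insert_iff, Set.mem_singleton_iff]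
  constructor
  · rintro ⟨hv, s, hs, hsv⟩
    exact (hS.closedOff.adj s hs v hsv).resolve_left hv
  · obtain ⟨h1, h2⟩ := hS.touches h.two h.ne
    rintro (rfl | rfl)
    exacts [⟨hS.closedOff.left, h1⟩, ⟨hS.closedOff.right, h2⟩]

/-- The case that `D` has no vertices besides `u`, `v`, `w`; the special set is `D ∪ {x, y}`. -/
theorem mem_class8 (h : BigComponent G x y D) [Finite V] {n : ℕ} (hn : Nat.card V = n) {u v w : V}
    (hnd : [u, v, w].Nodup) (hD : D = {u, v, w}) : G ∈ class8 V n := by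
  have hcl := h.comp.closedOff
  have hu : u ∈ D := by simp [hD]
  have hv : v ∈ D := by simp [hD]
  have hw : w ∈ D := by simp [hD]
  have hA : ({x, y, u, v, w} : Set V) = D ∪ {x, y} := by
    rw [hD]
    ext a
    simp only [Set.mem_insert_iff, Set.mem_singleton_iff, Set.mem_union]
    tauto
  have hx : x ∈ ({x, y, u, v, w} : Set V) := by simp
  have hy : y ∈ ({x, y, u, v, w} : Set V) := by simp
  have hin : ∀ S, IsComponent G ({x, y, u, v, w} : Set V)ᶜ S → ∃ s ∈ S, s ∉ D := by
    intro S hS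
    obtain ⟨s, hs⟩ := hS.nonempty
    refine ⟨s, hs, fun hsD => hS.1 hs ?_⟩
    rw [hA]
    exact .inl hsD
  have hcard : D.ncard ≤ 3 := by
    rw [hD]
    have e1 := Set.ncard_insert_le u {v, w}
    have e2 := Set.ncard_insert_le v {w}
    rw [Set.ncard_singleton] at e2
    omega
  refine ⟨x, y, u, v, w, ?_, h.hasSpecialSet hn hx hy hA.subset (hA ▸ h.isClique hcard)
    fun S hS hSD => ?_, fun S hS => ?_⟩
  · have := hcl.left
    have := hcl.right
    have := h.ne
    simp only [List.nodup_cons, List.mem_cons, List.not_mem_nil, not_or, List.nodup_nil] at hnd ⊢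
    grind
  · obtain ⟨s, hs, hsD⟩ := hin S hS
    exact absurd (hSD hs) hsD
  · obtain ⟨s, hs, hsD⟩ := hin S hS
    exact h.neighbors_outside (h.isComponent_outside hx hy hA.subset hS hs hsD).1

/-- The case that `y` has only one neighbor `z` in `D`: then `{x, z}` is a cut as well, and the
special set is `{x, y, z}`. Every component of `G - {x, y, z}` is a component of `G - {x, y}` or of
`G - {x, z}`, so `x` has a neighbor in it. -/
theorem mem_class5 (h : BigComponent G x y D) [Finite V] {n : ℕ} (hn : Nat.card V = n) {z : V}
    (hz : z ∈ D) (hnt : D.Nontrivial) (hu : ∀ t ∈ D, G.Adj t y → t = z) : G ∈ class5 V n := by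
  have hcl := h.comp.closedOff
  obtain ⟨⟨p, hp, hpx⟩, q, hq, hqy⟩ := h.comp.touches h.two h.ne
  have hzy : G.Adj z y := hu q hq hqy ▸ hqy
  have hxz : x ≠ z := fun e => hcl.left (e ▸ hz)
  have hyz : y ≠ z := fun e => hcl.right (e ▸ hz)
  have hclz : ClosedOff G (D \ {z}) x z := by
    refine ⟨fun hh => hcl.left hh.1, by simp, fun u hu' v huv => ?_⟩
    have h1 := hcl.adj u hu'.1 v huv
    have h2 : v ≠ y := by
      rintro rfl
      exact hu'.2 (hu u hu'.1 huv)
    simp only [Set.mem_sdiff, Set.mem_singleton_iff]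
    tauto
  have hxz' : G.Adj x z := by
    obtain ⟨d, hd, hdz⟩ := hnt.exists_ne z
    exact h.cutsAdjacent x z _ hxz hclz ⟨d, hd, hdz⟩ ⟨y, fun hh => hcl.right hh.1, h.ne.symm, hyz⟩
  have hx : x ∈ ({x, y, z} : Set V) := by simp
  have hy : y ∈ ({x, y, z} : Set V) := by simp
  have hA : ({x, y, z} : Set V) ⊆ D ∪ {x, y} := by
    rintro v (rfl | rfl | rfl) <;> simp [hz]
  have hin : ∀ S, IsComponent G ({x, y, z} : Set V)ᶜ S → S ⊆ D → IsComponent G {x, z}ᶜ S := by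
    intro S hS hSD
    refine ⟨fun v hv => ?_, hS.2.1, fun u hu' v hv huv => ?_⟩
    · have := hS.1 hv
      simp only [Set.mem_compl_iff, Set.mem_insert_iff, Set.mem_singleton_iff] at this ⊢
      tauto
    · refine hS.2.2 u hu' v ?_ huv
      have h2 : v ≠ y := by
        rintro rfl
        have := hS.1 hu'
        simp [hu u (hSD hu') huv] at this
      simp only [Set.mem_compl_iff, Set.mem_insert_iff, Set.mem_singleton_iff] at hv ⊢
      tauto
  refine ⟨x, y, z, by simp [h.ne, hxz, hyz], h.hasSpecialSet hn hx hy hA ?_ fun S hS hSD => ?_,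
    fun S hS => ?_⟩
  · have := h.adj
    rintro a (rfl | rfl | rfl) b (rfl | rfl | rfl) hab <;>
      first
        | exact absurd rfl hab
        | assumption
        | exact SimpleGraph.Adj.symm (by assumption)
  · have hS' := hin S hS hSD
    refine hS'.single_or_bridge h.two hxz' hx (by simp) (Set.disjoint_left.2 fun v hv => hS.1 hv)
      ⟨y, fun hh => hcl.right (hSD hh), h.ne.symm, hyz⟩ fun l hl => ?_
    have hzl : z ∉ l := fun hh => hS'.closedOff.right (hl.mem z hh)
    have h1 := h.long _ ((hl.concat hzl hzy).mono (by
      rintro v (rfl | hv)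
      exacts [hz, hSD hv]))
    simp at h1
    omega
  · have key : ∀ z', IsComponent G {x, z'}ᶜ S → x ≠ z' → ∃ s ∈ S, G.Adj x s := by
      intro z' hS' hne
      obtain ⟨⟨s, hs, hsx⟩, -⟩ := hS'.touches h.two hne
      exact ⟨s, hs, hsx.symm⟩
    by_cases hSD : S ⊆ D
    · exact key z (hin S hS hSD) hxz
    · obtain ⟨s, hs, hsD⟩ := Set.not_subset.1 hSD
      exact key y (h.isComponent_outside hx hy hA hS hs hsD).1 h.ne

/-- The case that `D` has two adjacent vertices `p`, `q`, joined to `x` and `y`, and otherwise only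
vertices with exactly two neighbors, both in `{x, y, p, q}`, which is the special set. -/
theorem special_four (h : BigComponent G x y D) [Finite V] {n : ℕ} (hn : Nat.card V = n) {p q : V}
    (hp : p ∈ D) (hq : q ∈ D) (hpq : G.Adj p q) (hxp : G.Adj x p) (hxq : G.Adj x q)
    (hyp : G.Adj y p) (hyq : G.Adj y q)
    (hin : ∀ t ∈ D, t ≠ p → t ≠ q → ∃ a a', a ≠ a' ∧ a ∈ ({x, y, p, q} : Set V) ∧
      a' ∈ ({x, y, p, q} : Set V) ∧ ∀ w, G.Adj t w ↔ w = a ∨ w = a') :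
    [x, y, p, q].Nodup ∧ HasSpecialSet n G {x, y, p, q} ∧ BridgesAt G {x, y, p, q} x y := by
  have hcl := h.comp.closedOff
  have hx : x ∈ ({x, y, p, q} : Set V) := by simp
  have hy : y ∈ ({x, y, p, q} : Set V) := by simp
  have hA : ({x, y, p, q} : Set V) ⊆ D ∪ {x, y} := by
    rintro v (rfl | rfl | rfl | rfl) <;> simp [hp, hq]
  have single : ∀ S, IsComponent G ({x, y, p, q} : Set V)ᶜ S → S ⊆ D → ∃ c, S = {c} ∧
      (G.neighborSet c ∩ {x, y, p, q}).ncard = 2 := by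
    intro S hS hSD
    obtain ⟨c, hc⟩ := hS.nonempty
    have hcA := hS.1 hc
    simp only [Set.mem_compl_iff, Set.mem_insert_iff, Set.mem_singleton_iff, not_or] at hcA
    obtain ⟨a, a', haa, ha, ha', hall⟩ := hin c (hSD hc) hcA.2.2.1 hcA.2.2.2
    have hnb : ∀ w, G.Adj c w → w ∈ ({x, y, p, q} : Set V) := by
      intro w hw
      rcases (hall w).1 hw with rfl | rfl <;> assumption
    refine ⟨c, ?_, ?_⟩
    · refine (hS.subset_of_mem (T := {c}) (fun u hu v hv huv => ?_) hc rfl).antisymm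
        (Set.singleton_subset_iff.2 hc)
      rw [Set.mem_singleton_iff] at hu
      subst hu
      exact absurd (hnb v huv) hv
    · rw [show G.neighborSet c ∩ {x, y, p, q} = {a, a'} from ?_, Set.ncard_pair haa]
      ext w
      exact ⟨fun hh => (hall w).1 hh.1, fun hh => ⟨(hall w).2 hh, hnb w ((hall w).2 hh)⟩⟩
  refine ⟨?_, h.hasSpecialSet hn hx hy hA ?_ fun S hS hSD => .inl (single S hS hSD),
    fun S a a' hS hJ => ?_⟩
  · have := hcl.left
    have := hcl.right
    have := h.ne
    have := hpq.ne
    simp only [List.nodup_cons, List.mem_cons, List.not_mem_nil, not_or, List.nodup_nil]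
    grind
  · have := h.adj
    rintro a (rfl | rfl | rfl | rfl) b (rfl | rfl | rfl | rfl) hab <;>
      first
        | exact absurd rfl hab
        | assumption
        | exact SimpleGraph.Adj.symm (by assumption)
  · by_cases hSD : S ⊆ D
    · obtain ⟨c, rfl, -⟩ := single S hS hSD
      exact absurd hJ.nontrivial Set.not_nontrivial_singleton
    · obtain ⟨s, hs, hsD⟩ := Set.not_subset.1 hSD
      have hS' := (h.isComponent_outside hx hy hA hS hs hsD).1
      obtain ⟨⟨s, hs, hsx⟩, s', hs', hsy⟩ := hS'.touches h.two h.ne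
      have e1 := hJ.attach s hs x hx hsx
      have e2 := hJ.attach s' hs' y hy hsy
      have := h.ne
      rcases e1 with rfl | rfl <;> rcases e2 with rfl | rfl
      · exact absurd rfl this
      · rfl
      · exact Set.pair_comm _ _
      · exact absurd rfl this

/-- The isolated vertex `t` is adjacent to the endpoint `x` of all bridges. -/
theorem mem_class6 (h : BigComponent G x y D) [Finite V] {n : ℕ} (hn : Nat.card V = n)
    {p q t : V} (hp : p ∈ D) (hq : q ∈ D) (hpq : G.Adj p q) (hxp : G.Adj x p) (hxq : G.Adj x q)
    (hyp : G.Adj y p) (hyq : G.Adj y q)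
    (hin : ∀ t ∈ D, t ≠ p → t ≠ q →
      (∀ w, G.Adj t w ↔ w = x ∨ w = p) ∨ ∀ w, G.Adj t w ↔ w = x ∨ w = q)
    (ht : t ∈ D) (htp : t ≠ p) (htq : t ≠ q) : G ∈ class6 V n := by
  obtain ⟨h1, h2, h3⟩ := h.special_four hn hp hq hpq hxp hxq hyp hyq fun t ht htp htq => by
    rcases hin t ht htp htq with hh | hh
    · exact ⟨x, p, hxp.ne, by simp, by simp, hh⟩
    · exact ⟨x, q, hxq.ne, by simp, by simp, hh⟩
  have hcl := h.comp.closedOff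
  refine ⟨x, y, p, q, h1, h2, h3, t, ⟨?_, fun w hw => ?_⟩, ?_⟩
  · rintro (rfl | rfl | rfl | rfl)
    exacts [hcl.left ht, hcl.right ht, htp rfl, htq rfl]
  · have e1 := fun hh : ∀ w, G.Adj t w ↔ w = x ∨ w = p => (hh w).1 hw
    have e2 := fun hh : ∀ w, G.Adj t w ↔ w = x ∨ w = q => (hh w).1 hw
    have := hin t ht htp htq
    simp only [Set.mem_insert_iff, Set.mem_singleton_iff]
    tauto
  · rcases hin t ht htp htq with hh | hh
    · exact (hh x).2 (.inl rfl)
    · exact (hh x).2 (.inl rfl)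

/-- The first alternative holds if some component of `G - {x, y}` other than `D` is a single vertex,
because this vertex is adjacent to `x`. -/
theorem mem_class6_or_class7 (h : BigComponent G x y D) [Finite V] {n : ℕ} (hn : Nat.card V = n)
    {p q : V} (hp : p ∈ D) (hq : q ∈ D) (hpq : G.Adj p q) (hxp : G.Adj x p) (hxq : G.Adj x q)
    (hyp : G.Adj y p) (hyq : G.Adj y q)
    (hin : ∀ t ∈ D, t ≠ p → t ≠ q → ∀ w, G.Adj t w ↔ w = p ∨ w = q) :
    G ∈ class6 V n ∪ class7 V n := by
  obtain ⟨h1, h2, h3⟩ := h.special_four hn hp hq hpq hxp hxq hyp hyq fun t ht htp htq =>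
    ⟨p, q, hpq.ne, by simp, by simp, hin t ht htp htq⟩
  by_cases hc : ∃ c, IsolatedOutside G {x, y, p, q} c ∧ c ∉ D
  · obtain ⟨c, hc, hcD⟩ := hc
    refine .inl ⟨x, y, p, q, h1, h2, h3, c, hc, ?_⟩
    have hcA := hc.1
    simp only [Set.mem_insert_iff, Set.mem_singleton_iff, not_or] at hcA
    refine (h.two.adj_iff_of_adj (o := x) (o' := y) (fun w hw => ?_) hcA.1 hcA.2.1 h.ne x).2
      (.inl rfl)
    have hwD : w ∉ D := fun hwD => by
      have := h.comp.closedOff.adj w hwD c hw.symm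
      tauto
    have := hc.2 hw
    simp only [Set.mem_insert_iff, Set.mem_singleton_iff] at this
    rcases this with hh | hh | rfl | rfl
    exacts [.inl hh, .inr hh, absurd hp hwD, absurd hq hwD]
  · push Not at hc
    refine .inr ⟨x, y, p, q, h1, h2, h3, fun c hc' => ?_⟩
    have hcA := hc'.1
    simp only [Set.mem_insert_iff, Set.mem_singleton_iff, not_or] at hcA
    ext w
    simpa using hin c (hc c hc') hcA.2.2.1 hcA.2.2.2 w

end BigComponent

/-- A component that becomes edgeless when its vertex `z` is deleted, all other components having no
path from `x` to `y` longer than three. The set `A` of the extremal graph is `{x, y, z}`. -/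
theorem exists_class_of_center [Finite V] {n : ℕ} (hn : Nat.card V = n) (h8 : 8 ≤ n)
    (h2 : TwoConnected G) {x y z : V} {D : Set V} (hxy : x ≠ y) (hD : IsComponent G {x, y}ᶜ D)
    (hz : z ∈ D) (hcover : ∀ u ∈ D, ∀ w ∈ D, G.Adj u w → u = z ∨ w = z)
    (short : ∀ S, IsComponent G {x, y}ᶜ S → S ≠ D → ∀ l, Link G S x y l → l.length ≤ 2) :
    ∃ H ∈ class1 V n 8 ∪ class2 V n 8 ∪ class3 V n 8, G ≤ H := by
  have hcl := hD.closedOff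
  have hA : ({x, y, z} : Set V).ncard = tOf 8 :=
    Set.ncard_eq_three.2 ⟨x, y, z, hxy, fun e => hcl.left (e ▸ hz), fun e => hcl.right (e ▸ hz),
      rfl⟩
  have hF : Frame G x y {x, y, z} D := by
    refine ⟨hxy, by simp, by simp, hcl, ?_, fun u hu w hw huw => ?_, fun S hS hSD => ?_⟩
    · rintro a (rfl | rfl | rfl)
      exacts [.inl rfl, .inr (.inl rfl), .inr (.inr hz)]
    · rcases hcover u hu w hw huw with rfl | rfl <;> simp
    · refine short S hS ?_
      rintro rfl
      exact Set.disjoint_left.1 hSD hz hz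
  by_cases hone : ∀ S T, IsComponent G {x, y}ᶜ S → IsComponent G {x, y}ᶜ T → Disjoint S D →
      Disjoint T D → S.Nontrivial → T.Nontrivial → S = T
  · obtain ⟨H, hH, hGH⟩ := hF.exists_class1_or_class2 hn h2 (.inr rfl) h8 hA hone
    exact ⟨H, .inl hH, hGH⟩
  · push Not at hone
    obtain ⟨S, T, hS, hT, hSD, hTD, hSn, hTn, hne⟩ := hone
    obtain ⟨H, hH, hGH⟩ := hF.exists_class3 hn h2 hA hne hS hT hSD hTD hSn hTn
    exact ⟨H, .inr hH, hGH⟩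

/-! ### The shape of the large component -/

namespace BigComponent

variable {x y : V} {D : Set V}

theorem not_four (h : BigComponent G x y D) {a b c d : V} (hn : [a, b, c, d].Nodup) (ha : a ∈ D)
    (hb : b ∈ D) (hc : c ∈ D) (hd : d ∈ D) (h1 : G.Adj x a) (h2 : G.Adj a b) (h3 : G.Adj b c)
    (h4 : G.Adj c d) (h5 : G.Adj d y) : False := by
  have := h.long [a, b, c, d] ⟨hn, by simp [ha, hb, hc, hd], by simp [h1, h2, h3, h4, h5]⟩
  simp at this

theorem not_five (h : BigComponent G x y D) {a b c d e : V} (hn : [a, b, c, d, e].Nodup)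
    (ha : a ∈ D) (hb : b ∈ D) (hc : c ∈ D) (hd : d ∈ D) (he : e ∈ D) (h1 : G.Adj x a)
    (h2 : G.Adj a b) (h3 : G.Adj b c) (h4 : G.Adj c d) (h5 : G.Adj d e) (h6 : G.Adj e y) :
    False := by
  have := h.long [a, b, c, d, e]
    ⟨hn, by simp [ha, hb, hc, hd, he], by simp [h1, h2, h3, h4, h5, h6]⟩
  simp at this

/-- A path from `x` through `K` to `o`, continued by the path `o, q, y` outside `K`, has length at most
four. -/
theorem length_left (h : BigComponent G x y D) {K : Set V} (hK : K ⊆ D) {o : V} {l q : List V}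
    (hl : Link G K x o l) (hq : (o :: (q ++ [y])).IsChain G.Adj) (hn : (o :: q).Nodup)
    (hqD : ∀ z ∈ o :: q, z ∈ D ∧ z ∉ K) : l.length + q.length + 1 ≤ 3 := by
  rw [List.nodup_cons] at hn
  have hq' : Link G (D \ K) o y q := ⟨hn.2, fun z hz => hqD z (by simp [hz]), hq⟩
  have ho := hqD o (by simp)
  have h1 := h.long _ ((hl.append hq' (fun v hv hv' => (hq'.mem v hv').2 (hl.mem v hv))
    (fun hh => ho.2 (hl.mem o hh)) hn.1).mono (by
      rintro v ((hv | hv) | rfl)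
      exacts [hK hv, hv.1, ho.1]))
  rw [List.length_append, List.length_cons] at h1
  omega

/-- The path `x, p, o`, continued through `K` to `o'` and then by `o', q, y`, has length at most
four. -/
theorem length_mid (h : BigComponent G x y D) {K : Set V} (hK : K ⊆ D) {o o' : V} {l p q : List V}
    (hl : Link G K o o' l) (hp : (x :: (p ++ [o])).IsChain G.Adj)
    (hq : (o' :: (q ++ [y])).IsChain G.Adj) (hn : (p ++ o :: o' :: q).Nodup)
    (hD : ∀ z ∈ p ++ o :: o' :: q, z ∈ D ∧ z ∉ K) : p.length + l.length + q.length + 2 ≤ 3 := by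
  simp only [List.nodup_append, List.nodup_cons, List.mem_cons, not_or] at hn
  have hp' : Link G (D \ K) x o p := ⟨hn.1, fun z hz => hD z (by simp [hz]), hp⟩
  have ho := hD o (by simp)
  have ho' := hD o' (by simp)
  have hol : o ∉ l := fun hh => ho.2 (hl.mem o hh)
  have h1 := hp'.append hl (fun v hv hv' => (hp'.mem v hv).2 (hl.mem v hv')) (fun hh => by
    have := hn.2.2 o hh o; tauto) hol
  have hq' : Link G (D \ K) o' y q := ⟨hn.2.1.2.2, fun z hz => hD z (by simp [hz]), hq⟩
  have h2 := h.long _ ((h1.append hq' (fun v hv hv' => by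
      rcases List.mem_append.1 hv with hv | hv
      · have := hn.2.2 v hv v; tauto
      · rcases List.mem_cons.1 hv with rfl | hv
        · exact hn.2.1.1.2 hv'
        · exact (hq'.mem v hv').2 (hl.mem v hv)) (fun hh => by
      rcases List.mem_append.1 hh with hv | hv
      · have := hn.2.2 o' hv o'; tauto
      · rcases List.mem_cons.1 hv with e | hv
        · exact hn.2.1.1.1 e.symm
        · exact ho'.2 (hl.mem o' hv)) hn.2.1.2.1).mono (by
      rintro v ((((hv | hv) | rfl) | hv) | rfl)
      exacts [hv.1, hK hv, ho.1, hv.1, ho'.1]))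
  simp only [List.length_append, List.length_cons] at h2
  omega

section path

variable {u v w : V}

/-- The attachments of a component of `D - {u, v, w}` are not consecutive on the path
`x, u, v, w, y`, and paths between attachments at distance two have length two. -/
theorem attachments (h : BigComponent G x y D) (hp : Link G D x y [u, v, w]) {K : Set V}
    (hK : IsComponent G (D \ {u, v, w}) K) {l : List V} (h1 : 1 ≤ l.length) :
    ¬ Link G K x u l ∧ ¬ Link G K u v l ∧ ¬ Link G K v w l ∧ ¬ Link G K w y l ∧
    (Link G K x v l → l.length ≤ 1) ∧ (Link G K u w l → l.length ≤ 1) ∧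
    (Link G K v y l → l.length ≤ 1) := by
  have hKD : K ⊆ D := fun k hk => (hK.1 hk).1
  have huD : u ∈ D ∧ u ∉ K := ⟨hp.mem u (by simp), fun hh => (hK.1 hh).2 (by simp)⟩
  have hvD : v ∈ D ∧ v ∉ K := ⟨hp.mem v (by simp), fun hh => (hK.1 hh).2 (by simp)⟩
  have hwD : w ∈ D ∧ w ∉ K := ⟨hp.mem w (by simp), fun hh => (hK.1 hh).2 (by simp)⟩
  obtain ⟨hxu, huv, hvw, hwy⟩ : G.Adj x u ∧ G.Adj u v ∧ G.Adj v w ∧ G.Adj w y := by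
    simpa using hp.chain
  obtain ⟨⟨huv', huw'⟩, hvw'⟩ : (u ≠ v ∧ u ≠ w) ∧ v ≠ w := by simpa using hp.nodup
  have hsw := h.swap
  refine ⟨fun hl => ?_, fun hl => ?_, fun hl => ?_, fun hl => ?_, fun hl => ?_, fun hl => ?_,
    fun hl => ?_⟩
  · have := h.length_left hKD hl (q := [v, w]) (by simp [huv, hvw, hwy]) hp.nodup
      (by simp [huD, hvD, hwD])
    simp only [List.length_cons, List.length_nil] at this
    omega
  · have := h.length_mid hKD hl (p := []) (q := [w]) (by simp [hxu]) (by simp [hvw, hwy])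
      (by simp [*]) (by simp [huD, hvD, hwD])
    simp only [List.length_cons, List.length_nil] at this
    omega
  · have := h.length_mid hKD hl (p := [u]) (q := []) (by simp [hxu, huv]) (by simp [hwy])
      (by simp [*]) (by simp [huD, hvD, hwD])
    simp only [List.length_cons, List.length_nil] at this
    omega
  · have := hsw.length_left hKD hl.reverse (q := [v, u])
      (by simp [huv.symm, hvw.symm, hxu.symm]) (by simp [huv'.symm, huw'.symm, hvw'.symm])
      (by simp [huD, hvD, hwD])
    simp only [List.length_reverse, List.length_cons, List.length_nil] at this
    omega
  · have := h.length_left hKD hl (q := [w]) (by simp [hvw, hwy]) (by simp [*])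
      (by simp [hvD, hwD])
    simp only [List.length_cons, List.length_nil] at this
    omega
  · have := h.length_mid hKD hl (p := []) (q := []) (by simp [hxu]) (by simp [hwy])
      (by simp [*]) (by simp [huD, hwD])
    simp only [List.length_nil] at this
    omega
  · have := hsw.length_left hKD hl.reverse (q := [u])
      (by simp [huv.symm, hxu.symm]) (by simp [huv'.symm]) (by simp [huD, hvD])
    simp only [List.length_reverse, List.length_cons, List.length_nil] at this
    omega

/-- A component of `D - {u, v, w}` has a neighbor on the path, because `D` is connected. -/
theorem exists_touch (h : BigComponent G x y D) (hp : Link G D x y [u, v, w]) {K : Set V}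
    (hK : IsComponent G (D \ {u, v, w}) K) : Touches G K u ∨ Touches G K v ∨ Touches G K w := by
  obtain ⟨k, hk⟩ := hK.nonempty
  obtain ⟨a, b, haD, hbD, ha, hb, hab⟩ := exists_crossing (S := K) h.comp.2.1.preconnected
    (hK.1 hk).1 (hp.mem u (by simp)) hk (fun hh => (hK.1 hh).2 (by simp))
  have hb' : b ∈ ({u, v, w} : Set V) := by
    by_contra hcon
    exact hb (hK.2.2 a ha b ⟨hbD, hcon⟩ hab)
  rcases hb' with rfl | rfl | rfl
  exacts [.inl ⟨a, ha, hab⟩, .inr (.inl ⟨a, ha, hab⟩), .inr (.inr ⟨a, ha, hab⟩)]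

/-- If a path of length at least three from `x` to `w` avoids `u` and `v`, then `w` is the only
neighbor of `y` in `D`. -/
theorem eq_of_long_link (h : BigComponent G x y D) (hp : Link G D x y [u, v, w]) {K : Set V}
    (hK : IsComponent G (D \ {u, v, w}) K) {l : List V} (hl : Link G K x w l)
    (hl2 : 2 ≤ l.length) : ∀ t ∈ D, G.Adj t y → t = w := by
  have hKD : K ⊆ D := fun k hk => (hK.1 hk).1
  have huD : u ∈ D ∧ u ∉ K := ⟨hp.mem u (by simp), fun hh => (hK.1 hh).2 (by simp)⟩
  have hvD : v ∈ D ∧ v ∉ K := ⟨hp.mem v (by simp), fun hh => (hK.1 hh).2 (by simp)⟩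
  have hwD : w ∈ D ∧ w ∉ K := ⟨hp.mem w (by simp), fun hh => (hK.1 hh).2 (by simp)⟩
  obtain ⟨hxu, huv, hvw, hwy⟩ : G.Adj x u ∧ G.Adj u v ∧ G.Adj v w ∧ G.Adj w y := by
    simpa using hp.chain
  obtain ⟨⟨huv', huw'⟩, hvw'⟩ : (u ≠ v ∧ u ≠ w) ∧ v ≠ w := by simpa using hp.nodup
  intro t ht hty
  by_contra htw
  by_cases htu : t = u
  · subst htu
    have := h.length_left hKD hl (q := [v, t]) (by simp [huv.symm, hvw.symm, hty])
      (by simp [huv'.symm, huw'.symm, hvw'.symm]) (by simp [huD, hvD, hwD])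
    simp only [List.length_cons, List.length_nil] at this
    omega
  by_cases htv : t = v
  · subst htv
    have := h.length_left hKD hl (q := [t]) (by simp [hvw.symm, hty])
      (by simp [hvw'.symm]) (by simp [hvD, hwD])
    simp only [List.length_cons, List.length_nil] at this
    omega
  obtain ⟨K', htK', hK'⟩ := exists_isComponent (G := G) (W := D \ {u, v, w}) (w := t)
    ⟨ht, by simp [htu, htv, htw]⟩
  have hy : Touches G K' y := ⟨t, htK', hty⟩
  have hwy' : ∀ K, IsComponent G (D \ {u, v, w}) K → Touches G K w → ¬ Touches G K y := by
    intro K hK h1 h2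
    obtain ⟨m, hm, hm1⟩ := h1.exists_link h2 hK.2.1
    exact (h.attachments hp hK hm1).2.2.2.1 hm
  have hKw : Touches G K w := by
    obtain ⟨l', b, rfl⟩ : ∃ l' b, l = l' ++ [b] :=
      ⟨l.dropLast, l.getLast (by rintro rfl; simp at hl2), (List.dropLast_append_getLast _).symm⟩
    have hch := hl.chain
    rw [List.append_assoc, ← List.cons_append, List.isChain_append] at hch
    exact ⟨b, hl.mem b (by simp), by simpa using hch.2.1⟩
  have hKK : ∀ m : List V, (∀ z ∈ m, z ∈ K') → ∀ z ∈ m, z ∈ D ∧ z ∉ K := by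
    intro m hm z hz
    refine ⟨(hK'.1 (hm z hz)).1, fun hh => ?_⟩
    have := hK'.eq_of_mem hK (hm z hz) hh
    subst this
    exact hwy' _ hK hKw hy
  have huK' : u ∉ K' := fun hh => (hK'.1 hh).2 (by simp)
  have hvK' : v ∉ K' := fun hh => (hK'.1 hh).2 (by simp)
  have hwK' : w ∉ K' := fun hh => (hK'.1 hh).2 (by simp)
  rcases h.exists_touch hp hK' with hh | hh | hh
  · obtain ⟨m, hm, hm1⟩ := hh.exists_link hy hK'.2.1
    have := h.length_left hKD hl (q := v :: u :: m)
      (by simpa [huv.symm, hvw.symm] using hm.chain) (by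
        have := fun hh => huK' (hm.mem u hh)
        have := fun hh => hvK' (hm.mem v hh)
        have := fun hh => hwK' (hm.mem w hh)
        have := hm.nodup
        simp only [List.nodup_cons, List.mem_cons]
        grind) (by
        have := hKK m hm.mem
        simp only [List.mem_cons]
        rintro z (rfl | rfl | rfl | hz)
        exacts [hwD, hvD, huD, this z hz])
    simp only [List.length_cons] at this
    omega
  · obtain ⟨m, hm, hm1⟩ := hh.exists_link hy hK'.2.1
    have := h.length_left hKD hl (q := v :: m)
      (by simpa [hvw.symm] using hm.chain) (by
        have := fun hh => hvK' (hm.mem v hh)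
        have := fun hh => hwK' (hm.mem w hh)
        have := hm.nodup
        simp only [List.nodup_cons, List.mem_cons]
        grind) (by
        have := hKK m hm.mem
        simp only [List.mem_cons]
        rintro z (rfl | rfl | hz)
        exacts [hwD, hvD, this z hz])
    simp only [List.length_cons] at this
    omega
  · exact hwy' _ hK' hh hy

/-- If `x` and `y` both have two neighbors in `D`, then the components of `D - {u, v, w}` are
single vertices. -/
theorem not_nontrivial (h : BigComponent G x y D)
    (hy : ¬ ∃ z ∈ D, ∀ t ∈ D, G.Adj t y → t = z) (hx : ¬ ∃ z ∈ D, ∀ t ∈ D, G.Adj t x → t = z)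
    (hp : Link G D x y [u, v, w]) {K : Set V} (hK : IsComponent G (D \ {u, v, w}) K) :
    ¬ K.Nontrivial := by
  rintro ⟨k₁, hk₁, k₂, hk₂, hk₁₂⟩
  have hcl := h.comp.closedOff
  have hKD : K ⊆ D := fun k hk => (hK.1 hk).1
  have huD : u ∈ D := hp.mem u (by simp)
  have hwD : w ∈ D := hp.mem w (by simp)
  have hnot : ∀ l, 2 ≤ l.length → ¬ Link G K x w l := fun l hl2 hl =>
    hy ⟨w, hwD, h.eq_of_long_link hp hK hl hl2⟩
  have hK' : IsComponent G (D \ {w, v, u}) K := by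
    rwa [show ({w, v, u} : Set V) = {u, v, w} by ext; simp; tauto]
  have hnot' : ∀ l, 2 ≤ l.length → ¬ Link G K y u l := fun l hl2 hl =>
    hx ⟨u, huD, h.swap.eq_of_long_link (by simpa using hp.reverse) hK' hl hl2⟩
  have hatt := fun {l : List V} (h1 : 1 ≤ l.length) => h.attachments hp hK h1
  have hlink : ∀ {k k' o o' : V}, k ∈ K → k' ∈ K → k ≠ k' → G.Adj k o → G.Adj k' o' →
      ∃ l, Link G K o o' l ∧ 2 ≤ l.length := by
    intro k k' o o' hk hk' hne h1 h2
    obtain ⟨l, hl, -, hl2⟩ := exists_link hK.2.1.preconnected hk hk' h1.symm h2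
    exact ⟨l, hl, hl2 hne⟩
  obtain ⟨k, k', o, o', hk, hk', ho, ho', hkk, hoo, e1, e2⟩ :=
    h.two.exists_disjoint_edges hk₁ hk₂ hk₁₂ (fun hh => hcl.left (hKD hh))
      (fun hh => hcl.right (hKD hh)) h.ne
  have hadj := h.comp.adj_of_diff hK
  have m1 := hadj k hk o e1 ho
  have m2 := hadj k' hk' o' e2 ho'
  simp only [Set.mem_insert_iff, Set.mem_singleton_iff] at m1 m2
  obtain ⟨l, hl, hl2⟩ := hlink hk hk' hkk e1 e2
  have hlr := hl.reverse
  have hlr2 : 2 ≤ l.reverse.length := by simpa using hl2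
  have a1 := hatt (l := l) (by omega)
  have a2 := hatt (l := l.reverse) (by omega)
  have b1 := hnot l hl2
  have b2 := hnot l.reverse hlr2
  have b3 := hnot' l hl2
  have b4 := hnot' l.reverse hlr2
  -- the two edges end at `x` and `y`
  have hxy : ∀ k k', k ∈ K → k' ∈ K → k ≠ k' → G.Adj k x → G.Adj k' y → False := by
    intro k k' hk hk' hkk e1 e2
    rcases h.exists_touch hp hK with hh | hh | hh
    · obtain ⟨m, hm, hm1⟩ := Touches.exists_link ⟨k, hk, e1⟩ hh hK.2.1
      exact (hatt hm1).1 hm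
    · obtain ⟨k'', hk'', e3⟩ := hh
      by_cases hk3 : k'' = k
      · subst hk3
        obtain ⟨m, hm, hm2⟩ := hlink hk hk' hkk e3 e2
        have := (hatt (l := m) (by omega)).2.2.2.2.2.2 hm
        omega
      · obtain ⟨m, hm, hm2⟩ := hlink hk hk'' (Ne.symm hk3) e1 e3
        have := (hatt (l := m) (by omega)).2.2.2.2.1 hm
        omega
    · obtain ⟨m, hm, hm1⟩ := hh.exists_link ⟨k', hk', e2⟩ hK.2.1
      exact (hatt hm1).2.2.2.1 hm
  rcases m1 with (rfl | rfl | rfl) | rfl | rfl <;> rcases m2 with (rfl | rfl | rfl) | rfl | rfl <;>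
    first
      | exact hoo rfl
      | exact a1.1 hl
      | exact a1.2.1 hl
      | exact a1.2.2.1 hl
      | exact a1.2.2.2.1 hl
      | exact a2.1 hlr
      | exact a2.2.1 hlr
      | exact a2.2.2.1 hlr
      | exact a2.2.2.2.1 hlr
      | exact absurd (a1.2.2.2.2.1 hl) (by omega)
      | exact absurd (a1.2.2.2.2.2.1 hl) (by omega)
      | exact absurd (a1.2.2.2.2.2.2 hl) (by omega)
      | exact absurd (a2.2.2.2.2.1 hlr) (by omega)
      | exact absurd (a2.2.2.2.2.2.1 hlr) (by omega)
      | exact absurd (a2.2.2.2.2.2.2 hlr) (by omega)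
      | exact b1 hl
      | exact b2 hlr
      | exact b3 hl
      | exact b4 hlr
      | exact hxy k k' hk hk' hkk e1 e2
      | exact hxy k' k hk' hk hkk.symm e2 e1

/-- The possible neighborhoods of a vertex of `D` off the path `u, v, w`. -/
theorem types (h : BigComponent G x y D)
    (hy : ¬ ∃ z ∈ D, ∀ t ∈ D, G.Adj t y → t = z) (hx : ¬ ∃ z ∈ D, ∀ t ∈ D, G.Adj t x → t = z)
    (hp : Link G D x y [u, v, w]) {t : V} (ht : t ∈ D) (htu : t ≠ u) (htv : t ≠ v) (htw : t ≠ w) :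
    (∀ s, G.Adj t s ↔ s = u ∨ s = w) ∨ (∀ s, G.Adj t s ↔ s = x ∨ s = w) ∨
    (∀ s, G.Adj t s ↔ s = y ∨ s = u) ∨
    (G.Adj t v ∧ ∀ s, G.Adj t s → s = x ∨ s = v ∨ s = y) := by
  have hcl := h.comp.closedOff
  obtain ⟨K, htK, hK⟩ := exists_isComponent (G := G) (W := D \ {u, v, w}) (w := t)
    ⟨ht, by simp [htu, htv, htw]⟩
  have hKt := (Set.not_nontrivial_iff.1 (h.not_nontrivial hy hx hp hK)).eq_singleton_of_mem htK
  subst hKt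
  have hnb : ∀ s, G.Adj t s → s = x ∨ s = u ∨ s = v ∨ s = w ∨ s = y := by
    intro s hs
    have := h.comp.adj_of_diff hK t rfl s hs (by simpa using hs.ne')
    simp only [Set.mem_insert_iff, Set.mem_singleton_iff] at this
    tauto
  have hin : G.Adj t u ∨ G.Adj t v ∨ G.Adj t w := by
    simpa [Touches] using h.exists_touch hp hK
  have hno : ∀ {o o'}, G.Adj t o → G.Adj t o' → Link G {t} o o' [t] := fun h1 h2 =>
    ⟨by simp, by simp, by simp [h1.symm, h2]⟩
  obtain ⟨a1, a2, a3, a4, -⟩ := h.attachments hp hK (l := [t]) (by simp)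
  have n1 : ¬ (G.Adj t x ∧ G.Adj t u) := fun hh => a1 (hno hh.1 hh.2)
  have n2 : ¬ (G.Adj t u ∧ G.Adj t v) := fun hh => a2 (hno hh.1 hh.2)
  have n3 : ¬ (G.Adj t v ∧ G.Adj t w) := fun hh => a3 (hno hh.1 hh.2)
  have n4 : ¬ (G.Adj t w ∧ G.Adj t y) := fun hh => a4 (hno hh.1 hh.2)
  by_cases h5 : G.Adj t v
  · refine .inr (.inr (.inr ⟨h5, fun s hs => ?_⟩))
    have := hnb s hs
    grind
  have htx : t ≠ x := fun e => hcl.left (e ▸ ht)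
  have hty : t ≠ y := fun e => hcl.right (e ▸ ht)
  by_cases h6 : G.Adj t u
  · by_cases h7 : G.Adj t w
    · refine .inl fun s => ⟨fun hs => ?_, ?_⟩
      · have := hnb s hs
        grind
      · rintro (rfl | rfl) <;> assumption
    · refine .inr (.inr (.inl (h.two.adj_iff_of_adj (fun s hs => ?_) hty htu
        (fun e => hcl.right (e ▸ hp.mem u (by simp))))))
      have := hnb s hs
      grind
  · refine .inr (.inl (h.two.adj_iff_of_adj (fun s hs => ?_) htx htw
        (fun e => hcl.left (e ▸ hp.mem w (by simp)))))
    have := hnb s hs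
    grind

end path

end BigComponent

/-! ### The extremal classes for `k = 8` -/

namespace BigComponent

variable {x y : V} {D : Set V} {u v w : V}

/-- The case that some vertex off the path is adjacent to `u` and `w`. Then all vertices of `D` other
than `u` and `w` have these two neighbors, and the special set is `{x, y, u, w}`. -/
theorem mem_class6_or_class7_of_adj (h : BigComponent G x y D) [Finite V] {n : ℕ}
    (hn : Nat.card V = n)
    (hy : ¬ ∃ z ∈ D, ∀ t ∈ D, G.Adj t y → t = z) (hx : ¬ ∃ z ∈ D, ∀ t ∈ D, G.Adj t x → t = z)
    (hp : Link G D x y [u, v, w]) {t : V} (ht : t ∈ D) (htu : t ≠ u) (htv : t ≠ v) (htw : t ≠ w)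
    (hNt : ∀ s, G.Adj t s ↔ s = u ∨ s = w) : G ∈ class6 V n ∪ class7 V n := by
  have hcl := h.comp.closedOff
  have hu : u ∈ D := hp.mem u (by simp)
  have hv : v ∈ D := hp.mem v (by simp)
  have hw : w ∈ D := hp.mem w (by simp)
  have hne : ∀ s ∈ D, s ≠ x ∧ s ≠ y := fun s hs =>
    ⟨fun e => hcl.left (e ▸ hs), fun e => hcl.right (e ▸ hs)⟩
  have hux := hne u hu
  have hvx := hne v hv
  have hwx := hne w hw
  have htx := hne t ht
  obtain ⟨hxu, huv, hvw, hwy⟩ : G.Adj x u ∧ G.Adj u v ∧ G.Adj v w ∧ G.Adj w y := by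
    simpa using hp.chain
  obtain ⟨⟨huv', huw'⟩, hvw'⟩ : (u ≠ v ∧ u ≠ w) ∧ v ≠ w := by simpa using hp.nodup
  have htu' : G.Adj t u := (hNt u).2 (.inl rfl)
  have htw' : G.Adj t w := (hNt w).2 (.inr rfl)
  -- `v` and `t` play the same role
  have hp' : Link G D x y [u, t, w] := by
    refine ⟨by simp; grind, ?_, by simp [hxu, htu'.symm, htw', hwy]⟩
    simp [hu, ht, hw]
  have hNv : ∀ s, G.Adj v s ↔ s = u ∨ s = w := by
    rcases h.types hy hx hp' hv huv'.symm htv.symm hvw' with hh | hh | hh | hh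
    · exact hh
    · have := (hh u).1 huv.symm
      grind
    · have := (hh w).1 hvw
      grind
    · have := hh.2 u huv.symm
      grind
  have hall : ∀ s ∈ D, s ≠ u → s ≠ w → ∀ r, G.Adj s r ↔ r = u ∨ r = w := by
    intro s hs hsu hsw
    by_cases hsv : s = v
    · exact hsv ▸ hNv
    by_cases hst : s = t
    · exact hst ▸ hNt
    rcases h.types hy hx hp hs hsu hsv hsw with hh | hh | hh | hh
    · exact hh
    · exfalso
      have hsx : G.Adj s x := (hh x).2 (.inl rfl)
      have hsw' : G.Adj s w := (hh w).2 (.inr rfl)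
      -- `y` has a second neighbor `r`, to which a path through `s`, `w`, `t` leads from `x`
      refine hy ⟨w, hw, fun r hr hry => ?_⟩
      by_contra hrw
      by_cases hru : r = u
      · subst hru
        exact h.not_four (a := s) (b := w) (c := t) (d := r) (by simp; grind) hs hw ht hr hsx.symm
          hsw' htw'.symm htu' hry
      have hrv : r ≠ v := by
        rintro rfl
        have := (hNv y).1 hry
        grind
      rcases h.types hy hx hp hr hru hrv hrw with hk | hk | hk | hk
      · have := (hk y).1 hry
        grind
      · have := (hk y).1 hry
        have := h.ne
        grind
      · have hru' : G.Adj r u := (hk u).2 (.inr rfl)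
        have hrs : r ≠ s := by
          rintro rfl
          have := (hh y).1 hry
          grind
        have hrt : r ≠ t := by
          rintro rfl
          have := (hNt y).1 hry
          grind
        exact h.not_five (a := s) (b := w) (c := t) (d := u) (e := r) (by simp; grind) hs hw ht hu
          hr hsx.symm hsw' htw'.symm htu' hru'.symm hry
      · have := (hNv r).1 hk.1.symm
        grind
    · exfalso
      have hsy : G.Adj s y := (hh y).2 (.inl rfl)
      have hsu' : G.Adj s u := (hh u).2 (.inr rfl)
      -- `x` has a second neighbor `r`, from which a path through `t`, `u`, `s` leads to `y`
      refine hx ⟨u, hu, fun r hr hrx => ?_⟩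
      by_contra hru
      by_cases hrw : r = w
      · subst hrw
        exact h.not_four (a := r) (b := t) (c := u) (d := s) (by simp; grind) hr ht hu hs hrx.symm
          htw'.symm htu' hsu'.symm hsy
      have hrv : r ≠ v := by
        rintro rfl
        have := (hNv x).1 hrx
        grind
      rcases h.types hy hx hp hr hru hrv hrw with hk | hk | hk | hk
      · have := (hk x).1 hrx
        grind
      · have hrw' : G.Adj r w := (hk w).2 (.inr rfl)
        have hrs : r ≠ s := by
          rintro rfl
          have := (hh x).1 hrx
          have := h.ne
          grind
        have hrt : r ≠ t := by
          rintro rfl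
          have := (hNt x).1 hrx
          grind
        exact h.not_five (a := r) (b := w) (c := t) (d := u) (e := s) (by simp; grind) hr hw ht hu
          hs hrx.symm hrw' htw'.symm htu' hsu'.symm hsy
      · have := (hk x).1 hrx
        have := h.ne
        grind
      · have := (hNv r).1 hk.1.symm
        grind
    · have := (hNv s).1 hh.1.symm
      grind
  have hyu : G.Adj y u := by
    push Not at hy
    obtain ⟨r, hr, hry, hrw⟩ := hy w hw
    by_cases hru : r = u
    · exact hru ▸ hry.symm
    · have := (hall r hr hru hrw y).1 hry
      grind
  have hxw : G.Adj x w := by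
    push Not at hx
    obtain ⟨r, hr, hrx, hru⟩ := hx u hu
    by_cases hrw : r = w
    · exact hrw ▸ hrx.symm
    · have := (hall r hr hru hrw x).1 hrx
      grind
  have huw : G.Adj u w := by
    refine h.cutsAdjacent u w {t} huw' ⟨by simp [htu.symm], by simp [htw.symm], ?_⟩ ⟨t, rfl⟩
      ⟨v, by simp [htv.symm], huv'.symm, hvw'⟩
    rintro _ rfl s hs
    exact .inr ((hNt s).1 hs)
  exact h.mem_class6_or_class7 hn hu hw huw hxu hxw hyu hwy.symm hall

/-- The case that no vertex off the path is adjacent to `u` and `w`, but one has the neighbors `x` and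
`w`. Then the special set is `{x, y, v, w}`, and the other vertices of `D`, including `u`, are adjacent
to `x` and one of `v` and `w`. -/
theorem mem_class6_of_adj (h : BigComponent G x y D) [Finite V] {n : ℕ} (hn : Nat.card V = n)
    (hy : ¬ ∃ z ∈ D, ∀ t ∈ D, G.Adj t y → t = z) (hx : ¬ ∃ z ∈ D, ∀ t ∈ D, G.Adj t x → t = z)
    (hp : Link G D x y [u, v, w])
    (hno : ¬ ∃ t ∈ D, t ≠ u ∧ t ≠ v ∧ t ≠ w ∧ ∀ s, G.Adj t s ↔ s = u ∨ s = w)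
    {t : V} (ht : t ∈ D) (htu : t ≠ u) (htv : t ≠ v) (htw : t ≠ w)
    (hNt : ∀ s, G.Adj t s ↔ s = x ∨ s = w) : G ∈ class6 V n := by
  have hcl := h.comp.closedOff
  have hu : u ∈ D := hp.mem u (by simp)
  have hv : v ∈ D := hp.mem v (by simp)
  have hw : w ∈ D := hp.mem w (by simp)
  have hne : ∀ s ∈ D, s ≠ x ∧ s ≠ y := fun s hs =>
    ⟨fun e => hcl.left (e ▸ hs), fun e => hcl.right (e ▸ hs)⟩
  have hux := hne u hu
  have hvx := hne v hv
  have hwx := hne w hw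
  have htx := hne t ht
  have hxy := h.ne
  obtain ⟨hxu, huv, hvw, hwy⟩ : G.Adj x u ∧ G.Adj u v ∧ G.Adj v w ∧ G.Adj w y := by
    simpa using hp.chain
  obtain ⟨⟨huv', huw'⟩, hvw'⟩ : (u ≠ v ∧ u ≠ w) ∧ v ≠ w := by simpa using hp.nodup
  have htx' : G.Adj t x := (hNt x).2 (.inl rfl)
  have htw' : G.Adj t w := (hNt w).2 (.inr rfl)
  have huy : ¬ G.Adj u y := fun huy =>
    h.not_four (a := t) (b := w) (c := v) (d := u) (by simp; grind) ht hw hv hu htx'.symm htw'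
      hvw.symm huv.symm huy
  -- the vertices off the path other than `t`
  have h14 : ∀ r ∈ D, r ≠ u → r ≠ v → r ≠ w → ¬ ∀ s, G.Adj r s ↔ s = y ∨ s = u := by
    intro r hr hru hrv hrw hh
    have hrt : r ≠ t := by
      rintro rfl
      have := (hh x).1 htx'
      grind
    exact h.not_five (a := t) (b := w) (c := v) (d := u) (e := r) (by simp; grind) ht hw hv hu hr
      htx'.symm htw' hvw.symm huv.symm ((hh u).2 (.inr rfl)).symm ((hh y).2 (.inl rfl))
  have h24 : ∀ r ∈ D, r ≠ u → r ≠ v → r ≠ w → G.Adj r v → ¬ G.Adj r y := by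
    intro r hr hru hrv hrw hrv' hry
    have hrt : r ≠ t := by
      rintro rfl
      have := (hNt y).1 hry
      grind
    exact h.not_four (a := t) (b := w) (c := v) (d := r) (by simp; grind) ht hw hv hr htx'.symm
      htw' hvw.symm hrv'.symm hry
  -- `y` has a neighbor in `D` other than `w`, and only `v` is left
  have hvy : G.Adj v y := by
    push Not at hy
    obtain ⟨r, hr, hry, hrw⟩ := hy w hw
    by_cases hrv : r = v
    · exact hrv ▸ hry
    have hru : r ≠ u := by
      rintro rfl
      exact huy hry
    exfalso
    have hy' : ¬ ∃ z ∈ D, ∀ t ∈ D, G.Adj t y → t = z := by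
      push Not
      exact hy
    rcases h.types hy' hx hp hr hru hrv hrw with hk | hk | hk | hk
    · have := (hk y).1 hry
      grind
    · have := (hk y).1 hry
      grind
    · exact h14 r hr hru hrv hrw hk
    · exact h24 r hr hru hrv hrw hk.1 hry
  have huw : ¬ G.Adj u w := fun huw =>
    h.not_four (a := t) (b := w) (c := u) (d := v) (by simp; grind) ht hw hu hv htx'.symm htw'
      huw.symm huv hvy
  have htypes : ∀ r ∈ D, r ≠ u → r ≠ v → r ≠ w →
      (∀ s, G.Adj r s ↔ s = x ∨ s = v) ∨ ∀ s, G.Adj r s ↔ s = x ∨ s = w := by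
    intro r hr hru hrv hrw
    rcases h.types hy hx hp hr hru hrv hrw with hk | hk | hk | hk
    · exact absurd ⟨r, hr, hru, hrv, hrw, hk⟩ hno
    · exact .inr hk
    · exact absurd hk (h14 r hr hru hrv hrw)
    · refine .inl (h.two.adj_iff_of_adj (fun s hs => ?_) (hne r hr).1 hrv hvx.1.symm)
      rcases hk.2 s hs with rfl | rfl | rfl
      exacts [.inl rfl, .inr rfl, absurd hs (h24 r hr hru hrv hrw hk.1)]
  have hNu : ∀ s, G.Adj u s ↔ s = x ∨ s = v := by
    refine h.two.adj_iff_of_adj (fun s hs => ?_) hux.1 huv' hvx.1.symm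
    by_contra hcon
    push Not at hcon
    have hsw : s ≠ w := by
      rintro rfl
      exact huw hs
    rcases hcl.adj u hu s hs with hsD | rfl | rfl
    · rcases htypes s hsD hs.ne' hcon.2 hsw with hk | hk
      · have := (hk u).1 hs.symm
        grind
      · have := (hk u).1 hs.symm
        grind
    · exact hcon.1 rfl
    · exact huy hs
  have hxv : G.Adj x v := by
    refine h.cutsAdjacent x v {u} hvx.1.symm ⟨by simp [hux.1.symm], by simp [huv'.symm], ?_⟩
      ⟨u, rfl⟩ ⟨w, by simp [huw'.symm], hwx.1, hvw'.symm⟩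
    rintro _ rfl s hs
    exact .inr ((hNu s).1 hs)
  have hxw : G.Adj x w := by
    refine h.cutsAdjacent x w {t} hwx.1.symm ⟨by simp [htx.1.symm], by simp [htw.symm], ?_⟩
      ⟨t, rfl⟩ ⟨v, by simp [htv.symm], hvx.1, hvw'⟩
    rintro _ rfl s hs
    exact .inr ((hNt s).1 hs)
  refine h.mem_class6 hn hv hw hvw hxv hxw hvy.symm hwy.symm (fun s hs hsv hsw => ?_) ht htv htw
  by_cases hsu : s = u
  · exact .inl (hsu ▸ hNu)
  · exact htypes s hs hsu hsv hsw

/-- If `x` or `y` has only one neighbor in `D`, then `G` is in the class with a special set of three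
vertices. Otherwise `BigComponent.types` lists the vertices off the path `u, v, w`: the first three
kinds lead to special sets of four vertices. If only the fourth kind occurs, then `v` is adjacent to
all vertices off the path, and `u` and `w` are not adjacent, so all edges in `D` contain `v`. If there
are no vertices off the path, the special set has five vertices. -/
theorem classify (h : BigComponent G x y D) [Finite V] {n : ℕ} (hn : Nat.card V = n)
    (hp : Link G D x y [u, v, w]) :
    (G ∈ class5 V n ∪ class6 V n ∪ class7 V n ∪ class8 V n) ∨
      ∃ z ∈ D, ∀ p ∈ D, ∀ q ∈ D, G.Adj p q → p = z ∨ q = z := by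
  have hcl := h.comp.closedOff
  have hu : u ∈ D := hp.mem u (by simp)
  have hv : v ∈ D := hp.mem v (by simp)
  have hw : w ∈ D := hp.mem w (by simp)
  have hne : ∀ s ∈ D, s ≠ x ∧ s ≠ y := fun s hs =>
    ⟨fun e => hcl.left (e ▸ hs), fun e => hcl.right (e ▸ hs)⟩
  obtain ⟨hxu, huv, hvw, hwy⟩ : G.Adj x u ∧ G.Adj u v ∧ G.Adj v w ∧ G.Adj w y := by
    simpa using hp.chain
  obtain ⟨⟨huv', huw'⟩, hvw'⟩ : (u ≠ v ∧ u ≠ w) ∧ v ≠ w := by simpa using hp.nodup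
  have hnt : D.Nontrivial := ⟨u, hu, v, hv, huv'⟩
  by_cases hy : ∃ z ∈ D, ∀ t ∈ D, G.Adj t y → t = z
  · obtain ⟨z, hz, hzy⟩ := hy
    exact .inl (.inl (.inl (.inl (h.mem_class5 hn hz hnt hzy))))
  by_cases hx : ∃ z ∈ D, ∀ t ∈ D, G.Adj t x → t = z
  · obtain ⟨z, hz, hzx⟩ := hx
    exact .inl (.inl (.inl (.inl (h.swap.mem_class5 hn hz hnt hzx))))
  by_cases h13 : ∃ t ∈ D, t ≠ u ∧ t ≠ v ∧ t ≠ w ∧ ∀ s, G.Adj t s ↔ s = u ∨ s = w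
  · obtain ⟨t, ht, htu, htv, htw, hNt⟩ := h13
    rcases h.mem_class6_or_class7_of_adj hn hy hx hp ht htu htv htw hNt with hh | hh
    · exact .inl (.inl (.inl (.inr hh)))
    · exact .inl (.inl (.inr hh))
  by_cases h03 : ∃ t ∈ D, t ≠ u ∧ t ≠ v ∧ t ≠ w ∧ ∀ s, G.Adj t s ↔ s = x ∨ s = w
  · obtain ⟨t, ht, htu, htv, htw, hNt⟩ := h03
    exact .inl (.inl (.inl (.inr (h.mem_class6_of_adj hn hy hx hp h13 ht htu htv htw hNt))))
  by_cases h14 : ∃ t ∈ D, t ≠ u ∧ t ≠ v ∧ t ≠ w ∧ ∀ s, G.Adj t s ↔ s = y ∨ s = u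
  · obtain ⟨t, ht, htu, htv, htw, hNt⟩ := h14
    refine .inl (.inl (.inl (.inr (h.swap.mem_class6_of_adj hn hx hy (by simpa using hp.reverse)
      ?_ ht htw htv htu hNt))))
    rintro ⟨t, ht, htu, htv, htw, hNt⟩
    exact h13 ⟨t, ht, htw, htv, htu, fun s => (hNt s).trans or_comm⟩
  have hrest : ∀ t ∈ D, t ≠ u → t ≠ v → t ≠ w →
      G.Adj t v ∧ ∀ s, G.Adj t s → s = x ∨ s = v ∨ s = y := by
    intro t ht htu htv htw
    rcases h.types hy hx hp ht htu htv htw with hk | hk | hk | hk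
    · exact absurd ⟨t, ht, htu, htv, htw, hk⟩ h13
    · exact absurd ⟨t, ht, htu, htv, htw, hk⟩ h03
    · exact absurd ⟨t, ht, htu, htv, htw, hk⟩ h14
    · exact hk
  by_cases ht : ∃ t ∈ D, t ≠ u ∧ t ≠ v ∧ t ≠ w
  · obtain ⟨t, ht, htu, htv, htw⟩ := ht
    obtain ⟨htv', hNt⟩ := hrest t ht htu htv htw
    have huw : ¬ G.Adj u w := by
      intro huw
      have htxy : G.Adj t x ∨ G.Adj t y := by
        obtain ⟨_, _, o, o', rfl, rfl, -, -, hoo, e1, e2⟩ := h.two.exists_two_attachments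
          (K := {t}) ⟨t, rfl⟩ (o₁ := u) (o₂ := v) (by simpa using htu.symm)
          (by simpa using htv.symm) huv'
        have m1 := hNt o e1
        have m2 := hNt o' e2
        grind
      rcases htxy with hh | hh
      · exact h.not_four (a := t) (b := v) (c := u) (d := w) (by simp; grind) ht hv hu hw hh.symm
          htv' huv.symm huw hwy
      · exact h.not_four (a := u) (b := w) (c := v) (d := t) (by simp; grind) hu hw hv ht hxu huw
          hvw.symm htv'.symm hh
    refine .inr ⟨v, hv, fun p hp q hq hpq => ?_⟩
    by_contra hcon
    push Not at hcon
    have key : ∀ p ∈ D, ∀ q ∈ D, p ≠ v → q ≠ v → G.Adj p q → p = u ∨ p = w := by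
      intro p hp q hq hpv hqv hpq
      by_contra hcon
      push Not at hcon
      have := (hrest p hp hcon.1 hpv hcon.2).2 q hpq
      have := hne q hq
      grind
    have e1 := key p hp q hq hcon.1 hcon.2 hpq
    have e2 := key q hq p hp hcon.2 hcon.1 hpq.symm
    rcases e1 with rfl | rfl <;> rcases e2 with rfl | rfl
    · exact G.irrefl hpq
    · exact huw hpq
    · exact huw hpq.symm
    · exact G.irrefl hpq
  · push Not at ht
    refine .inl (.inr (h.mem_class8 hn hp.nodup ?_))
    ext s
    simp only [Set.mem_insert_iff, Set.mem_singleton_iff]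
    constructor
    · intro hs
      have := ht s hs
      tauto
    · rintro (rfl | rfl | rfl) <;> assumption

end BigComponent

/-- Both nontrivial components carry a path of length at least three, so no component has a path longer
than four, and at most one component has a path of length four. -/
theorem Saturated.exists_class_of_separation [Finite V] {n : ℕ} (h : Saturated G 8)
    (h2 : TwoConnected G) (hn : Nat.card V = n) (h8 : 8 ≤ n) (hsep : HasEdgeSeparation G) :
    ∃ H ∈ extremalClass V n 8, G ≤ H := by
  obtain ⟨x, y, hxy, S₀, T₀, hST, hS₀, hT₀, hSn, hTn⟩ := hsep.exists_components
  have center : ∀ D z, IsComponent G {x, y}ᶜ D → z ∈ D →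
      (∀ p ∈ D, ∀ q ∈ D, G.Adj p q → p = z ∨ q = z) →
      (∀ S, IsComponent G {x, y}ᶜ S → S ≠ D → ∀ l, Link G S x y l → l.length ≤ 2) →
      ∃ H ∈ extremalClass V n 8, G ≤ H := by
    intro D z hD hz hcover hshort
    obtain ⟨H, hH, hGH⟩ := exists_class_of_center hn h8 h2 hxy hD hz hcover hshort
    exact ⟨H, .inl (.inl (.inl (.inl hH))), hGH⟩
  by_cases hlong : ∃ D, IsComponent G {x, y}ᶜ D ∧ ∃ l, Link G D x y l ∧ 3 ≤ l.length
  · obtain ⟨D, hD, l, hl, hl3⟩ := hlong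
    obtain ⟨E, hE, hED⟩ := exists_ne_component hST D
    have hE' : IsComponent G {x, y}ᶜ E ∧ E.Nontrivial := by
      rcases hE with rfl | rfl <;> exact ⟨by assumption, by assumption⟩
    have hDlong : ∀ l, Link G D x y l → l.length ≤ 3 := by
      intro l hl
      obtain ⟨m, hm, -, h1'⟩ := hE'.1.exists_link h2 hxy
      have := h1' hE'.2
      have := h.1.links_lt hxy hD hE'.1 hED hl hm (by omega)
      omega
    have hshort : ∀ S, IsComponent G {x, y}ᶜ S → S ≠ D → ∀ l, Link G S x y l → l.length ≤ 2 := by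
      intro S hS hSD m hm
      have := h.1.links_lt hxy hS hD hSD hm hl (by omega)
      omega
    have hbig : BigComponent G x y D := ⟨h, h2, hxy, hD, hDlong, hshort, E, hE'.1, hED.symm, hE'.2⟩
    obtain ⟨u, v, w, rfl⟩ := List.length_eq_three.1 (le_antisymm (hDlong l hl) hl3)
    rcases hbig.classify hn hl with (((hG | hG) | hG) | hG) | ⟨z, hz, hcover⟩
    · exact ⟨G, .inl (.inl (.inl (.inr hG))), le_rfl⟩
    · exact ⟨G, .inl (.inl (.inr hG)), le_rfl⟩
    · exact ⟨G, .inl (.inr hG), le_rfl⟩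
    · exact ⟨G, .inr hG, le_rfl⟩
    · exact center D z hD hz hcover hshort
  · have hshort : ∀ S, IsComponent G {x, y}ᶜ S → ∀ l, Link G S x y l → l.length ≤ 2 := by
      intro S hS l hl
      by_contra hcon
      exact hlong ⟨S, hS, l, hl, by omega⟩
    rcases hS₀.pair_or_star h2 hxy hSn (hshort S₀ hS₀) with ⟨s, s', hss, rfl⟩ | ⟨z, a, hz, ha, hall⟩
    · refine center _ s hS₀ (by simp) (fun p hp q hq hpq => ?_) fun S hS _ => hshort S hS
      have := hpq.ne
      simp only [Set.mem_insert_iff, Set.mem_singleton_iff] at hp hq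
      grind
    · refine center _ z hS₀ hz (fun p hp q hq hpq => ?_) fun S hS _ => hshort S hS
      by_contra hcon
      push Not at hcon
      have hqa := ((hall p hp hcon.1 q).1 hpq).resolve_left hcon.2
      subst hqa
      rcases ha with rfl | rfl
      exacts [hS₀.closedOff.left hq, hS₀.closedOff.right hq]

theorem TwoConnected.exists_class_eight [Finite V] {n : ℕ} (h2 : TwoConnected G)
    (hn : Nat.card V = n) (h8 : 8 ≤ n) (hs : Saturated G 8)
    (he : 2 * n + 4 ≤ G.edgeSet.ncard) : ∃ H ∈ extremalClass V n 8, G ≤ H := by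
  by_cases hsep : HasEdgeSeparation G
  · exact hs.exists_class_of_separation h2 hn h8 hsep
  obtain ⟨A, B, hAB, hoff⟩ :=
    exists_core_eight n hn h8 h2 hs.1 (hs.cutsAdjacent h2 (by omega)) hsep he
  rcases hoff with ⟨p, q, hp, hq, hpq, hoff⟩ | ⟨a, b, ha, hb, -, hoff, hleaf⟩
  · obtain ⟨H, hH, hGH⟩ := exists_class1 hn (by omega) h8 (A := A) (C := {p, q})
      hAB.card_left (Set.ncard_pair hpq) (by
        rw [Set.disjoint_right]
        rintro c (rfl | rfl)
        exacts [hp, hq]) (fun u w hu hw huw => by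
        rcases hoff u w hu hw huw with ⟨rfl, rfl⟩ | ⟨rfl, rfl⟩ <;> simp)
    exact ⟨H, .inl (.inl (.inl (.inl (.inl (.inl hH))))), hGH⟩
  · obtain ⟨H, hH, hGH⟩ := exists_class2 (k := 8) hn hAB.card_left ha hb hoff hleaf
    exact ⟨H, .inl (.inl (.inl (.inl (.inl (.inr hH))))), hGH⟩

end LongCycles

theorem theorem11 {V : Type*} [Finite V] (n : ℕ) (hn : Nat.card V = n) (G : SimpleGraph V)
    (h2 : LongCycles.TwoConnected G) :
    (∀ k : ℕ, 4 ≤ k → k ≤ 8 → k ≤ n → LongCycles.NoLongCycle G k →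
      (7 ≤ k ∧ G.edgeSet.ncard ≤ LongCycles.h n k (LongCycles.tOf k - 1)) ∨
        ∃ H ∈ LongCycles.extremalClass V n k, G ≤ H) ∧
    (6 ≤ n → (LongCycles.NoLongCycle G 6 ↔ ∃ H ∈ LongCycles.extremalClass V n 6, G ≤ H)) := by
  refine ⟨fun k hk4 hk8 hkn h => ?_, fun h6 => ⟨fun h => h2.exists_class_six hn h6 h, ?_⟩⟩
  · obtain ⟨H, hGH, hH⟩ := LongCycles.exists_saturated h
    have h2H := h2.mono hGH
    have hcut := hH.cutsAdjacent h2H (by omega)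
    have he : G.edgeSet.ncard ≤ H.edgeSet.ncard :=
      Set.ncard_le_ncard (SimpleGraph.edgeSet_mono hGH)
    interval_cases k
    · exact absurd h (h2.not_noLongCycle_four (by omega))
    · exact .inr (h2.exists_class_five hn hkn h)
    · exact .inr (h2.exists_class_six hn hkn h)
    · by_cases hle : H.edgeSet.ncard ≤ 2 * n
      · refine .inl ⟨le_rfl, he.trans (hle.trans ?_)⟩
        have : LongCycles.h n 7 (LongCycles.tOf 7 - 1) = 10 + 2 * (n - 7 + 2) := rfl
        omega
      · obtain ⟨H', hH', hHH'⟩ := h2H.exists_class_seven hn hkn hH.1 hcut (by omega)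
        exact .inr ⟨H', hH', hGH.trans hHH'⟩
    · by_cases hle : H.edgeSet.ncard ≤ 2 * n + 3
      · refine .inl ⟨by omega, he.trans (hle.trans ?_)⟩
        have : LongCycles.h n 8 (LongCycles.tOf 8 - 1) = 15 + 2 * (n - 8 + 2) := rfl
        omega
      · obtain ⟨H', hH', hHH'⟩ := h2H.exists_class_eight hn hkn hH (by omega)
        exact .inr ⟨H', hH', hGH.trans hHH'⟩
  · rintro ⟨H, hH | hH, hGH⟩
    · exact (LongCycles.noLongCycle_of_mem_class1 hH).of_le hGH
    · exact (LongCycles.noLongCycle_of_mem_class2 hH).of_le hGH
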